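/- **Setting.** Let $c<2$ be real, $N\ge 1$, $h=2\pi/N$, and consider the $2N$ nodes $x_{j\pm1/4}=x_j\pm h/4$, $x_j=h(j-1)+h/2$, $j=1,\dots,N$ ($j$ taken cyclically). Let $Q$ be the operator on grid functions given by $$(Qu)_{j-\frac14}=\tfrac{1}{12(h/2)^2}\big[(-u_{j-\frac54}+16u_{j-\frac34}-30u_{j-\frac14}+16u_{j+\frac14}-u_{j+\frac34})+c\,\delta_j\big],$$ $$(Qu)_{j+\frac14}=\tfrac{1}{12(h/2)^2}\big[(-u_{j-\frac34}+16u_{j-\frac14}-30u_{j+\frac14}+16u_{j+\frac34}-u_{j+\frac54})-c\,\delta_j\big],$$ $\delta_j=u_{j-\frac54}-5u_{j-\frac34}+10u_{j-\frac14}-10u_{j+\frac14}+5u_{j+\frac34}-u_{j+\frac54}$. Let $\|v\|_h^2=\frac h2\sum|v|^2$ (sum over all nodes), and let $e^{i\omega\mathbf x}$ be the grid function of $e^{i\omega x}$. For an integer $\omega$ with $|\omega|\le N/2$ put $\nu=\omega-N$ if $\omega>0$ and $\nu=\omega+N$ if $\omega\le0$. Let $v$ denote a solution of $dv/dt=Qv$,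 $t\ge0$. Then the following hold for all $N\ge1$ and all integers $|\omega|\le N/2$. 1. **Aliasing.** $e^{i\omega x_{j-1/4}}=\pm i\,e^{i\nu x_{j-1/4}}$ and $e^{i\omega x_{j+1/4}}=\mp i\,e^{i\nu x_{j+1/4}}$, with the upper signs for $\omega>0$ and the lower signs for $\omega<0$. 2. **Action of $Q$.** $Qe^{i\omega\mathbf x}=\mathrm{diag}(\mu_1,\mu_2,\mu_1,\mu_2,\dots)e^{i\omega\mathbf x}$ and $Qe^{i\nu\mathbf x}=\mathrm{diag}(\sigma_1,\sigma_2,\dots)e^{i\nu\mathbf x}$, where, with $P=(6c-2)\cos(h\omega)+10c-30$ and $R=(32-15c)\cos\frac{h\omega}2-c\cos\frac{3h\omega}2$, $$\mu_{1,2}=\tfrac1{3h^2}\big[P+R\mp32ic\sin^5\tfrac{h\omega}4\cos\tfrac{h\omega}4\big],\qquad \sigma_{1,2}=\tfrac1{3h^2}\big[P-R\pm32ic\sin\tfrac{h\omega}4\cos^5\tfrac{h\omega}4\big].$$ 3. **Diagonalization.** Let $\Delta=\sqrt2\,[4(3c-8)(5c-8)\cos(h\omega)+c(9c-16)\cos(2h\omega)+c(59c-240)+256]^{1/2}$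 and $\hat Q_{1,2}(\omega)=\frac{P\pm\Delta}{3h^2}$. If $c\ne0$ and $\omega\neq0$, let $D=32c\sin\frac{\omega h}4\cos^5\frac{\omega h}4$, $\Omega=2\cos\frac{\omega h}2\,(-16+7c+c\cos(\omega h))/D$ and $r_{1,2}=(\Omega\pm\Delta/D)\,i$; then $\mu_1-\sigma_1r_k=\hat Q_k(1-r_k)$ and $\mu_2+\sigma_2r_k=\hat Q_k(1+r_k)$ for $k=1,2$. Let $s=\operatorname{sgn}\omega$ and $$(\alpha_1,\beta_1)=\frac{(1,\,-is\,r_1)}{\sqrt{1+|r_1|^2}},\qquad(\alpha_2,\beta_2)=\frac{(|r_2|/r_2,\,-is|r_2|)}{\sqrt{1+|r_2|^2}},$$ and $(\alpha_1,\beta_1)=(1,0)$, $(\alpha_2,\beta_2)=(0,1)$ if $c=0$ or $\omega=0$. Then $|\alpha_k|^2+|\beta_k|^2=1$, and $\psi_k(\omega)=(\alpha_ke^{i\omega\mathbf x}+\beta_ke^{i\nu\mathbf x})/\sqrt{2\pi}$ satisfies $Q\psi_k(\omega)=\hat Q_k(\omega)\psi_k(\omega)$. The $2N$ vectors $\psi_k(\omega)$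 with $-N/2<\omega\le N/2$, $k=1,2$, form a basis of the space of grid functions. 4. **Eigenvalue expansions.** There is a constant $C=C(c)$, independent of $N$ and $\omega$, such that $$\Big|\hat Q_1(\omega)+\omega^2+\tfrac{(4+13c)\omega^6h^4}{2880(c-2)}\Big|\le C\omega^8h^6,\qquad\Big|\hat Q_2(\omega)-\tfrac{32(c-2)}{3h^2}+\tfrac{(6c-5)\omega^2}{3}-\tfrac{(3c-1)\omega^4h^2}{18}\Big|\le C\omega^6h^4 .$$ 5. **Semi-discrete solution.** For every initial grid function the problem $dv/dt=Qv$, $t\ge0$, has exactly one solution. If $v(0)=e^{i\omega\mathbf x}$, then for every $t\ge0$ there are real $a,b$ with $v(t)=a\,e^{i\omega\mathbf x}+b\,e^{i\nu\mathbf x}$ and $$\Big|a-e^{-\omega^2t}\Big(1-\tfrac{(4+13c)\omega^6t\,h^4}{2880(c-2)}\Big)\Big|\le C(|\omega|h)^6,\qquad\Big|b+\tfrac{c(|\omega|h)^5}{1024(c-2)}\big(e^{-\omega^2t}-e^{\hat Q_2(\omega)t}\big)\Big|\le C(|\omega|h)^6,$$ with $C=C(c)$ independent of $N,\omega,t$.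 At fixed $\omega$ and $t>0$ the same holds without the term $e^{\hat Q_2(\omega)t}$, with both right-hand sides replaced by $C(c,\omega,t)h^6$. 6. **Global error, Fourier data.** For fixed $\omega$ and $t>0$, with $v(0)=e^{i\omega\mathbf x}$ and $E(t)=e^{-\omega^2t}e^{i\omega\mathbf x}-v(t)$, $$\|E(t)\|_h=\sqrt{2\pi}\,\tfrac{|4+13c|\,\omega^6t}{2880(2-c)}e^{-\omega^2t}h^4+O(h^5),$$ and if $c=-4/13$ then $\|E(t)\|_h=\sqrt{2\pi}\,\frac{|c||\omega|^5}{1024(2-c)}e^{-\omega^2t}h^5+O(h^6)$; the implied constants depend on $c,\omega,t$ only. So the order is exactly $4$ if $c\ne-4/13$ and exactly $5$ if $c=-4/13$ (for $\omega\ne0$). 7. **Global error, smooth data.** Let $u$ be a classical $2\pi$-periodic solution of $u_t=u_{xx}$, continuous up to $t=0$, with $u(\cdot,0)=f\in C^\infty$, let $v(0)$ be the projection of $f$ onto the grid, and let $E(t)$ be the projection of $u(\cdot,t)$ onto the grid minus $v(t)$. There is a constant $C$ depending only on $c$ and $u$ such that for all $N\ge1$ and $t\ge0$: $\|E(t)\|_h\le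 Ch^4$, and $\|E(t)\|_h\le Ch^5$ if $c=-4/13$. 8. **Truncation error.** For $w\in C^\infty$, $2\pi$-periodic, let $T_e=w''-Qw$ on the grid. With constants depending only on $c$ and $w$, $\|T_e\|_h\le Ch^3$, and at every node $(T_e)_{j\mp1/4}=\pm\frac{c\,h^3}{96}w^{(5)}(x_{j\mp1/4})+O(h^4)$. For $w=e^{i\omega x}$ with any fixed integer $\omega$, for all $N\ge1$, $\|T_e\|_h=\sqrt{2\pi}\,\frac{|c||\omega|^5}{96}h^3+O(h^4)$, so the truncation error is only of order $3$ when $c\ne0$, $\omega\ne0$ (error inhibition). -/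

import Mathlib

noncomputable section

namespace BFD

open Complex (I exp)

/-- Grid functions: `(j, 0)` is the left node and `(j, 1)` the right node of the `j`-th of `N`
cells of the periodic interval `[0, 2π)`. Cells are numbered from `0`, cyclically. -/
abbrev Grid (N : ℕ) : Type := ZMod N × Fin 2 → ℂ

/-- The cell size `h = 2π / N`. -/
def meshSize (N : ℕ) : ℝ := 2 * Real.pi / N

/-- The node `x_j - h/4` (second index `0`) or `x_j + h/4` (second index `1`), where
`x_j = h j + h/2` is the centre of the `j`-th cell. -/
def node (N : ℕ) (p : ZMod N × Fin 2) : ℝ :=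
  meshSize N * (p.1.val : ℝ) + meshSize N / 2 +
    (if p.2 = 0 then -(meshSize N / 4) else meshSize N / 4)

/-- Projection of a function onto the grid. -/
def proj (N : ℕ) (w : ℝ → ℂ) : Grid N := fun p => w (node N p)

/-- The discrete `L²` norm; neighbouring nodes are `h / 2` apart. -/
def gridNorm (N : ℕ) [NeZero N] (v : Grid N) : ℝ :=
  Real.sqrt (meshSize N / 2 * ∑ p, ‖v p‖ ^ 2)

/-- The periodic two-point block finite difference operator `Q` with parameter `c`. -/
def blockOp (c : ℝ) (N : ℕ) : Grid N →ₗ[ℂ] Grid N where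
  toFun u := fun p =>
    let j := p.1
    1 / (12 * ((meshSize N : ℂ) / 2) ^ 2) *
      (if p.2 = 0 then
        (-u (j - 1, 0) + 16 * u (j - 1, 1) - 30 * u (j, 0) + 16 * u (j, 1) - u (j + 1, 0)) +
          c * (u (j - 1, 0) - 5 * u (j - 1, 1) + 10 * u (j, 0) - 10 * u (j, 1)
            + 5 * u (j + 1, 0) - u (j + 1, 1))
      else
        (-u (j - 1, 1) + 16 * u (j, 0) - 30 * u (j, 1) + 16 * u (j + 1, 0) - u (j + 1, 1)) -
          c * (u (j - 1, 0) - 5 * u (j - 1, 1) + 10 * u (j, 0) - 10 * u (j, 1)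
            + 5 * u (j + 1, 0) - u (j + 1, 1)))
  map_add' u v := by
    ext p
    simp only [Pi.add_apply]
    split_ifs <;> ring
  map_smul' a u := by
    ext p
    simp only [Pi.smul_apply, smul_eq_mul, RingHom.id_apply]
    split_ifs <;> ring

/-- `v` solves the semi-discrete problem `dv/dt = Q v` for `t ≥ 0` with initial value `v₀`. -/
def IsSemidiscreteSolution (c : ℝ) (N : ℕ) [NeZero N] (v₀ : Grid N) (v : ℝ → Grid N) : Prop :=
  v 0 = v₀ ∧ ∀ t : ℝ, 0 ≤ t → HasDerivWithinAt v (blockOp c N (v t)) (Set.Ici 0) t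

/-- `u` (written `u x t`) is a classical solution, `2π`-periodic in `x`, of `u_t = u_xx` for
`t > 0` that attains the initial value `f` continuously. -/
structure IsHeatSolution (f : ℝ → ℂ) (u : ℝ → ℝ → ℂ) : Prop where
  initial : ∀ x, u x 0 = f x
  periodic : ∀ t, 0 ≤ t → Function.Periodic (fun x => u x t) (2 * Real.pi)
  continuousOn : ContinuousOn (fun p : ℝ × ℝ => u p.1 p.2) (Set.univ ×ˢ Set.Ici 0)
  contDiff : ∀ t, 0 < t → ContDiff ℝ 2 (fun x => u x t)
  continuousOn_xx : ContinuousOn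
    (fun p : ℝ × ℝ => iteratedDeriv 2 (fun x => u x p.2) p.1) (Set.univ ×ˢ Set.Ioi 0)
  heat : ∀ t, 0 < t → ∀ x,
    HasDerivAt (fun s => u x s) (iteratedDeriv 2 (fun y => u y t) x) t

/-- The global error `u - v` at time `t`. -/
def globalError (N : ℕ) (u : ℝ → ℝ → ℂ) (v : ℝ → Grid N) (t : ℝ) : Grid N :=
  proj N (fun x => u x t) - v t

/-- The local truncation error `w'' - Q w` on the grid. -/
def truncError (c : ℝ) (N : ℕ) (w : ℝ → ℂ) : Grid N :=
  proj N (iteratedDeriv 2 w) - blockOp c N (proj N w)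

/-- The Fourier mode `x ↦ exp (i ω x)`. -/
def wave (ω : ℤ) (x : ℝ) : ℂ := exp (I * ω * x)

/-- The heat solution `exp (-ω² t) exp (i ω x)`. -/
def waveSol (ω : ℤ) (x t : ℝ) : ℂ := (Real.exp (-(ω : ℝ) ^ 2 * t) : ℂ) * wave ω x

/-- The Fourier mode on the grid. -/
def mode (N : ℕ) (ω : ℤ) : Grid N := proj N (wave ω)

/-- The aliased high frequency `ν` of a low frequency `ω` (`ν = N` for `ω = 0`). -/
def highFreq (N : ℕ) (ω : ℤ) : ℤ := if 0 < ω then ω - N else ω + N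

/-- `diag(a, b, a, b, …) v`. -/
def diagMul {N : ℕ} (a b : ℂ) (v : Grid N) : Grid N :=
  fun p => (if p.2 = 0 then a else b) * v p

section Symbols

variable (c h ω : ℝ)

def mu1 : ℂ :=
  1 / (3 * (h : ℂ) ^ 2) *
    (((32 - 15 * c) * Real.cos (h * ω / 2) + (6 * c - 2) * Real.cos (h * ω)
        - c * Real.cos (3 * h * ω / 2) + 10 * c - 30 : ℝ)
      - 32 * I * c * (Real.sin (h * ω / 4) ^ 5 * Real.cos (h * ω / 4) : ℝ))

def mu2 : ℂ :=
  1 / (3 * (h : ℂ) ^ 2) *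
    (((32 - 15 * c) * Real.cos (h * ω / 2) + (6 * c - 2) * Real.cos (h * ω)
        - c * Real.cos (3 * h * ω / 2) + 10 * c - 30 : ℝ)
      + 32 * I * c * (Real.sin (h * ω / 4) ^ 5 * Real.cos (h * ω / 4) : ℝ))

def sigma1 : ℂ :=
  1 / (3 * (h : ℂ) ^ 2) *
    (((15 * c - 32) * Real.cos (h * ω / 2) + c * Real.cos (3 * h * ω / 2)
        + (6 * c - 2) * Real.cos (h * ω) + 10 * c - 30 : ℝ)
      + 32 * I * c * (Real.sin (h * ω / 4) * Real.cos (h * ω / 4) ^ 5 : ℝ))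

def sigma2 : ℂ :=
  1 / (3 * (h : ℂ) ^ 2) *
    (((15 * c - 32) * Real.cos (h * ω / 2) + c * Real.cos (3 * h * ω / 2)
        + (6 * c - 2) * Real.cos (h * ω) + 10 * c - 30 : ℝ)
      - 32 * I * c * (Real.sin (h * ω / 4) * Real.cos (h * ω / 4) ^ 5 : ℝ))

/-- `Δ`. -/
def Delta : ℝ :=
  Real.sqrt 2 * Real.sqrt
    (4 * (3 * c - 8) * (5 * c - 8) * Real.cos (h * ω) + c * (9 * c - 16) * Real.cos (2 * h * ω)
      + c * (59 * c - 240) + 256)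

/-- The eigenvalue `Q̂₁(ω)`. -/
def Qhat1 : ℝ := ((6 * c - 2) * Real.cos (h * ω) + 10 * c - 30 + Delta c h ω) / (3 * h ^ 2)

/-- The eigenvalue `Q̂₂(ω)`. -/
def Qhat2 : ℝ := ((6 * c - 2) * Real.cos (h * ω) + 10 * c - 30 - Delta c h ω) / (3 * h ^ 2)

/-- The common denominator of `r₁` and `r₂`. -/
def rDen : ℝ := 32 * c * Real.sin (ω * h / 4) * Real.cos (ω * h / 4) ^ 5

/-- `Ω`. -/
def Omega : ℝ :=
  2 * Real.cos (ω * h / 2) * (-16 + 7 * c + c * Real.cos (ω * h)) / rDen c h ω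

def r1 : ℂ := ((Omega c h ω + Delta c h ω / rDen c h ω : ℝ) : ℂ) * I

def r2 : ℂ := ((Omega c h ω - Delta c h ω / rDen c h ω : ℝ) : ℂ) * I

end Symbols

/-- The normalized coefficients `(α₁, β₁)` of `ψ₁(ω)`; here `r = i sgn(ω) β / α`. For `c = 0` or
`ω = 0` the two modes decouple and are themselves eigenvectors. -/
def coeff1 (c h : ℝ) (ω : ℤ) : ℂ × ℂ :=
  if c = 0 ∨ ω = 0 then (1, 0)
  else (1 / (Real.sqrt (1 + ‖r1 c h ω‖ ^ 2) : ℂ),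
    -I * (ω.sign : ℂ) * r1 c h ω / (Real.sqrt (1 + ‖r1 c h ω‖ ^ 2) : ℂ))

/-- The normalized coefficients `(α₂, β₂)` of `ψ₂(ω)`. -/
def coeff2 (c h : ℝ) (ω : ℤ) : ℂ × ℂ :=
  if c = 0 ∨ ω = 0 then (0, 1)
  else ((‖r2 c h ω‖ : ℂ) / r2 c h ω / (Real.sqrt (1 + ‖r2 c h ω‖ ^ 2) : ℂ),
    -I * (ω.sign : ℂ) * (‖r2 c h ω‖ : ℂ) / (Real.sqrt (1 + ‖r2 c h ω‖ ^ 2) : ℂ))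

/-- The combination `α exp(iωx)/√(2π) + β exp(iνx)/√(2π)` of a low mode and its aliased high
mode. -/
def combo (N : ℕ) (ω : ℤ) (ab : ℂ × ℂ) : Grid N :=
  (ab.1 / (Real.sqrt (2 * Real.pi) : ℂ)) • mode N ω +
    (ab.2 / (Real.sqrt (2 * Real.pi) : ℂ)) • mode N (highFreq N ω)

/-- The eigenvectors `ψ₁(ω)` (`k = 0`) and `ψ₂(ω)` (`k = 1`). -/
def psi (c : ℝ) (N : ℕ) (ω : ℤ) (k : Fin 2) : Grid N :=
  combo N ω (if k = 0 then coeff1 c (meshSize N) ω else coeff2 c (meshSize N) ω)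

/-- The eigenvalues `Q̂₁(ω)` (`k = 0`) and `Q̂₂(ω)` (`k = 1`). -/
def Qhat (c : ℝ) (N : ℕ) (ω : ℤ) (k : Fin 2) : ℝ :=
  if k = 0 then Qhat1 c (meshSize N) ω else Qhat2 c (meshSize N) ω

/-- A set of `N` low frequencies, one for each block. -/
abbrev LowFreq (N : ℕ) : Type := {ω : ℤ // -(N : ℤ) < 2 * ω ∧ 2 * ω ≤ N}

end BFD

end

noncomputable section

namespace BFD

open Complex (I exp)

/-! ### Nodes, modes and the action of the operator -/

/-! `Q` commutes with the shift by a whole cell but not with the shift by one node. On the nodes,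
`exp(iNx)` takes only the values `i` and `-i`, so the sawtooth part of `Q exp(iωx)` is a multiple of
the aliased mode `exp(iνx)`, and the two modes span an invariant plane (`blockOp_low`,
`blockOp_high`). There `3h²Q` is a real 2×2 matrix depending only on `θ = hω`: diagonal `symMean ±
symGap`, off-diagonal `symUp` and `symDown`, eigenvalues `symMean ± symDisc`. Everything reduces to
this matrix for `|θ| ≤ π`.

The coupling explains the error inhibition. The `c`-term is a fifth difference, so the low mode
feeds the high one only through `symUp`, of size `θ⁵`. The third-order truncation error therefore
alternates in sign and lies mainly in the high mode, which `Q` damps at rate about `32(2-c)/(3h²)`.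
Dividing by this rate gains `h²` and leaves `c(|ω|h)⁵/(1024(2-c))`. The back-reaction on the low
amplitude is of order `symUp * symDown`, that is `θ⁶`. The only `h⁴` error left is that of the low
eigenvalue, whose coefficient `4 + 13c` vanishes at `c = -4/13`.

The low eigenvalue is expanded by inserting a polynomial into the characteristic equation, whose
other root is far away near `θ = 0` (`exists_low_expansion`); the high one then follows from the
trace. Uniformity in time comes from the dissipation `Q̂₁ ≤ -δω²`, which absorbs powers of `ω²t`
(`exists_exp_Qhat1_bounds`). The matrix exponential of a block is explicit, and this yields the
Fourier-data statements.

For smooth data, data and heat solution are expanded in full Fourier series. A resolved frequency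
`k` has error `O((|k|h)⁴)`, or `O((|k|h)⁵)` at `c = -4/13`. An unresolved one aliases to a low or
high mode, and since `|k|h ≥ 1`, plain stability gives the same bound (`exists_mode_error_bound`).
Fast decay of the Fourier coefficients permits summation.

The eigenvectors form a basis because the `2N` modes are eigenvectors of the one-node shift with
distinct eigenvalues, and within each plane the coefficient matrix is invertible. The truncation
error is a Taylor expansion with sixth-order remainder. -/

theorem meshSize_pos (N : ℕ) [NeZero N] : 0 < meshSize N := by
  have : (0 : ℝ) < N := by exact_mod_cast Nat.pos_of_ne_zero (NeZero.ne N)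
  unfold meshSize
  positivity

theorem meshSize_ne_zero (N : ℕ) [NeZero N] : meshSize N ≠ 0 := (meshSize_pos N).ne'

theorem natCast_mul_meshSize (N : ℕ) [NeZero N] : (N : ℝ) * meshSize N = 2 * Real.pi := by
  have : (N : ℝ) ≠ 0 := by exact_mod_cast NeZero.ne N
  unfold meshSize
  field_simp

theorem meshSize_le (N : ℕ) [NeZero N] : meshSize N ≤ 2 * Real.pi := by
  have h1 : (1 : ℝ) ≤ N := by exact_mod_cast Nat.pos_of_ne_zero (NeZero.ne N)
  rw [← natCast_mul_meshSize N]
  nlinarith [meshSize_pos N]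

theorem abs_meshSize_mul_le {N : ℕ} [NeZero N] {ω : ℤ} (hω : |2 * ω| ≤ N) :
    |meshSize N * ω| ≤ Real.pi := by
  have h1 : |2 * (ω : ℝ)| ≤ N := by exact_mod_cast hω
  rw [abs_mul, abs_two] at h1
  rw [abs_mul, abs_of_pos (meshSize_pos N)]
  nlinarith [meshSize_pos N, natCast_mul_meshSize N]

/-! ### The stencil as translations of a periodic function -/

section Periodic

variable {N : ℕ} [NeZero N] {w : ℝ → ℂ}

/-- Nodes are computed from the representative `val`, which wraps around at the last cell; the wrap
costs a multiple of `2π` that periodic functions do not see. -/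
theorem exists_node_add_one (j : ZMod N) (b : Fin 2) :
    ∃ q : ℤ, node N (j + 1, b) = node N (j, b) + meshSize N + q * (2 * Real.pi) := by
  have h1 : (((j + 1).val : ℤ) : ZMod N) = ((j.val + 1 : ℤ) : ZMod N) := by
    push_cast
    rw [ZMod.natCast_zmod_val, ZMod.natCast_zmod_val]
  rw [ZMod.intCast_eq_intCast_iff_dvd_sub] at h1
  obtain ⟨q, hq⟩ := h1
  refine ⟨-q, ?_⟩
  have hq' : ((j.val : ℝ) + 1) - ((j + 1).val : ℝ) = N * q := by exact_mod_cast hq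
  have h2 : ((j + 1).val : ℝ) = j.val + 1 - N * q := by linarith
  unfold node
  rw [← natCast_mul_meshSize N]
  simp only [h2]
  push_cast
  ring

theorem proj_add_one (hw : Function.Periodic w (2 * Real.pi)) (j : ZMod N) (b : Fin 2) :
    proj N w (j + 1, b) = w (node N (j, b) + meshSize N) := by
  obtain ⟨q, hq⟩ := exists_node_add_one j b
  unfold proj
  rw [hq]
  exact hw.int_mul q _

theorem proj_sub_one (hw : Function.Periodic w (2 * Real.pi)) (j : ZMod N) (b : Fin 2) :
    proj N w (j - 1, b) = w (node N (j, b) - meshSize N) := by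
  obtain ⟨q, hq⟩ := exists_node_add_one (j - 1) b
  rw [sub_add_cancel] at hq
  unfold proj
  rw [hq, show node N (j - 1, b) + meshSize N + q * (2 * Real.pi) - meshSize N
    = node N (j - 1, b) + q * (2 * Real.pi) by ring]
  exact (hw.int_mul q _).symm

theorem node_right (j : ZMod N) : node N (j, 1) = node N (j, 0) + meshSize N / 2 := by
  simp only [node]
  norm_num
  ring

/-- Replaces cyclic indices by offsets from one point, with `12(h/2)² = 3h²`. The `c`-part is
lopsided: it reaches `3h/2` to the right from a left node and, by reflection, `3h/2` to the left
from a right node. -/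
theorem blockOp_proj_left (c : ℝ) (hw : Function.Periodic w (2 * Real.pi)) (j : ZMod N) :
    blockOp c N (proj N w) (j, 0) =
      1 / (3 * (meshSize N : ℂ) ^ 2) *
        ((-w (node N (j, 0) - meshSize N) + 16 * w (node N (j, 0) - meshSize N / 2)
            - 30 * w (node N (j, 0)) + 16 * w (node N (j, 0) + meshSize N / 2)
            - w (node N (j, 0) + meshSize N))
          + c * (w (node N (j, 0) - meshSize N) - 5 * w (node N (j, 0) - meshSize N / 2)
            + 10 * w (node N (j, 0)) - 10 * w (node N (j, 0) + meshSize N / 2)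
            + 5 * w (node N (j, 0) + meshSize N)
            - w (node N (j, 0) + 3 * meshSize N / 2))) := by
  simp only [blockOp, LinearMap.coe_mk, AddHom.coe_mk, if_true, proj_add_one hw, proj_sub_one hw]
  simp only [proj, node_right]
  ring_nf

theorem blockOp_proj_right (c : ℝ) (hw : Function.Periodic w (2 * Real.pi)) (j : ZMod N) :
    blockOp c N (proj N w) (j, 1) =
      1 / (3 * (meshSize N : ℂ) ^ 2) *
        ((-w (node N (j, 1) - meshSize N) + 16 * w (node N (j, 1) - meshSize N / 2)
            - 30 * w (node N (j, 1)) + 16 * w (node N (j, 1) + meshSize N / 2)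
            - w (node N (j, 1) + meshSize N))
          - c * (w (node N (j, 1) - 3 * meshSize N / 2) - 5 * w (node N (j, 1) - meshSize N)
            + 10 * w (node N (j, 1) - meshSize N / 2) - 10 * w (node N (j, 1))
            + 5 * w (node N (j, 1) + meshSize N / 2) - w (node N (j, 1) + meshSize N))) := by
  simp only [blockOp, LinearMap.coe_mk, AddHom.coe_mk, one_ne_zero, if_false, proj_add_one hw,
    proj_sub_one hw]
  simp only [proj, node_right]
  ring_nf

end Periodic

/-! ### Exponentials and the symbol of the operator -/

theorem wave_add (k : ℤ) (x y : ℝ) : wave k (x + y) = wave k x * wave k y := by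
  unfold wave
  rw [← Complex.exp_add]
  push_cast
  ring_nf

theorem wave_add_freq (k l : ℤ) (x : ℝ) : wave (k + l) x = wave k x * wave l x := by
  unfold wave
  rw [← Complex.exp_add]
  push_cast
  ring_nf

theorem wave_eq (k : ℤ) (x : ℝ) :
    wave k x = (Real.cos (k * x) : ℂ) + (Real.sin (k * x) : ℂ) * I := by
  unfold wave
  rw [Complex.ofReal_cos, Complex.ofReal_sin, ← Complex.exp_mul_I]
  push_cast
  ring_nf

theorem norm_wave (k : ℤ) (x : ℝ) : ‖wave k x‖ = 1 := by
  have : wave k x = exp ((k * x : ℝ) * I) := by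
    unfold wave
    push_cast
    ring_nf
  rw [this, Complex.norm_exp_ofReal_mul_I]

theorem wave_ne_zero (k : ℤ) (x : ℝ) : wave k x ≠ 0 := Complex.exp_ne_zero _

theorem wave_periodic (k : ℤ) : Function.Periodic (wave k) (2 * Real.pi) := by
  intro x
  rw [wave_add]
  have : wave k (2 * Real.pi) = 1 := by
    unfold wave
    rw [Complex.exp_eq_one_iff]
    exact ⟨k, by push_cast; ring⟩
  rw [this, mul_one]

theorem norm_mode (N : ℕ) (k : ℤ) (p : ZMod N × Fin 2) : ‖mode N k p‖ = 1 := norm_wave _ _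

theorem wave_add_apply (k : ℤ) (x y : ℝ) :
    wave k (x + y) = wave k x * ((Real.cos (k * y) : ℂ) + (Real.sin (k * y) : ℂ) * I) := by
  rw [wave_add, wave_eq k y]

theorem wave_sub_apply (k : ℤ) (x y : ℝ) :
    wave k (x - y) = wave k x * ((Real.cos (k * y) : ℂ) - (Real.sin (k * y) : ℂ) * I) := by
  rw [sub_eq_add_neg, wave_add_apply, mul_neg, Real.cos_neg, Real.sin_neg]
  push_cast
  ring

/-- Here `φ` is the phase gained per node. The imaginary part comes from the `c`-term alone, the
basic stencil being symmetric, and it changes sign between the two kinds of nodes because their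
`c`-stencils are reflections of each other. -/
theorem blockOp_mode (c : ℝ) (N : ℕ) [NeZero N] (k : ℤ) (φ : ℝ)
    (hφ : φ = k * (meshSize N / 2)) :
    blockOp c N (mode N k) = diagMul
      (1 / (3 * (meshSize N : ℂ) ^ 2) *
        (((32 - 15 * c) * Real.cos φ + (6 * c - 2) * Real.cos (2 * φ)
          - c * Real.cos (3 * φ) + 10 * c - 30 : ℝ)
          + I * c * (4 * Real.sin (2 * φ) - 5 * Real.sin φ - Real.sin (3 * φ) : ℝ)))
      (1 / (3 * (meshSize N : ℂ) ^ 2) *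
        (((32 - 15 * c) * Real.cos φ + (6 * c - 2) * Real.cos (2 * φ)
          - c * Real.cos (3 * φ) + 10 * c - 30 : ℝ)
          - I * c * (4 * Real.sin (2 * φ) - 5 * Real.sin φ - Real.sin (3 * φ) : ℝ)))
      (mode N k) := by
  have e1 : (k : ℝ) * meshSize N = 2 * φ := by rw [hφ]; ring
  have e2 : (k : ℝ) * (3 * meshSize N / 2) = 3 * φ := by rw [hφ]; ring
  ext ⟨j, b⟩
  fin_cases b
  · simp only [Fin.zero_eta, Fin.isValue, mode, blockOp_proj_left c (wave_periodic k), diagMul,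
      if_true, wave_add_apply, wave_sub_apply, ← hφ, e1, e2, proj]
    push_cast
    ring
  · simp only [Fin.mk_one, Fin.isValue, mode, blockOp_proj_right c (wave_periodic k), diagMul,
      one_ne_zero, if_false, wave_add_apply, wave_sub_apply, ← hφ, e1, e2, proj]
    push_cast
    ring

/-- The fifth-order zero at `φ = 0` reflects that `δ_j` is a fifth difference; it is the source of
the weak coupling from low to high modes. -/
theorem low_sin_identity (φ : ℝ) :
    4 * Real.sin (2 * φ) - 5 * Real.sin φ - Real.sin (3 * φ)
      = -32 * (Real.sin (φ / 2) ^ 5 * Real.cos (φ / 2)) := by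
  have h1 : φ = 2 * (φ / 2) := by ring
  rw [Real.sin_two_mul φ, Real.sin_three_mul]
  have h2 : Real.sin φ = 2 * Real.sin (φ / 2) * Real.cos (φ / 2) := by
    conv_lhs => rw [h1, Real.sin_two_mul]
  have h3 : Real.cos φ = 1 - 2 * Real.sin (φ / 2) ^ 2 := by
    conv_lhs => rw [h1, Real.cos_two_mul]
    linarith [Real.sin_sq_add_cos_sq (φ / 2)]
  rw [h3, h2]
  have h4 : Real.cos (φ / 2) ^ 2 = 1 - Real.sin (φ / 2) ^ 2 := by
    linarith [Real.sin_sq_add_cos_sq (φ / 2)]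
  linear_combination (32 * Real.sin (φ / 2) ^ 3 * Real.cos (φ / 2)) * h4

/-- Counterpart for the phase shifted by `π`, where sine and cosine of the half angle trade places,
leaving only a simple zero at `φ = 0`. -/
theorem high_sin_identity (φ : ℝ) :
    4 * Real.sin (2 * φ) + 5 * Real.sin φ + Real.sin (3 * φ)
      = 32 * (Real.sin (φ / 2) * Real.cos (φ / 2) ^ 5) := by
  have h1 : φ = 2 * (φ / 2) := by ring
  rw [Real.sin_two_mul φ, Real.sin_three_mul]
  have h2 : Real.sin φ = 2 * Real.sin (φ / 2) * Real.cos (φ / 2) := by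
    conv_lhs => rw [h1, Real.sin_two_mul]
  have h3 : Real.cos φ = 2 * Real.cos (φ / 2) ^ 2 - 1 := by
    conv_lhs => rw [h1, Real.cos_two_mul]
  rw [h3, h2]
  have h4 : Real.sin (φ / 2) ^ 2 = 1 - Real.cos (φ / 2) ^ 2 := by
    linarith [Real.sin_sq_add_cos_sq (φ / 2)]
  linear_combination (-32 * Real.sin (φ / 2) * Real.cos (φ / 2) ^ 3) * h4

theorem blockOp_mode_low (c : ℝ) (N : ℕ) [NeZero N] (ω : ℤ) :
    blockOp c N (mode N ω) =
      diagMul (mu1 c (meshSize N) ω) (mu2 c (meshSize N) ω) (mode N ω) := by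
  rw [blockOp_mode c N ω _ rfl, low_sin_identity]
  unfold mu1 mu2
  rw [show (ω : ℝ) * (meshSize N / 2) / 2 = meshSize N * ω / 4 by ring,
    show 2 * ((ω : ℝ) * (meshSize N / 2)) = meshSize N * ω by ring,
    show 3 * ((ω : ℝ) * (meshSize N / 2)) = 3 * meshSize N * ω / 2 by ring,
    show (ω : ℝ) * (meshSize N / 2) = meshSize N * ω / 2 by ring]
  congr 1 <;> (push_cast; ring)

/-- The sign relating a low frequency to its aliased high frequency. -/
def aliasSign (ω : ℤ) : ℝ := if 0 < ω then 1 else -1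

theorem aliasSign_mul_self (ω : ℤ) : aliasSign ω * aliasSign ω = 1 := by
  unfold aliasSign
  split_ifs <;> norm_num

theorem aliasSign_mul_self_complex (ω : ℤ) : (aliasSign ω : ℂ) * aliasSign ω = 1 := by
  exact_mod_cast aliasSign_mul_self ω

/-- At `ω = 0` the sign is `-1`, in agreement with `highFreq N 0 = N`; `Int.sign` would fail there.
-/
theorem highFreq_eq (N : ℕ) (ω : ℤ) : (highFreq N ω : ℝ) = ω - aliasSign ω * N := by
  unfold highFreq aliasSign
  split_ifs <;> (push_cast; ring)

theorem blockOp_mode_high (c : ℝ) (N : ℕ) [NeZero N] (ω : ℤ) :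
    blockOp c N (mode N (highFreq N ω)) =
      diagMul (sigma1 c (meshSize N) ω) (sigma2 c (meshSize N) ω) (mode N (highFreq N ω)) := by
  set φ : ℝ := meshSize N * ω / 2 with hφ
  have hν : (highFreq N ω : ℝ) * (meshSize N / 2) = φ - aliasSign ω * Real.pi := by
    rw [highFreq_eq, hφ]
    linear_combination (-aliasSign ω / 2) * natCast_mul_meshSize N
  -- Aliasing moves the phase per node by `π`: odd harmonics flip sign, even ones stay.
  have key : ∀ ε : ℝ, (ε = 1 ∨ ε = -1) →
      Real.cos (φ - ε * Real.pi) = -Real.cos φ ∧ Real.sin (φ - ε * Real.pi) = -Real.sin φ ∧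
      Real.cos (2 * (φ - ε * Real.pi)) = Real.cos (2 * φ) ∧
      Real.sin (2 * (φ - ε * Real.pi)) = Real.sin (2 * φ) ∧
      Real.cos (3 * (φ - ε * Real.pi)) = -Real.cos (3 * φ) ∧
      Real.sin (3 * (φ - ε * Real.pi)) = -Real.sin (3 * φ) := by
    intro ε hε
    have h1 : Real.cos (φ - ε * Real.pi) = -Real.cos φ ∧
        Real.sin (φ - ε * Real.pi) = -Real.sin φ := by
      rcases hε with rfl | rfl
      · simp [Real.cos_sub_pi, Real.sin_sub_pi]
      · simp [Real.cos_add_pi, Real.sin_add_pi]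
    refine ⟨h1.1, h1.2, ?_, ?_, ?_, ?_⟩
    · simp [Real.cos_two_mul, h1.1]
    · simp [Real.sin_two_mul, h1.1, h1.2]
    · rw [Real.cos_three_mul, Real.cos_three_mul, h1.1]; ring
    · rw [Real.sin_three_mul, Real.sin_three_mul, h1.2]; ring
  obtain ⟨e1, e2, e3, e4, e5, e6⟩ := key (aliasSign ω) (by
    unfold aliasSign
    split_ifs
    · exact Or.inl rfl
    · exact Or.inr rfl)
  rw [blockOp_mode c N _ _ hν.symm, e1, e2, e3, e4, e5, e6,
    show 4 * Real.sin (2 * φ) - 5 * -Real.sin φ - -Real.sin (3 * φ)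
      = 4 * Real.sin (2 * φ) + 5 * Real.sin φ + Real.sin (3 * φ) by ring, high_sin_identity]
  unfold sigma1 sigma2
  rw [show φ / 2 = meshSize N * ω / 4 by rw [hφ]; ring,
    show 2 * φ = meshSize N * ω by rw [hφ]; ring,
    show 3 * φ = 3 * meshSize N * ω / 2 by rw [hφ]; ring, hφ]
  congr 1 <;> (push_cast; ring)

/-- The nodes lie at one quarter and three quarters of each cell, so `N x` is `π/2` or `3π/2` modulo
`2π`. -/
theorem wave_natCast_node (N : ℕ) [NeZero N] (j : ZMod N) :
    wave N (node N (j, 0)) = I ∧ wave N (node N (j, 1)) = -I := by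
  have h := natCast_mul_meshSize N
  have e0 : ((N : ℤ) : ℝ) * node N (j, 0) = Real.pi / 2 + j.val * (2 * Real.pi) := by
    simp only [node, if_true]
    push_cast
    linear_combination ((j.val : ℝ) + 1 / 4) * h
  have e1 : ((N : ℤ) : ℝ) * node N (j, 1)
      = Real.pi / 2 + Real.pi + j.val * (2 * Real.pi) := by
    rw [node_right]
    push_cast at e0 ⊢
    linear_combination e0 + h / 2
  rw [wave_eq, wave_eq, e0, e1, Real.cos_add_nat_mul_two_pi, Real.sin_add_nat_mul_two_pi,
    Real.cos_add_nat_mul_two_pi, Real.sin_add_nat_mul_two_pi, Real.cos_add_pi, Real.sin_add_pi]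
  simp

theorem mode_add_natCast (N : ℕ) [NeZero N] (k : ℤ) :
    mode N (k + N) = diagMul I (-I) (mode N k) := by
  ext ⟨j, b⟩
  obtain ⟨h0, h1⟩ := wave_natCast_node N j
  fin_cases b
  · simp [mode, proj, diagMul, wave_add_freq, h0, mul_comm]
  · simp [mode, proj, diagMul, wave_add_freq, h1, mul_comm]

theorem diagMul_diagMul {N : ℕ} (a b a' b' : ℂ) (v : Grid N) :
    diagMul a b (diagMul a' b' v) = diagMul (a * a') (b * b') v := by
  ext p
  simp only [diagMul]
  split_ifs <;> ring

theorem diagMul_smul {N : ℕ} (a : ℂ) (v : Grid N) : diagMul a a v = a • v := by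
  ext p
  simp [diagMul]

theorem mode_highFreq (N : ℕ) [NeZero N] (ω : ℤ) :
    mode N (highFreq N ω) = diagMul (-(aliasSign ω * I)) (aliasSign ω * I) (mode N ω) := by
  unfold highFreq aliasSign
  split_ifs with h
  · have h1 := mode_add_natCast N (ω - N)
    rw [sub_add_cancel] at h1
    rw [h1, diagMul_diagMul]
    simp [diagMul_smul]
  · rw [mode_add_natCast]
    simp

theorem mode_eq_highFreq (N : ℕ) [NeZero N] (ω : ℤ) :
    mode N ω = diagMul (aliasSign ω * I) (-(aliasSign ω * I)) (mode N (highFreq N ω)) := by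
  have h := aliasSign_mul_self_complex ω
  have h1 : (aliasSign ω * I) * -(aliasSign ω * I) = 1 := by
    linear_combination -(aliasSign ω * aliasSign ω : ℂ) * Complex.I_mul_I + h
  rw [mode_highFreq, diagMul_diagMul, h1, mul_comm, h1, diagMul_smul, one_smul]

/-- The half-trace of a block of `3 h² Q`, as a function of `θ = h ω`. -/
def symMean (c θ : ℝ) : ℝ := (6 * c - 2) * Real.cos θ + 10 * c - 30

/-- The half-difference of the diagonal entries of a block of `3 h² Q`. -/
def symGap (c θ : ℝ) : ℝ := (32 - 15 * c) * Real.cos (θ / 2) - c * Real.cos (3 * θ / 2)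

/-- The entry of a block of `3 h² Q` that feeds the high mode from the low one. -/
def symUp (c θ : ℝ) : ℝ := 32 * c * |Real.sin (θ / 4)| ^ 5 * Real.cos (θ / 4)

/-- The entry of a block of `3 h² Q` that feeds the low mode from the high one. -/
def symDown (c θ : ℝ) : ℝ := 32 * c * |Real.sin (θ / 4)| * Real.cos (θ / 4) ^ 5

/-- Since `|θ/4| ≤ π/4`, the sine has the sign of `ω`. The alias sign is thereby absorbed into
absolute values, and the block becomes a function of `θ` alone. -/
theorem aliasSign_mul_sin {N : ℕ} [NeZero N] {ω : ℤ} (hω : |2 * ω| ≤ N) :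
    aliasSign ω * Real.sin (meshSize N * ω / 4) = |Real.sin (meshSize N * ω / 4)| := by
  have h := abs_le.1 (abs_meshSize_mul_le hω)
  have hp := meshSize_pos N
  unfold aliasSign
  split_ifs with h0
  · have h0' : (0 : ℝ) < ω := by exact_mod_cast h0
    rw [one_mul, abs_of_nonneg]
    apply Real.sin_nonneg_of_nonneg_of_le_pi
    · positivity
    · linarith [Real.pi_pos]
  · have h0' : (ω : ℝ) ≤ 0 := by exact_mod_cast not_lt.1 h0
    rw [abs_of_nonpos, neg_one_mul]
    apply Real.sin_nonpos_of_nonpos_of_neg_pi_le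
    · nlinarith
    · linarith [Real.pi_pos]

/-- Split `diag(μ₁, μ₂)` into its mean, which acts as a scalar, and a multiple of `diag(1, -1)`,
which maps the mode to `±i` times its alias. The half-difference is purely imaginary, so the
resulting coefficient is real. -/
theorem blockOp_low (c : ℝ) {N : ℕ} [NeZero N] {ω : ℤ} (hω : |2 * ω| ≤ N) :
    blockOp c N (mode N ω) =
      (((symMean c (meshSize N * ω) + symGap c (meshSize N * ω)) / (3 * meshSize N ^ 2) : ℝ) : ℂ)
          • mode N ω
        + ((symUp c (meshSize N * ω) / (3 * meshSize N ^ 2) : ℝ) : ℂ)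
          • mode N (highFreq N ω) := by
  -- A sign equals its own fifth power.
  have h5 : |Real.sin (meshSize N * ω / 4)| ^ 5
      = aliasSign ω * Real.sin (meshSize N * ω / 4) ^ 5 := by
    rw [← aliasSign_mul_sin hω]
    linear_combination (aliasSign ω ^ 3 + aliasSign ω) * Real.sin (meshSize N * ω / 4) ^ 5
      * aliasSign_mul_self ω
  have hε := aliasSign_mul_self_complex ω
  rw [blockOp_mode_low, mode_highFreq]
  ext p
  simp only [diagMul, Pi.add_apply, Pi.smul_apply, smul_eq_mul, mu1, mu2, symMean, symGap, symUp,
    h5]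
  rw [show 3 * (meshSize N * (ω : ℝ)) / 2 = 3 * meshSize N * ω / 2 by ring]
  split_ifs
  · push_cast
    linear_combination (32 / 3 * I * c * (Complex.sin (meshSize N * ω / 4)) ^ 5
      * Complex.cos (meshSize N * ω / 4) * ((meshSize N : ℂ) ^ 2)⁻¹ * mode N ω p) * hε
  · push_cast
    linear_combination (-32 / 3 * I * c * (Complex.sin (meshSize N * ω / 4)) ^ 5
      * Complex.cos (meshSize N * ω / 4) * ((meshSize N : ℂ) ^ 2)⁻¹ * mode N ω p) * hε

theorem blockOp_high (c : ℝ) {N : ℕ} [NeZero N] {ω : ℤ} (hω : |2 * ω| ≤ N) :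
    blockOp c N (mode N (highFreq N ω)) =
      ((symDown c (meshSize N * ω) / (3 * meshSize N ^ 2) : ℝ) : ℂ) • mode N ω
        + (((symMean c (meshSize N * ω) - symGap c (meshSize N * ω)) / (3 * meshSize N ^ 2) : ℝ)
          : ℂ) • mode N (highFreq N ω) := by
  have h1 := (aliasSign_mul_sin hω).symm
  have hε := aliasSign_mul_self_complex ω
  rw [blockOp_mode_high]
  ext p
  rw [mode_eq_highFreq N ω]
  simp only [diagMul, Pi.add_apply, Pi.smul_apply, smul_eq_mul, sigma1, sigma2, symMean, symGap,
    symDown, h1]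
  rw [show 3 * (meshSize N * (ω : ℝ)) / 2 = 3 * meshSize N * ω / 2 by ring]
  split_ifs
  · push_cast
    linear_combination (-32 / 3 * I * c * (Complex.sin (meshSize N * ω / 4))
      * Complex.cos (meshSize N * ω / 4) ^ 5 * ((meshSize N : ℂ) ^ 2)⁻¹
      * mode N (highFreq N ω) p) * hε
  · push_cast
    linear_combination (32 / 3 * I * c * (Complex.sin (meshSize N * ω / 4))
      * Complex.cos (meshSize N * ω / 4) ^ 5 * ((meshSize N : ℂ) ^ 2)⁻¹
      * mode N (highFreq N ω) p) * hε

/-! ### The symbols as functions of `θ = h ω` -/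

/-- Half the difference of the eigenvalues of a block of `3 h² Q`. -/
def symDisc (c θ : ℝ) : ℝ := Real.sqrt (symGap c θ ^ 2 + symUp c θ * symDown c θ)

/-- This factored form exhibits the sign of the gap for `c < 2`, and it is the numerator of `Ω` up
to sign. -/
theorem symGap_eq (c θ : ℝ) :
    symGap c θ = 2 * Real.cos (θ / 2) * (16 - 7 * c - c * Real.cos θ) := by
  have h1 : Real.cos θ = 2 * Real.cos (θ / 2) ^ 2 - 1 := by
    conv_lhs => rw [show θ = 2 * (θ / 2) by ring, Real.cos_two_mul]
  unfold symGap
  rw [h1, show 3 * θ / 2 = 3 * (θ / 2) by ring, Real.cos_three_mul]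
  ring

theorem symGap_sq (c θ : ℝ) :
    symGap c θ ^ 2 = 2 * (1 + Real.cos θ) * (16 - 7 * c - c * Real.cos θ) ^ 2 := by
  have h1 : Real.cos (θ / 2) ^ 2 = (1 + Real.cos θ) / 2 := by
    conv_rhs => rw [show θ = 2 * (θ / 2) by ring, Real.cos_two_mul]
    ring
  rw [symGap_eq, mul_pow, mul_pow, h1]
  ring

/-- The absolute values enter the product with an even exponent, so the discriminant is a polynomial
in `cos θ` although the single entries are not smooth. -/
theorem symUp_mul_symDown (c θ : ℝ) :
    symUp c θ * symDown c θ = 2 * c ^ 2 * (1 - Real.cos θ) ^ 3 := by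
  have h1 : (1 - Real.cos θ) = 8 * (Real.sin (θ / 4) ^ 2 * Real.cos (θ / 4) ^ 2) := by
    have e1 : Real.cos θ = 2 * Real.cos (θ / 2) ^ 2 - 1 := by
      conv_lhs => rw [show θ = 2 * (θ / 2) by ring, Real.cos_two_mul]
    have e2 : Real.cos (θ / 2) = 2 * Real.cos (θ / 4) ^ 2 - 1 := by
      conv_lhs => rw [show θ / 2 = 2 * (θ / 4) by ring, Real.cos_two_mul]
    rw [e1, e2]
    linear_combination (-8 * Real.cos (θ / 4) ^ 2) * Real.sin_sq_add_cos_sq (θ / 4)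
  rw [h1, ← sq_abs (Real.sin (θ / 4))]
  unfold symUp symDown
  ring

theorem symUp_mul_symDown_nonneg (c θ : ℝ) : 0 ≤ symUp c θ * symDown c θ := by
  rw [symUp_mul_symDown]
  have : 0 ≤ 1 - Real.cos θ := by linarith [Real.cos_le_one θ]
  positivity

theorem symDisc_nonneg (c θ : ℝ) : 0 ≤ symDisc c θ := Real.sqrt_nonneg _

theorem symDisc_sq (c θ : ℝ) :
    symDisc c θ ^ 2 = symGap c θ ^ 2 + symUp c θ * symDown c θ :=
  Real.sq_sqrt (by have := symUp_mul_symDown_nonneg c θ; positivity)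

theorem Delta_eq (c h ω : ℝ) : Delta c h ω = symDisc c (h * ω) := by
  unfold Delta symDisc
  rw [← Real.sqrt_mul (by norm_num), symGap_sq, symUp_mul_symDown,
    show 2 * h * ω = 2 * (h * ω) by ring, Real.cos_two_mul]
  congr 1
  ring

theorem Qhat1_eq (c h ω : ℝ) :
    Qhat1 c h ω = (symMean c (h * ω) + symDisc c (h * ω)) / (3 * h ^ 2) := by
  rw [Qhat1, Delta_eq, symMean]

theorem Qhat2_eq (c h ω : ℝ) :
    Qhat2 c h ω = (symMean c (h * ω) - symDisc c (h * ω)) / (3 * h ^ 2) := by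
  rw [Qhat2, Delta_eq, symMean]

/-- The determinant of a block of `3 h² Q`. -/
theorem symMean_sq_sub (c θ : ℝ) :
    symMean c θ ^ 2 - symDisc c θ ^ 2
      = (1 - Real.cos θ) * (192 * (2 - c) + (4 + 40 * c) * (1 - Real.cos θ)) := by
  rw [symDisc_sq, symGap_sq, symUp_mul_symDown, symMean]
  ring

/-- The mean is affine in `cos θ`, so its endpoint values `-16(2-c)` and `-4(2-c) - 20` decide. -/
theorem symMean_le {c : ℝ} (hc : c < 2) (θ : ℝ) : symMean c θ ≤ -(4 * (2 - c)) := by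
  unfold symMean
  nlinarith [Real.cos_le_one θ, Real.neg_one_le_cos θ]

theorem neg_symMean_le {c : ℝ} (hc : c < 2) (θ : ℝ) :
    -symMean c θ ≤ 28 * (2 - c) + 20 := by
  unfold symMean
  nlinarith [Real.cos_le_one θ, Real.neg_one_le_cos θ]

theorem symGap_nonneg {c θ : ℝ} (hc : c < 2) (hθ : |θ| ≤ Real.pi) : 0 ≤ symGap c θ := by
  have h := abs_le.1 hθ
  rw [symGap_eq]
  have h1 : 0 ≤ Real.cos (θ / 2) :=
    Real.cos_nonneg_of_neg_pi_div_two_le_of_le (by linarith) (by linarith)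
  have h2 : 0 ≤ 16 - 7 * c - c * Real.cos θ := by
    nlinarith [Real.cos_le_one θ, Real.neg_one_le_cos θ]
  positivity

theorem symGap_le_symDisc {c θ : ℝ} : symGap c θ ≤ symDisc c θ := by
  refine Real.le_sqrt_of_sq_le ?_
  linarith [symUp_mul_symDown_nonneg c θ]

/-- The second factor of the determinant is affine in `1 - cos θ ∈ [0, 2]`, with endpoint values
`192(2-c)` and `112(2-c) + 168`. -/
theorem le_symMean_sq_sub_symDisc_sq {c : ℝ} (hc : c < 2) (θ : ℝ) :
    112 * (2 - c) * (1 - Real.cos θ) ≤ symMean c θ ^ 2 - symDisc c θ ^ 2 := by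
  rw [symMean_sq_sub]
  have h0 : 0 ≤ 1 - Real.cos θ := by linarith [Real.cos_le_one θ]
  have h2 : 1 - Real.cos θ ≤ 2 := by linarith [Real.neg_one_le_cos θ]
  rw [mul_comm]
  refine mul_le_mul_of_nonneg_left ?_ h0
  nlinarith

/-- Dissipation: `h² Q̂₁ ≤ -δ θ²`. -/
theorem exists_symMean_add_symDisc_le {c : ℝ} (hc : c < 2) :
    ∃ δ : ℝ, 0 < δ ∧ δ ≤ 1 ∧ ∀ θ : ℝ, |θ| ≤ Real.pi →
      symMean c θ + symDisc c θ ≤ -(3 * δ * θ ^ 2) := by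
  have hm : 0 < 2 - c := by linarith
  -- The determinant is the product of the two negated eigenvalues. `B` bounds the larger of them
  -- from above, so the smaller one is at least determinant over `B`; `d` then uses `1 - cos θ ≥
  -- 2θ²/π²`.
  set B : ℝ := 2 * (28 * (2 - c) + 20) with hB
  have hBpos : 0 < B := by positivity
  set d : ℝ := 112 * (2 - c) * (2 / Real.pi ^ 2) / B / 3 with hd
  have hdpos : 0 < d := by positivity
  -- With `δ ≤ 1` the exact rate `-ω²` is also at most `-δω²`, so one `δ` serves both exponentials
  -- later.
  refine ⟨min 1 d, lt_min one_pos hdpos, min_le_left _ _, fun θ hθ => ?_⟩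
  have hz : 2 / Real.pi ^ 2 * θ ^ 2 ≤ 1 - Real.cos θ := by
    linarith [Real.cos_le_one_sub_mul_cos_sq hθ]
  have h1 := le_symMean_sq_sub_symDisc_sq hc θ
  have h2 := symMean_le hc θ
  have h3 := neg_symMean_le hc θ
  have h4 := symDisc_nonneg c θ
  have hz0 : 0 ≤ 1 - Real.cos θ := by linarith [Real.cos_le_one θ]
  have h5 : symDisc c θ ≤ -symMean c θ := by
    apply le_of_sq_le_sq _ (by linarith)
    nlinarith [mul_nonneg (mul_nonneg (by norm_num : (0:ℝ) ≤ 112) hm.le) hz0]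
  have h6 : 112 * (2 - c) * (1 - Real.cos θ) ≤ (-symMean c θ - symDisc c θ) * B := by
    calc _ ≤ (-symMean c θ - symDisc c θ) * (-symMean c θ + symDisc c θ) := by linarith
      _ ≤ _ := by
        apply mul_le_mul_of_nonneg_left _ (by linarith)
        linarith
  have h7 : 3 * d * θ ^ 2 ≤ -symMean c θ - symDisc c θ := by
    rw [show 3 * d * θ ^ 2 = 112 * (2 - c) * (2 / Real.pi ^ 2 * θ ^ 2) / B by rw [hd]; ring,
      div_le_iff₀ hBpos]
    refine le_trans ?_ h6
    exact mul_le_mul_of_nonneg_left hz (by positivity)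
  have h8 : min 1 d * θ ^ 2 ≤ d * θ ^ 2 :=
    mul_le_mul_of_nonneg_right (min_le_right _ _) (sq_nonneg _)
  linarith

theorem sin_sq_le_cos_sq_quarter {θ : ℝ} (hθ : |θ| ≤ Real.pi) :
    Real.sin (θ / 4) ^ 2 ≤ Real.cos (θ / 4) ^ 2 := by
  have h := abs_le.1 hθ
  have h1 : 0 ≤ Real.cos (2 * (θ / 4)) :=
    Real.cos_nonneg_of_neg_pi_div_two_le_of_le (by linarith) (by linarith)
  rw [Real.cos_two_mul'] at h1
  linarith

/-- For `|θ/4| ≤ π/4` the sine is dominated by the cosine, hence `symUp² ≤ symUp * symDown ≤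
symDisc²`. No lower bound on `symDisc` is needed, which matters because it can vanish when `c = 0`.
-/
theorem abs_symUp_le {c θ : ℝ} (hθ : |θ| ≤ Real.pi) : |symUp c θ| ≤ symDisc c θ := by
  refine Real.abs_le_sqrt ?_
  have h1 := sin_sq_le_cos_sq_quarter hθ
  rw [← sq_abs (Real.sin (θ / 4))] at h1
  have h2 : symUp c θ ^ 2 ≤ symUp c θ * symDown c θ := by
    have e1 : symUp c θ ^ 2 = 1024 * c ^ 2 * |Real.sin (θ / 4)| ^ 6 * Real.cos (θ / 4) ^ 2
        * (|Real.sin (θ / 4)| ^ 2) ^ 2 := by unfold symUp; ring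
    have e2 : symUp c θ * symDown c θ = 1024 * c ^ 2 * |Real.sin (θ / 4)| ^ 6
        * Real.cos (θ / 4) ^ 2 * (Real.cos (θ / 4) ^ 2) ^ 2 := by unfold symUp symDown; ring
    rw [e1, e2]
    gcongr
  linarith [sq_nonneg (symGap c θ)]

@[fun_prop]
theorem continuous_symMean (c : ℝ) : Continuous (symMean c) := by
  unfold symMean; fun_prop

@[fun_prop]
theorem continuous_symGap (c : ℝ) : Continuous (symGap c) := by
  unfold symGap; fun_prop

@[fun_prop]
theorem continuous_symUp (c : ℝ) : Continuous (symUp c) := by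
  unfold symUp; fun_prop

@[fun_prop]
theorem continuous_symDown (c : ℝ) : Continuous (symDown c) := by
  unfold symDown; fun_prop

@[fun_prop]
theorem continuous_symDisc (c : ℝ) : Continuous (symDisc c) := by
  unfold symDisc; fun_prop

theorem symDisc_zero {c : ℝ} (hc : c < 2) : symDisc c 0 = 16 * (2 - c) := by
  have h1 : symGap c 0 ^ 2 + symUp c 0 * symDown c 0 = (16 * (2 - c)) ^ 2 := by
    rw [symGap_sq, symUp_mul_symDown, Real.cos_zero]; ring
  rw [symDisc, h1, Real.sqrt_sq (by linarith)]

theorem symDisc_pos {c : ℝ} (hc : c < 2) (hc0 : c ≠ 0) (θ : ℝ) : 0 < symDisc c θ := by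
  refine Real.sqrt_pos.2 ?_
  rw [symGap_sq, symUp_mul_symDown]
  rcases (Real.cos_le_one θ).eq_or_lt with h | h
  · rw [h]
    have : 0 < 16 - 7 * c - c * 1 := by linarith
    have := pow_pos this 2
    linarith
  · have h1 : 0 < 1 - Real.cos θ := by linarith
    have h2 : 0 ≤ 1 + Real.cos θ := by linarith [Real.neg_one_le_cos θ]
    positivity

/-- A double eigenvalue occurs only when the block is scalar. This is the case in which division by
`symDisc` has to be handled separately. -/
theorem eq_zero_of_symDisc_eq_zero {c : ℝ} (hc : c < 2) {θ : ℝ} (h : symDisc c θ = 0) :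
    c = 0 ∧ symGap c θ = 0 := by
  have h0 : c = 0 := by
    by_contra h0
    exact (symDisc_pos hc h0 θ).ne' h
  refine ⟨h0, ?_⟩
  have h1 := symDisc_sq c θ
  rw [h] at h1
  nlinarith [symUp_mul_symDown_nonneg c θ]

/-- Compactness of `[-π, π]` applies to the quotient when `c ≠ 0`; for `c = 0` the entry itself
vanishes. -/
theorem exists_abs_symDown_le {c : ℝ} (hc : c < 2) :
    ∃ K : ℝ, 0 ≤ K ∧ ∀ θ : ℝ, |θ| ≤ Real.pi → |symDown c θ| ≤ K * symDisc c θ := by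
  rcases eq_or_ne c 0 with rfl | hc0
  · exact ⟨0, le_rfl, fun θ _ => by simp [symDown]⟩
  have hcont : ContinuousOn (fun θ => symDown c θ / symDisc c θ)
      (Set.Icc (-Real.pi) Real.pi) := by
    apply Continuous.continuousOn
    exact (continuous_symDown c).div (continuous_symDisc c) fun θ => (symDisc_pos hc hc0 θ).ne'
  obtain ⟨K, hK⟩ := isCompact_Icc.exists_bound_of_continuousOn hcont
  refine ⟨|K|, abs_nonneg _, fun θ hθ => ?_⟩
  have h1 := (hK θ (abs_le.1 hθ)).trans (le_abs_self K)
  rwa [Real.norm_eq_abs, abs_div, abs_of_pos (symDisc_pos hc hc0 θ),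
    div_le_iff₀ (symDisc_pos hc hc0 θ)] at h1

/-! ### Expansions at `θ = 0` -/

/-- A local bound of order `n` extends to all of `[-π, π]`: outside a neighbourhood of `0` of radius
`ε`, boundedness suffices because `|θ|^n / ε^n ≥ 1`. -/
theorem exists_bound_of_eventually {F : ℝ → ℝ} {n : ℕ} {B C : ℝ}
    (hB : ∀ θ, |θ| ≤ Real.pi → |F θ| ≤ B)
    (hF : ∀ᶠ θ in nhds (0 : ℝ), |θ| ≤ Real.pi → |F θ| ≤ C * |θ| ^ n) :
    ∃ C' : ℝ, 0 ≤ C' ∧ ∀ θ, |θ| ≤ Real.pi → |F θ| ≤ C' * |θ| ^ n := by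
  obtain ⟨ε, hε, h⟩ := Metric.eventually_nhds_iff.1 hF
  refine ⟨|C| + |B| / ε ^ n, by positivity, fun θ hθ => ?_⟩
  by_cases h1 : |θ| < ε
  · have h2 := h (by simpa using h1) hθ
    refine h2.trans ?_
    gcongr
    exact (le_abs_self C).trans (le_add_of_nonneg_right (by positivity))
  · push Not at h1
    have h2 : (1 : ℝ) ≤ |θ| ^ n / ε ^ n := by
      rw [le_div_iff₀ (by positivity), one_mul]
      gcongr
    calc |F θ| ≤ |B| * 1 := by rw [mul_one]; exact (hB θ hθ).trans (le_abs_self B)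
      _ ≤ |B| * (|θ| ^ n / ε ^ n) := by gcongr
      _ = |B| / ε ^ n * |θ| ^ n := by ring
      _ ≤ _ := by
        gcongr
        exact le_add_of_nonneg_left (abs_nonneg C)

theorem exists_bound_of_continuous {F : ℝ → ℝ} (hF : Continuous F) :
    ∃ B : ℝ, ∀ θ, |θ| ≤ Real.pi → |F θ| ≤ B := by
  obtain ⟨B, hB⟩ := (isCompact_Icc (a := -Real.pi) (b := Real.pi)).exists_bound_of_continuousOn
    hF.continuousOn
  exact ⟨B, fun θ hθ => hB θ (abs_le.1 hθ)⟩

/-- Real part of the remainder of `exp(ix)` after eight terms; the seventh-degree term is imaginary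
and drops out. -/
theorem cos_sub_taylor_le (x : ℝ) :
    |Real.cos x - (1 - x ^ 2 / 2 + x ^ 4 / 24 - x ^ 6 / 720)| ≤ |x| ^ 8 * Real.exp |x| := by
  have h := Complex.norm_exp_sub_sum_le_norm_mul_exp ((x : ℂ) * I) 8
  rw [norm_mul, Complex.norm_I, mul_one, Complex.norm_real, Real.norm_eq_abs] at h
  refine le_trans ?_ ((Complex.abs_re_le_norm _).trans h)
  apply le_of_eq
  congr 1
  rw [Complex.sub_re, Complex.exp_ofReal_mul_I_re]
  congr 1
  have hI2 : I ^ 2 = -1 := Complex.I_sq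
  have hI3 : I ^ 3 = -I := by rw [pow_succ, hI2]; ring
  have hI4 : I ^ 4 = 1 := Complex.I_pow_four
  have hI5 : I ^ 5 = I := by rw [pow_succ, hI4]; ring
  have hI6 : I ^ 6 = -1 := by rw [pow_succ, hI5]; simp
  have hI7 : I ^ 7 = -I := by rw [pow_succ, hI6]; ring
  have e : ∑ m ∈ Finset.range 8, ((x : ℂ) * I) ^ m / (m.factorial : ℂ)
      = ((1 - x ^ 2 / 2 + x ^ 4 / 24 - x ^ 6 / 720 : ℝ) : ℂ)
        + ((x - x ^ 3 / 6 + x ^ 5 / 120 - x ^ 7 / 5040 : ℝ) : ℂ) * I := by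
    simp only [Finset.sum_range_succ, Finset.sum_range_zero, mul_pow, hI2, hI3, hI4, hI5, hI6,
      hI7, Nat.factorial]
    push_cast
    ring
  rw [e]
  simp only [Complex.add_re, Complex.re_ofReal_mul, Complex.I_re, Complex.ofReal_re, mul_zero,
    add_zero]

/-- The polynomial `-θ² - κ θ⁶` nearly solves the characteristic equation of a block. -/
theorem exists_charpoly_bound {c : ℝ} (hc : c < 2) :
    ∃ C : ℝ, 0 ≤ C ∧ ∀ θ : ℝ, |θ| ≤ Real.pi → ∀ g : ℝ,
      g = -θ ^ 2 - (4 + 13 * c) / (2880 * (-2 + c)) * θ ^ 6 →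
      |9 * g ^ 2 - 6 * symMean c θ * g + (symMean c θ ^ 2 - symDisc c θ ^ 2)| ≤ C * |θ| ^ 8 := by
  set κ : ℝ := (4 + 13 * c) / (2880 * (-2 + c)) with hκ
  have hκ' : κ * (2880 * (-2 + c)) = 4 + 13 * c := by
    rw [hκ]
    have : -2 + c ≠ 0 := by linarith
    field_simp
  -- `q` is the cofactor of `θ⁸` once `cos θ` is replaced by its Taylor polynomial minus `θ⁸ r`. The
  -- `θ²` and `θ⁴` coefficients cancel identically and `κ` is the value that cancels `θ⁶`. Treating
  -- `r` as an independent bounded variable makes `q` a polynomial on a compact set.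
  let q : ℝ × ℝ → ℝ := fun p =>
    18 * κ + 9 * κ ^ 2 * p.1 ^ 4
      - 6 * (6 * c - 2) * ((1 / 720 + p.1 ^ 2 * p.2)
        + κ * (1 / 2 - p.1 ^ 2 / 24 + p.1 ^ 4 / 720 + p.1 ^ 6 * p.2))
      + 192 * (2 - c) * p.2
      + (4 + 40 * c) * (1 / 576 + (1 / 720 + p.1 ^ 2 * p.2)
        - p.1 ^ 2 * (1 / 720 + p.1 ^ 2 * p.2) / 12 + p.1 ^ 4 * (1 / 720 + p.1 ^ 2 * p.2) ^ 2)
  have hq : Continuous q := by fun_prop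
  obtain ⟨C, hC⟩ := ((isCompact_Icc (a := -Real.pi) (b := Real.pi)).prod
    (isCompact_Icc (a := -Real.exp Real.pi) (b := Real.exp Real.pi))).exists_bound_of_continuousOn
    hq.continuousOn
  refine ⟨|C|, abs_nonneg _, fun θ hθ g hg => ?_⟩
  -- The rescaled Taylor remainder, with value `0` chosen at `θ = 0`.
  obtain ⟨r, hr, hz⟩ : ∃ r : ℝ, |r| ≤ Real.exp Real.pi ∧
      Real.cos θ = 1 - θ ^ 2 / 2 + θ ^ 4 / 24 - θ ^ 6 / 720 - θ ^ 8 * r := by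
    rcases eq_or_ne θ 0 with rfl | h0
    · exact ⟨0, by simpa using (Real.exp_pos _).le, by simp⟩
    refine ⟨-(Real.cos θ - (1 - θ ^ 2 / 2 + θ ^ 4 / 24 - θ ^ 6 / 720)) / θ ^ 8, ?_, ?_⟩
    · rw [abs_div, abs_neg, abs_pow, div_le_iff₀ (by positivity)]
      refine (cos_sub_taylor_le θ).trans ?_
      rw [mul_comm]
      gcongr
    · field_simp
      ring
  have h1 := (hC (θ, r) ⟨abs_le.1 hθ, abs_le.1 hr⟩).trans (le_abs_self C)
  have e : 9 * g ^ 2 - 6 * symMean c θ * g + (symMean c θ ^ 2 - symDisc c θ ^ 2)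
      = θ ^ 8 * q (θ, r) := by
    rw [symMean_sq_sub, symMean, hz, hg]
    simp only [q]
    linear_combination (θ ^ 6 / 30) * hκ'
  rw [e, abs_mul, abs_pow, mul_comm]
  exact mul_le_mul_of_nonneg_right h1 (by positivity)

/-- The characteristic polynomial at `g` factors into the distances from `g` to the two eigenvalues.
Near `θ = 0` the factor of the high eigenvalue exceeds `2 - c`, so the residual of order `θ⁸`
controls the distance to the low one; elsewhere boundedness is enough. -/
theorem exists_low_expansion {c : ℝ} (hc : c < 2) :
    ∃ C : ℝ, 0 ≤ C ∧ ∀ θ : ℝ, |θ| ≤ Real.pi →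
      |(symMean c θ + symDisc c θ) / 3
        - (-θ ^ 2 - (4 + 13 * c) / (2880 * (-2 + c)) * θ ^ 6)| ≤ C * |θ| ^ 8 := by
  obtain ⟨C, hC0, hC⟩ := exists_charpoly_bound hc
  set κ : ℝ := (4 + 13 * c) / (2880 * (-2 + c)) with hκ
  obtain ⟨B, hB⟩ := exists_bound_of_continuous
    (F := fun θ => (symMean c θ + symDisc c θ) / 3 - (-θ ^ 2 - κ * θ ^ 6)) (by fun_prop)
  refine exists_bound_of_eventually (C := C / (2 - c)) hB ?_
  have hcont : ContinuousAt (fun θ => -3 * symMean c θ + 3 * symDisc c θ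
      + 9 * (-θ ^ 2 - κ * θ ^ 6)) 0 := by
    apply Continuous.continuousAt
    fun_prop
  have hpos : (2 - c) < -3 * symMean c 0 + 3 * symDisc c 0
      + 9 * (-(0 : ℝ) ^ 2 - κ * 0 ^ 6) := by
    have := symMean_le hc 0
    have := symDisc_nonneg c 0
    norm_num
    linarith
  filter_upwards [hcont.eventually (lt_mem_nhds hpos)] with θ hθ hθπ
  have hm : 0 < 2 - c := by linarith
  set g : ℝ := -θ ^ 2 - κ * θ ^ 6 with hg
  have h1 := hC θ hθπ g rfl
  have e : 9 * g ^ 2 - 6 * symMean c θ * g + (symMean c θ ^ 2 - symDisc c θ ^ 2)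
      = -(((symMean c θ + symDisc c θ) / 3 - g)
        * (-3 * symMean c θ + 3 * symDisc c θ + 9 * g)) := by ring
  rw [e, abs_neg, abs_mul, abs_of_pos (hm.trans hθ)] at h1
  rw [div_mul_eq_mul_div, le_div_iff₀ hm]
  exact (mul_le_mul_of_nonneg_left hθ.le (abs_nonneg _)).trans h1

/-- The two eigenvalues sum to `2/3 * symMean`, which is explicit, so the high one is obtained by
subtracting the low expansion. -/
theorem exists_high_expansion {c : ℝ} (hc : c < 2) :
    ∃ C : ℝ, 0 ≤ C ∧ ∀ θ : ℝ, |θ| ≤ Real.pi →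
      |(symMean c θ - symDisc c θ) / 3
        - (32 * (-2 + c) / 3 - (-5 + 6 * c) * θ ^ 2 / 3 + (-1 + 3 * c) * θ ^ 4 / 18)|
        ≤ C * |θ| ^ 6 := by
  obtain ⟨C, hC0, hC⟩ := exists_low_expansion hc
  set κ : ℝ := (4 + 13 * c) / (2880 * (-2 + c)) with hκ
  refine ⟨C * Real.pi ^ 2 + |κ| + |2 / 3 * (6 * c - 2)|
    * (1 / 720 + Real.pi ^ 2 * Real.exp Real.pi), by positivity, fun θ hθ => ?_⟩
  have h1 := hC θ hθ
  have h2 := cos_sub_taylor_le θ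
  have hsq : |θ| ^ 2 ≤ Real.pi ^ 2 := by gcongr
  have h3 : |2 / 3 * (6 * c - 2) * (Real.cos θ - (1 - θ ^ 2 / 2 + θ ^ 4 / 24))|
      ≤ |2 / 3 * (6 * c - 2)| * ((1 / 720 + Real.pi ^ 2 * Real.exp Real.pi) * |θ| ^ 6) := by
    rw [abs_mul]
    gcongr
    calc |Real.cos θ - (1 - θ ^ 2 / 2 + θ ^ 4 / 24)|
        = |(Real.cos θ - (1 - θ ^ 2 / 2 + θ ^ 4 / 24 - θ ^ 6 / 720)) - θ ^ 6 / 720| := by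
          congr 1; ring
      _ ≤ |Real.cos θ - (1 - θ ^ 2 / 2 + θ ^ 4 / 24 - θ ^ 6 / 720)| + |θ ^ 6 / 720| :=
          abs_sub _ _
      _ ≤ |θ| ^ 8 * Real.exp |θ| + |θ| ^ 6 / 720 := by
          rw [abs_div, abs_pow, abs_of_pos (by norm_num : (0 : ℝ) < 720)]
          gcongr
      _ = |θ| ^ 2 * Real.exp |θ| * |θ| ^ 6 + |θ| ^ 6 / 720 := by ring
      _ ≤ Real.pi ^ 2 * Real.exp Real.pi * |θ| ^ 6 + |θ| ^ 6 / 720 := by gcongr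
      _ = _ := by ring
  have h4 : |(symMean c θ + symDisc c θ) / 3 - (-θ ^ 2 - κ * θ ^ 6)|
      ≤ C * Real.pi ^ 2 * |θ| ^ 6 := by
    refine h1.trans ?_
    calc C * |θ| ^ 8 = C * |θ| ^ 2 * |θ| ^ 6 := by ring
      _ ≤ _ := by gcongr
  have h5 : |κ * θ ^ 6| = |κ| * |θ| ^ 6 := by rw [abs_mul, abs_pow]
  have e : (symMean c θ - symDisc c θ) / 3
        - (32 * (-2 + c) / 3 - (-5 + 6 * c) * θ ^ 2 / 3 + (-1 + 3 * c) * θ ^ 4 / 18)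
      = 2 / 3 * (6 * c - 2) * (Real.cos θ - (1 - θ ^ 2 / 2 + θ ^ 4 / 24))
        - ((symMean c θ + symDisc c θ) / 3 - (-θ ^ 2 - κ * θ ^ 6)) + κ * θ ^ 6 := by
    unfold symMean
    ring
  rw [e]
  refine (abs_add_le _ _).trans ?_
  rw [h5]
  have := abs_sub (2 / 3 * (6 * c - 2) * (Real.cos θ - (1 - θ ^ 2 / 2 + θ ^ 4 / 24)))
    ((symMean c θ + symDisc c θ) / 3 - (-θ ^ 2 - κ * θ ^ 6))
  linarith

/-- With `x = |θ|/4` the leading term is `32 c x⁵ = c|θ|⁵/32`; the bounds `x - sin x ≤ x³` and `1 -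
cos x ≤ x²/2` produce two more orders. -/
theorem abs_symUp_sub_le {c θ : ℝ} (hθ : |θ| ≤ Real.pi) :
    |symUp c θ - c * |θ| ^ 5 / 32| ≤ |c| * |θ| ^ 7 := by
  set x : ℝ := |θ| / 4 with hx
  have hx0 : 0 ≤ x := by positivity
  have hx1 : x ≤ 1 := by
    rw [hx]
    linarith [Real.pi_lt_four]
  have hxθ : |θ / 4| = x := by rw [abs_div, abs_of_pos (by norm_num : (0 : ℝ) < 4)]
  have hs0 : 0 ≤ Real.sin x :=
    Real.sin_nonneg_of_nonneg_of_le_pi hx0 (by linarith [Real.pi_gt_three])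
  have hs : |Real.sin (θ / 4)| = Real.sin x := by
    rw [← hxθ] at hs0 ⊢
    rcases abs_cases (θ / 4) with h | h
    · rw [h.1] at hs0 ⊢; exact abs_of_nonneg hs0
    · rw [h.1, Real.sin_neg] at hs0 ⊢; exact abs_of_nonpos (by linarith)
  have hk : Real.cos (θ / 4) = Real.cos x := by rw [← hxθ, Real.cos_abs]
  have hsx : Real.sin x ≤ x := Real.sin_le hx0
  have hsx' : x - Real.sin x ≤ x ^ 3 := by
    rcases hx0.eq_or_lt with h | h
    · rw [← h]; simp
    · have := Real.sin_gt_sub_cube h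
      nlinarith [pow_pos h 3]
  have hcx : 1 - Real.cos x ≤ x ^ 2 / 2 := by linarith [Real.one_sub_sq_div_two_le_cos (x := x)]
  have hcx0 : 0 ≤ 1 - Real.cos x := by linarith [Real.cos_le_one x]
  have key : |Real.sin x ^ 5 * Real.cos x - x ^ 5| ≤ 6 * x ^ 7 := by
    have e : x ^ 5 - Real.sin x ^ 5 * Real.cos x
        = (x - Real.sin x) * (x ^ 4 + x ^ 3 * Real.sin x + x ^ 2 * Real.sin x ^ 2
          + x * Real.sin x ^ 3 + Real.sin x ^ 4) + Real.sin x ^ 5 * (1 - Real.cos x) := by ring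
    have hd : 0 ≤ x - Real.sin x := by linarith
    rw [abs_sub_comm, e, abs_of_nonneg (by positivity)]
    calc (x - Real.sin x) * (x ^ 4 + x ^ 3 * Real.sin x + x ^ 2 * Real.sin x ^ 2
          + x * Real.sin x ^ 3 + Real.sin x ^ 4) + Real.sin x ^ 5 * (1 - Real.cos x)
        ≤ x ^ 3 * (x ^ 4 + x ^ 3 * x + x ^ 2 * x ^ 2 + x * x ^ 3 + x ^ 4)
          + x ^ 5 * (x ^ 2 / 2) := by gcongr
      _ ≤ 6 * x ^ 7 := by nlinarith [pow_nonneg hx0 7]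
  have e : symUp c θ - c * |θ| ^ 5 / 32 = 32 * c * (Real.sin x ^ 5 * Real.cos x - x ^ 5) := by
    unfold symUp
    rw [hs, hk, show |θ| = 4 * x by rw [hx]; ring]
    ring
  rw [e, abs_mul, abs_mul, abs_of_pos (by norm_num : (0 : ℝ) < 32),
    show |θ| = 4 * x by rw [hx]; ring]
  calc 32 * |c| * |Real.sin x ^ 5 * Real.cos x - x ^ 5| ≤ 32 * |c| * (6 * x ^ 7) := by gcongr
    _ ≤ |c| * (4 * x) ^ 7 := by nlinarith [mul_nonneg (abs_nonneg c) (pow_nonneg hx0 7)]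

theorem eventually_symDisc_ge {c : ℝ} (hc : c < 2) :
    ∀ᶠ θ in nhds (0 : ℝ), 8 * (2 - c) < symDisc c θ := by
  have h : 8 * (2 - c) < symDisc c 0 := by rw [symDisc_zero hc]; linarith
  exact (continuous_symDisc c).continuousAt.eventually (lt_mem_nhds h)

theorem abs_symUp_div_le {c θ : ℝ} (hθ : |θ| ≤ Real.pi) :
    |symUp c θ / (2 * symDisc c θ)| ≤ 1 / 2 := by
  have h0 := symDisc_nonneg c θ
  rw [abs_div, abs_of_nonneg (by positivity : 0 ≤ 2 * symDisc c θ)]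
  rcases h0.eq_or_lt with h | h
  · rw [← h]; norm_num
  · rw [div_le_iff₀ (by positivity)]
    linarith [abs_symUp_le (c := c) hθ]

/-- The numerator is `c|θ|⁵/32` to leading order and the denominator is close to `32(2-c)`, whence
the constant `1024`. -/
theorem exists_symUp_div_expansion {c : ℝ} (hc : c < 2) :
    ∃ C : ℝ, 0 ≤ C ∧ ∀ θ : ℝ, |θ| ≤ Real.pi →
      |symUp c θ / (2 * symDisc c θ) - -(c * |θ| ^ 5 / (1024 * (-2 + c)))| ≤ C * |θ| ^ 6 := by
  have hm : 0 < 2 - c := by linarith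
  obtain ⟨B, hB⟩ := exists_bound_of_continuous
    (F := fun θ => -(c * |θ| ^ 5 / (1024 * (-2 + c)))) (by fun_prop)
  obtain ⟨C, hC0, hC⟩ := exists_low_expansion hc
  set κ : ℝ := (4 + 13 * c) / (2880 * (-2 + c)) with hκ
  set L : ℝ := 3 * (C * Real.pi ^ 6 + 1 + |κ| * Real.pi ^ 4) + |6 * c - 2| with hL
  have hL0 : 0 ≤ L := by positivity
  -- Read off from the low eigenvalue: `symDisc` is three times that eigenvalue minus `symMean`, and
  -- both are known to second order.
  have hdisc : ∀ θ, |θ| ≤ Real.pi → |symDisc c θ - 16 * (2 - c)| ≤ L * |θ| ^ 2 := by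
    intro θ hθ
    have h1 := hC θ hθ
    have h2 : |(6 * c - 2) * (1 - Real.cos θ)| ≤ |6 * c - 2| * |θ| ^ 2 := by
      rw [abs_mul]
      gcongr
      rw [abs_of_nonneg (by linarith [Real.cos_le_one θ]), sq_abs]
      nlinarith [Real.one_sub_sq_div_two_le_cos (x := θ)]
    have e : symDisc c θ - 16 * (2 - c) = 3 * ((symMean c θ + symDisc c θ) / 3
        - (-θ ^ 2 - κ * θ ^ 6)) - 3 * (θ ^ 2 + κ * θ ^ 6) + (6 * c - 2) * (1 - Real.cos θ) := by
      unfold symMean; ring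
    have h3 : |θ ^ 2 + κ * θ ^ 6| ≤ (1 + |κ| * Real.pi ^ 4) * |θ| ^ 2 := by
      calc |θ ^ 2 + κ * θ ^ 6| ≤ |θ ^ 2| + |κ * θ ^ 6| := abs_add_le _ _
        _ = |θ| ^ 2 + |κ| * |θ| ^ 4 * |θ| ^ 2 := by rw [abs_mul, abs_pow, abs_pow]; ring
        _ ≤ |θ| ^ 2 + |κ| * Real.pi ^ 4 * |θ| ^ 2 := by gcongr
        _ = _ := by ring
    have h4 : C * |θ| ^ 8 ≤ C * Real.pi ^ 6 * |θ| ^ 2 := by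
      calc C * |θ| ^ 8 = C * |θ| ^ 6 * |θ| ^ 2 := by ring
        _ ≤ _ := by gcongr
    rw [e, hL]
    rw [abs_le] at *
    constructor <;> nlinarith
  refine exists_bound_of_eventually (B := 1 / 2 + B)
    (C := |c| * Real.pi / (16 * (2 - c)) + |c| / 32 * (L * Real.pi / (256 * (2 - c) ^ 2))) ?_ ?_
  · intro θ hθ
    refine (abs_sub _ _).trans ?_
    exact add_le_add (abs_symUp_div_le hθ) (hB θ hθ)
  · filter_upwards [eventually_symDisc_ge hc] with θ h8 hθ
    have hd : 0 < symDisc c θ := by linarith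
    have e : symUp c θ / (2 * symDisc c θ) - -(c * |θ| ^ 5 / (1024 * (-2 + c)))
        = (symUp c θ - c * |θ| ^ 5 / 32) / (2 * symDisc c θ)
          - c / 32 * |θ| ^ 5 * ((symDisc c θ - 16 * (2 - c))
            / (32 * (2 - c) * symDisc c θ)) := by
      have : -2 + c ≠ 0 := by linarith
      have : (2 - c) ≠ 0 := hm.ne'
      field_simp
      ring
    rw [e]
    refine (abs_sub _ _).trans ?_
    rw [add_mul]
    have h1 : |(symUp c θ - c * |θ| ^ 5 / 32) / (2 * symDisc c θ)|
        ≤ |c| * Real.pi / (16 * (2 - c)) * |θ| ^ 6 := by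
      rw [abs_div, abs_of_pos (by positivity : 0 < 2 * symDisc c θ)]
      calc |symUp c θ - c * |θ| ^ 5 / 32| / (2 * symDisc c θ)
          ≤ (|c| * |θ| ^ 7) / (16 * (2 - c)) := by
            exact div_le_div₀ (by positivity) (abs_symUp_sub_le hθ) (by positivity) (by linarith)
        _ = |c| * |θ| / (16 * (2 - c)) * |θ| ^ 6 := by ring
        _ ≤ _ := by gcongr
    have h2 : |c / 32 * |θ| ^ 5 * ((symDisc c θ - 16 * (2 - c))
            / (32 * (2 - c) * symDisc c θ))|
        ≤ |c| / 32 * (L * Real.pi / (256 * (2 - c) ^ 2)) * |θ| ^ 6 := by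
      rw [abs_mul, abs_mul, abs_div, abs_div, abs_pow, abs_abs,
        abs_of_pos (by norm_num : (0 : ℝ) < 32),
        abs_of_pos (by positivity : 0 < 32 * (2 - c) * symDisc c θ)]
      calc |c| / 32 * |θ| ^ 5 * (|symDisc c θ - 16 * (2 - c)| / (32 * (2 - c) * symDisc c θ))
          ≤ |c| / 32 * |θ| ^ 5 * (L * |θ| ^ 2 / (256 * (2 - c) ^ 2)) := by
            refine mul_le_mul_of_nonneg_left ?_ (by positivity)
            exact div_le_div₀ (by positivity) (hdisc θ hθ) (by positivity) (by nlinarith)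
        _ = |c| / 32 * (L * |θ| / (256 * (2 - c) ^ 2)) * |θ| ^ 6 := by ring
        _ ≤ _ := by gcongr
    exact add_le_add h1 h2

theorem defect_nonneg_le {c θ : ℝ} (hc : c < 2) (hθ : |θ| ≤ Real.pi) :
    0 ≤ (symDisc c θ - symGap c θ) / (2 * symDisc c θ) ∧
      (symDisc c θ - symGap c θ) / (2 * symDisc c θ) ≤ 1 / 2 := by
  have h1 := symGap_le_symDisc (c := c) (θ := θ)
  have h2 := symGap_nonneg hc hθ
  have h0 := symDisc_nonneg c θ
  refine ⟨div_nonneg (by linarith) (by linarith), ?_⟩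
  rcases h0.eq_or_lt with h | h
  · rw [← h]; norm_num
  · rw [div_le_iff₀ (by positivity)]
    linarith

/-- Rationalizing, `symDisc - symGap = symUp * symDown / (symDisc + symGap)`, and the numerator is
`2c²(1 - cos θ)³`. This is the sixth-order back-reaction of the high mode on the low amplitude. -/
theorem exists_defect_expansion {c : ℝ} (hc : c < 2) :
    ∃ C : ℝ, 0 ≤ C ∧ ∀ θ : ℝ, |θ| ≤ Real.pi →
      |(symDisc c θ - symGap c θ) / (2 * symDisc c θ)| ≤ C * |θ| ^ 6 := by
  have hm : 0 < 2 - c := by linarith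
  refine exists_bound_of_eventually (B := 1 / 2) (C := c ^ 2 / (128 * (2 - c) ^ 2)) ?_ ?_
  · intro θ hθ
    obtain ⟨h1, h2⟩ := defect_nonneg_le hc hθ
    rwa [abs_of_nonneg h1]
  · filter_upwards [eventually_symDisc_ge hc] with θ h8 hθ
    obtain ⟨h1, -⟩ := defect_nonneg_le hc hθ
    have hd : 0 < symDisc c θ := by linarith
    have h2 := symGap_nonneg hc hθ
    have hz : 1 - Real.cos θ ≤ θ ^ 2 / 2 := by
      linarith [Real.one_sub_sq_div_two_le_cos (x := θ)]
    have hz0 : 0 ≤ 1 - Real.cos θ := by linarith [Real.cos_le_one θ]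
    have e : (symDisc c θ - symGap c θ) / (2 * symDisc c θ)
        = 2 * c ^ 2 * (1 - Real.cos θ) ^ 3
          / (2 * symDisc c θ * (symDisc c θ + symGap c θ)) := by
      rw [← symUp_mul_symDown, div_eq_div_iff (by positivity) (by positivity)]
      linear_combination (2 * symDisc c θ) * symDisc_sq c θ
    rw [abs_of_nonneg h1, e]
    calc 2 * c ^ 2 * (1 - Real.cos θ) ^ 3 / (2 * symDisc c θ * (symDisc c θ + symGap c θ))
        ≤ 2 * c ^ 2 * (θ ^ 2 / 2) ^ 3 / (2 * (8 * (2 - c)) * (8 * (2 - c) + 0)) := by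
          gcongr
      _ = c ^ 2 * θ ^ 6 / (512 * (2 - c) ^ 2) := by
          field_simp
          ring
      _ ≤ c ^ 2 * θ ^ 6 / (128 * (2 - c) ^ 2) := by
          gcongr
          norm_num
      _ = c ^ 2 / (128 * (2 - c) ^ 2) * |θ| ^ 6 := by
          rw [show |θ| ^ 6 = θ ^ 6 from Even.pow_abs ⟨3, rfl⟩ θ]
          ring

/-! ### Solutions of the semi-discrete problem -/

section Solutions

variable {c : ℝ} {N : ℕ} [NeZero N]

theorem IsSemidiscreteSolution.eqOn {v₀ : Grid N} {v w : ℝ → Grid N}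
    (hw : IsSemidiscreteSolution c N v₀ w) (hv : IsSemidiscreteSolution c N v₀ v) :
    Set.EqOn w v (Set.Ici 0) := by
  intro t ht
  have hLip := (LinearMap.toContinuousLinearMap (blockOp c N)).lipschitz
  have hcont : ∀ {u : ℝ → Grid N}, IsSemidiscreteSolution c N v₀ u →
      ContinuousOn u (Set.Icc 0 t) := fun hu s hs =>
    ((hu.2 s hs.1).continuousWithinAt).mono Set.Icc_subset_Ici_self
  have hder : ∀ {u : ℝ → Grid N}, IsSemidiscreteSolution c N v₀ u → ∀ s ∈ Set.Ico 0 t,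
      HasDerivWithinAt u (LinearMap.toContinuousLinearMap (blockOp c N) (u s))
        (Set.Ici s) s := fun hu s hs =>
    (hu.2 s hs.1).mono (Set.Ici_subset_Ici.2 hs.1)
  exact ODE_solution_unique (v := fun _ => LinearMap.toContinuousLinearMap (blockOp c N))
    (fun _ => hLip) (hcont hw) (hder hw) (hcont hv) (hder hv) (hw.1.trans hv.1.symm)
    (Set.right_mem_Icc.2 ht)

theorem IsSemidiscreteSolution.eq {v₀ : Grid N} {v w : ℝ → Grid N}
    (hw : IsSemidiscreteSolution c N v₀ w) (hv : IsSemidiscreteSolution c N v₀ v)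
    {t : ℝ} (ht : 0 ≤ t) : w t = v t := hw.eqOn hv ht

variable (c N) in
/-- The semigroup `exp (t Q)`. -/
def semigroup (t : ℝ) : Grid N →L[ℂ] Grid N :=
  NormedSpace.exp ((t : ℂ) • LinearMap.toContinuousLinearMap (blockOp c N))

theorem isSemidiscreteSolution_semigroup (v₀ : Grid N) :
    IsSemidiscreteSolution c N v₀ (fun t => semigroup c N t v₀) := by
  refine ⟨?_, fun t _ => ?_⟩
  · simp only [semigroup, Complex.ofReal_zero]
    have e : (0 : ℂ) • LinearMap.toContinuousLinearMap (blockOp c N) = 0 := by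
      ext v p
      simp
    exact congrArg (fun L : Grid N →L[ℂ] Grid N => L v₀)
      ((congrArg NormedSpace.exp e).trans NormedSpace.exp_zero)
  have h1 := (hasDerivAt_exp_smul_const' (𝕂 := ℂ)
    (LinearMap.toContinuousLinearMap (blockOp c N)) (t : ℂ)).clm_apply
    (hasDerivAt_const (t : ℂ) v₀)
  simp only [map_zero, add_zero] at h1
  have h2 := h1.scomp t Complex.ofRealCLM.hasDerivAt
  rw [Complex.ofRealCLM_apply, Complex.ofReal_one, one_smul] at h2
  exact h2.hasDerivWithinAt

/-- Invariance of the plane reduces the grid problem to a planar real system. -/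
theorem isSemidiscreteSolution_of_coeffs {ω : ℤ} (hω : |2 * ω| ≤ N) {a b : ℝ → ℝ}
    (ha : ∀ t, HasDerivAt a (((symMean c (meshSize N * ω) + symGap c (meshSize N * ω)) * a t
      + symDown c (meshSize N * ω) * b t) / (3 * meshSize N ^ 2)) t)
    (hb : ∀ t, HasDerivAt b ((symUp c (meshSize N * ω) * a t
      + (symMean c (meshSize N * ω) - symGap c (meshSize N * ω)) * b t)
        / (3 * meshSize N ^ 2)) t) :
    IsSemidiscreteSolution c N ((a 0 : ℂ) • mode N ω + (b 0 : ℂ) • mode N (highFreq N ω))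
      (fun t => (a t : ℂ) • mode N ω + (b t : ℂ) • mode N (highFreq N ω)) := by
  refine ⟨rfl, fun t _ => ?_⟩
  have h := ((ha t).ofReal_comp.smul_const (mode N ω)).add
    ((hb t).ofReal_comp.smul_const (mode N (highFreq N ω)))
  have e : blockOp c N ((a t : ℂ) • mode N ω + (b t : ℂ) • mode N (highFreq N ω))
      = ((((symMean c (meshSize N * ω) + symGap c (meshSize N * ω)) * a t
        + symDown c (meshSize N * ω) * b t) / (3 * meshSize N ^ 2) : ℝ) : ℂ) • mode N ω
        + (((symUp c (meshSize N * ω) * a t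
          + (symMean c (meshSize N * ω) - symGap c (meshSize N * ω)) * b t)
          / (3 * meshSize N ^ 2) : ℝ) : ℂ) • mode N (highFreq N ω) := by
    rw [map_add, map_smul, map_smul, blockOp_low c hω, blockOp_high c hω]
    ext p
    simp only [Pi.add_apply, Pi.smul_apply, smul_eq_mul]
    push_cast
    ring
  rw [e]
  exact h.hasDerivWithinAt

end Solutions

/-! ### Entries of the exponential of a block -/

section Coefficients

variable (c h ω t : ℝ)

/-- The amplitude of the low mode in the solution started from the low mode. -/
def ampLowLow : ℝ :=
  Real.exp (Qhat1 c h ω * t)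
    - (symDisc c (h * ω) - symGap c (h * ω)) / (2 * symDisc c (h * ω))
      * (Real.exp (Qhat1 c h ω * t) - Real.exp (Qhat2 c h ω * t))

/-- The amplitude of the high mode in the solution started from the low mode. -/
def ampLowHigh : ℝ :=
  symUp c (h * ω) / (2 * symDisc c (h * ω))
    * (Real.exp (Qhat1 c h ω * t) - Real.exp (Qhat2 c h ω * t))

/-- The amplitude of the low mode in the solution started from the high mode. -/
def ampHighLow : ℝ :=
  symDown c (h * ω) / (2 * symDisc c (h * ω))
    * (Real.exp (Qhat1 c h ω * t) - Real.exp (Qhat2 c h ω * t))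

/-- The amplitude of the high mode in the solution started from the high mode. -/
def ampHighHigh : ℝ :=
  Real.exp (Qhat1 c h ω * t)
    - (symDisc c (h * ω) + symGap c (h * ω)) / (2 * symDisc c (h * ω))
      * (Real.exp (Qhat1 c h ω * t) - Real.exp (Qhat2 c h ω * t))

end Coefficients

theorem hasDerivAt_exp_mul (q t : ℝ) :
    HasDerivAt (fun s => Real.exp (q * s)) (q * Real.exp (q * t)) t := by
  have h := ((hasDerivAt_id t).const_mul q).exp
  simpa [mul_comm] using h

section ExplicitSolutions

variable {c : ℝ} {N : ℕ} [NeZero N] {ω : ℤ}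

/-- For a 2×2 matrix `M` with eigenvalues `λ₁ ≠ λ₂`, `exp(tM) = e^{λ₁t} - (λ₁ - M)/(λ₁ - λ₂)
(e^{λ₁t} - e^{λ₂t})`. The amplitudes are the first column of this formula. -/
theorem isSemidiscreteSolution_low (hc : c < 2) (hω : |2 * ω| ≤ N) :
    IsSemidiscreteSolution c N (mode N ω) (fun t =>
      (ampLowLow c (meshSize N) ω t : ℂ) • mode N ω
        + (ampLowHigh c (meshSize N) ω t : ℂ) • mode N (highFreq N ω)) := by
  have hh : (meshSize N) ≠ 0 := meshSize_ne_zero N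
  have key := isSemidiscreteSolution_of_coeffs (c := c) hω
    (a := ampLowLow c (meshSize N) ω) (b := ampLowHigh c (meshSize N) ω) ?_ ?_
  · simpa [ampLowLow, ampLowHigh] using key
  all_goals
    intro t
    have h1 := hasDerivAt_exp_mul (Qhat1 c (meshSize N) ω) t
    have h2 := hasDerivAt_exp_mul (Qhat2 c (meshSize N) ω) t
    have hsq := symDisc_sq c (meshSize N * ω)
    -- For a scalar block the quotients by `symDisc` evaluate to `0`, and the formula still gives
    -- the right exponential.
    rcases (symDisc_nonneg c (meshSize N * ω)).eq_or_lt with h0 | h0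
    on_goal 1 =>
      obtain ⟨hc0, hg⟩ := eq_zero_of_symDisc_eq_zero hc h0.symm
      have hup : symUp c (meshSize N * ω) = 0 := by simp [symUp, hc0]
      have hdown : symDown c (meshSize N * ω) = 0 := by simp [symDown, hc0]
  · refine (h1.sub ((h1.sub h2).const_mul ((symDisc c (meshSize N * ω)
      - symGap c (meshSize N * ω)) / (2 * symDisc c (meshSize N * ω))))).congr_deriv ?_
    simp only [ampLowLow, ampLowHigh, Qhat1_eq, Qhat2_eq, ← h0, hg, hup, hdown]
    simp
    ring
  · refine (h1.sub ((h1.sub h2).const_mul ((symDisc c (meshSize N * ω)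
      - symGap c (meshSize N * ω)) / (2 * symDisc c (meshSize N * ω))))).congr_deriv ?_
    simp only [ampLowLow, ampLowHigh]
    generalize Real.exp (Qhat1 c (meshSize N) ω * t) = e1
    generalize Real.exp (Qhat2 c (meshSize N) ω * t) = e2
    rw [Qhat1_eq, Qhat2_eq]
    field_simp
    linear_combination (e1 - e2) * hsq
  · refine ((h1.sub h2).const_mul (symUp c (meshSize N * ω)
      / (2 * symDisc c (meshSize N * ω)))).congr_deriv ?_
    simp only [ampLowLow, ampLowHigh, Qhat1_eq, Qhat2_eq, ← h0, hg, hup]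
    simp
  · refine ((h1.sub h2).const_mul (symUp c (meshSize N * ω)
      / (2 * symDisc c (meshSize N * ω)))).congr_deriv ?_
    simp only [ampLowLow, ampLowHigh]
    generalize Real.exp (Qhat1 c (meshSize N) ω * t) = e1
    generalize Real.exp (Qhat2 c (meshSize N) ω * t) = e2
    rw [Qhat1_eq, Qhat2_eq]
    field_simp
    ring

theorem isSemidiscreteSolution_high (hc : c < 2) (hω : |2 * ω| ≤ N) :
    IsSemidiscreteSolution c N (mode N (highFreq N ω)) (fun t =>
      (ampHighLow c (meshSize N) ω t : ℂ) • mode N ω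
        + (ampHighHigh c (meshSize N) ω t : ℂ) • mode N (highFreq N ω)) := by
  have hh : (meshSize N) ≠ 0 := meshSize_ne_zero N
  have key := isSemidiscreteSolution_of_coeffs (c := c) hω
    (a := ampHighLow c (meshSize N) ω) (b := ampHighHigh c (meshSize N) ω) ?_ ?_
  · simpa [ampHighLow, ampHighHigh] using key
  all_goals
    intro t
    have h1 := hasDerivAt_exp_mul (Qhat1 c (meshSize N) ω) t
    have h2 := hasDerivAt_exp_mul (Qhat2 c (meshSize N) ω) t
    have hsq := symDisc_sq c (meshSize N * ω)
    rcases (symDisc_nonneg c (meshSize N * ω)).eq_or_lt with h0 | h0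
    on_goal 1 =>
      obtain ⟨hc0, hg⟩ := eq_zero_of_symDisc_eq_zero hc h0.symm
      have hup : symUp c (meshSize N * ω) = 0 := by simp [symUp, hc0]
      have hdown : symDown c (meshSize N * ω) = 0 := by simp [symDown, hc0]
  · refine ((h1.sub h2).const_mul (symDown c (meshSize N * ω)
      / (2 * symDisc c (meshSize N * ω)))).congr_deriv ?_
    simp only [ampHighLow, ampHighHigh, Qhat1_eq, Qhat2_eq, ← h0, hg, hdown]
    simp
  · refine ((h1.sub h2).const_mul (symDown c (meshSize N * ω)
      / (2 * symDisc c (meshSize N * ω)))).congr_deriv ?_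
    simp only [ampHighLow, ampHighHigh]
    generalize Real.exp (Qhat1 c (meshSize N) ω * t) = e1
    generalize Real.exp (Qhat2 c (meshSize N) ω * t) = e2
    rw [Qhat1_eq, Qhat2_eq]
    field_simp
    ring
  · refine (h1.sub ((h1.sub h2).const_mul ((symDisc c (meshSize N * ω)
      + symGap c (meshSize N * ω)) / (2 * symDisc c (meshSize N * ω))))).congr_deriv ?_
    simp only [ampHighLow, ampHighHigh, Qhat1_eq, Qhat2_eq, ← h0, hg, hup, hdown]
    simp
    ring
  · refine (h1.sub ((h1.sub h2).const_mul ((symDisc c (meshSize N * ω)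
      + symGap c (meshSize N * ω)) / (2 * symDisc c (meshSize N * ω))))).congr_deriv ?_
    simp only [ampHighLow, ampHighHigh]
    generalize Real.exp (Qhat1 c (meshSize N) ω * t) = e1
    generalize Real.exp (Qhat2 c (meshSize N) ω * t) = e2
    rw [Qhat1_eq, Qhat2_eq]
    field_simp
    linear_combination (e1 - e2) * hsq

end ExplicitSolutions

/-! ### Uniform estimates of the amplitudes -/

theorem exp_sub_exp_le (x y : ℝ) : Real.exp x - Real.exp y ≤ (x - y) * Real.exp x := by
  have h := Real.add_one_le_exp (y - x)
  have h2 : Real.exp y = Real.exp (y - x) * Real.exp x := by rw [← Real.exp_add]; ring_nf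
  rw [h2]
  nlinarith [Real.exp_pos x]

theorem abs_exp_sub_exp_le {x y M : ℝ} (hx : x ≤ M) (hy : y ≤ M) :
    |Real.exp x - Real.exp y| ≤ |x - y| * Real.exp M := by
  have hx' : Real.exp x ≤ Real.exp M := Real.exp_le_exp.2 hx
  have hy' : Real.exp y ≤ Real.exp M := Real.exp_le_exp.2 hy
  have h1 := exp_sub_exp_le x y
  have h2 := exp_sub_exp_le y x
  have h3 : (x - y) * Real.exp x ≤ |x - y| * Real.exp M :=
    mul_le_mul (le_abs_self _) hx' (Real.exp_pos _).le (abs_nonneg _)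
  have h4 : (y - x) * Real.exp y ≤ |x - y| * Real.exp M := by
    rw [abs_sub_comm]
    exact mul_le_mul (le_abs_self _) hy' (Real.exp_pos _).le (abs_nonneg _)
  rw [abs_le]
  constructor <;> linarith

/-- By convexity the first-order remainder lies between `0` and `(x - y)(e^x - e^y)`. -/
theorem abs_exp_sub_exp_sub_le {x y M : ℝ} (hx : x ≤ M) (hy : y ≤ M) :
    |Real.exp x - Real.exp y - (x - y) * Real.exp y| ≤ (x - y) ^ 2 * Real.exp M := by
  have h1 := exp_sub_exp_le x y
  have h2 := exp_sub_exp_le y x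
  have h3 := abs_exp_sub_exp_le hx hy
  rw [abs_of_nonneg (by linarith)]
  calc Real.exp x - Real.exp y - (x - y) * Real.exp y
      ≤ (x - y) * (Real.exp x - Real.exp y) := by linarith
    _ ≤ |x - y| * |Real.exp x - Real.exp y| := by rw [← abs_mul]; exact le_abs_self _
    _ ≤ |x - y| * (|x - y| * Real.exp M) := by gcongr
    _ = _ := by rw [← mul_assoc, ← pow_two, sq_abs]

/-- Decay absorbs a factor of time; this makes the amplitude estimates uniform in `t`. -/
theorem mul_exp_neg_le {δ τ : ℝ} (hδ : 0 < δ) : τ * Real.exp (-(δ * τ)) ≤ 1 / δ := by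
  have h := Real.add_one_le_exp (δ * τ)
  rw [Real.exp_neg, ← div_eq_mul_inv, div_le_div_iff₀ (Real.exp_pos _) hδ]
  linarith

theorem sq_mul_exp_neg_le {δ τ : ℝ} (hδ : 0 < δ) (hτ : 0 ≤ τ) :
    τ ^ 2 * Real.exp (-(δ * τ)) ≤ 4 / δ ^ 2 := by
  have h := mul_exp_neg_le (τ := τ) (half_pos hδ)
  have h0 : 0 ≤ τ * Real.exp (-(δ / 2 * τ)) := by positivity
  have h1 : τ ^ 2 * Real.exp (-(δ * τ)) = (τ * Real.exp (-(δ / 2 * τ))) ^ 2 := by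
    rw [mul_pow, ← Real.exp_nat_mul]
    push_cast
    ring_nf
  rw [h1]
  calc (τ * Real.exp (-(δ / 2 * τ))) ^ 2 ≤ (1 / (δ / 2)) ^ 2 := by gcongr
    _ = 4 / δ ^ 2 := by field_simp; norm_num

section Bounds

variable {c : ℝ}

theorem Qhat2_le_Qhat1 (c h ω : ℝ) : Qhat2 c h ω ≤ Qhat1 c h ω := by
  rw [Qhat1_eq, Qhat2_eq]
  gcongr
  linarith [symDisc_nonneg c (h * ω)]

theorem Qhat2_le (hc : c < 2) (h ω : ℝ) : Qhat2 c h ω ≤ -(4 * (2 - c)) / (3 * h ^ 2) := by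
  rw [Qhat2_eq]
  gcongr
  linarith [symDisc_nonneg c (h * ω), symMean_le hc (h * ω)]

theorem exists_Qhat1_le (hc : c < 2) :
    ∃ δ : ℝ, 0 < δ ∧ δ ≤ 1 ∧ ∀ h ω : ℝ, 0 < h → |h * ω| ≤ Real.pi →
      Qhat1 c h ω ≤ -(δ * ω ^ 2) := by
  obtain ⟨δ, h0, h1, hδ⟩ := exists_symMean_add_symDisc_le hc
  refine ⟨δ, h0, h1, fun h ω hh hθ => ?_⟩
  rw [Qhat1_eq, div_le_iff₀ (by positivity)]
  linarith [hδ _ hθ]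

theorem exists_Qhat1_expansion (hc : c < 2) :
    ∃ C : ℝ, 0 ≤ C ∧ ∀ h ω : ℝ, 0 < h → |h * ω| ≤ Real.pi →
      |Qhat1 c h ω - (-ω ^ 2 - (4 + 13 * c) * ω ^ 6 * h ^ 4 / (2880 * (-2 + c)))|
        ≤ C * ω ^ 8 * h ^ 6 := by
  obtain ⟨C, hC0, hC⟩ := exists_low_expansion hc
  refine ⟨C, hC0, fun h ω hh hθ => ?_⟩
  have e : Qhat1 c h ω - (-ω ^ 2 - (4 + 13 * c) * ω ^ 6 * h ^ 4 / (2880 * (-2 + c)))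
      = ((symMean c (h * ω) + symDisc c (h * ω)) / 3
        - (-(h * ω) ^ 2 - (4 + 13 * c) / (2880 * (-2 + c)) * (h * ω) ^ 6)) / h ^ 2 := by
    rw [Qhat1_eq]
    have : -2 + c ≠ 0 := by linarith
    field_simp
  rw [e, abs_div, abs_of_pos (by positivity : 0 < h ^ 2), div_le_iff₀ (by positivity)]
  refine (hC _ hθ).trans (le_of_eq ?_)
  rw [show |h * ω| ^ 8 = (h * ω) ^ 8 from Even.pow_abs ⟨4, rfl⟩ _]
  ring

theorem exists_Qhat2_expansion (hc : c < 2) :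
    ∃ C : ℝ, 0 ≤ C ∧ ∀ h ω : ℝ, 0 < h → |h * ω| ≤ Real.pi →
      |Qhat2 c h ω - (32 * (-2 + c) / (3 * h ^ 2) - (-5 + 6 * c) * ω ^ 2 / 3
            + (-1 + 3 * c) * ω ^ 4 * h ^ 2 / 18)| ≤ C * ω ^ 6 * h ^ 4 := by
  obtain ⟨C, hC0, hC⟩ := exists_high_expansion hc
  refine ⟨C, hC0, fun h ω hh hθ => ?_⟩
  have e : Qhat2 c h ω - (32 * (-2 + c) / (3 * h ^ 2) - (-5 + 6 * c) * ω ^ 2 / 3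
            + (-1 + 3 * c) * ω ^ 4 * h ^ 2 / 18)
      = ((symMean c (h * ω) - symDisc c (h * ω)) / 3
        - (32 * (-2 + c) / 3 - (-5 + 6 * c) * (h * ω) ^ 2 / 3
          + (-1 + 3 * c) * (h * ω) ^ 4 / 18)) / h ^ 2 := by
    rw [Qhat2_eq]
    field_simp
  rw [e, abs_div, abs_of_pos (by positivity : 0 < h ^ 2), div_le_iff₀ (by positivity)]
  refine (hC _ hθ).trans (le_of_eq ?_)
  rw [show |h * ω| ^ 6 = (h * ω) ^ 6 from Even.pow_abs ⟨3, rfl⟩ _]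
  ring

/-- With `τ = ω²t`, both exponents are at most `-δτ` and differ by `O(θ⁴τ)`, so `τ e^{-δτ} ≤ 1/δ`
gives the first estimate. The second is a first-order expansion: its quadratic remainder is `θ⁸ τ²
e^{-δτ}`, and the eigenvalue error contributes `θ⁶ τ e^{-δτ}`. -/
theorem exists_exp_Qhat1_bounds (hc : c < 2) :
    ∃ C : ℝ, 0 ≤ C ∧ ∀ h ω t : ℝ, 0 < h → |h * ω| ≤ Real.pi → 0 ≤ t →
      Real.exp (Qhat1 c h ω * t) ≤ 1 ∧
      |Real.exp (Qhat1 c h ω * t) - Real.exp (-ω ^ 2 * t)| ≤ C * |h * ω| ^ 4 ∧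
      |Real.exp (Qhat1 c h ω * t) - Real.exp (-ω ^ 2 * t)
          * (1 - (4 + 13 * c) * ω ^ 6 * t * h ^ 4 / (2880 * (-2 + c)))|
        ≤ C * |h * ω| ^ 6 := by
  obtain ⟨δ, hδ0, hδ1, hδ⟩ := exists_Qhat1_le hc
  obtain ⟨C, hC0, hC⟩ := exists_Qhat1_expansion hc
  set κ : ℝ := (4 + 13 * c) / (2880 * (-2 + c)) with hκ
  set K : ℝ := |κ| + C * Real.pi ^ 2 with hK
  have hK0 : 0 ≤ K := by positivity
  refine ⟨K / δ + (4 * K ^ 2 * Real.pi ^ 2 / δ ^ 2 + C / δ), by positivity,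
    fun h ω t hh hθ ht => ?_⟩
  set τ : ℝ := ω ^ 2 * t with hτ
  have hτ0 : 0 ≤ τ := by positivity
  have hθ2 : (h * ω) ^ 2 ≤ Real.pi ^ 2 := by rw [← sq_abs]; gcongr
  have hx : Qhat1 c h ω * t ≤ -(δ * τ) := by
    have := mul_le_mul_of_nonneg_right (hδ h ω hh hθ) ht
    rw [hτ]; linarith
  have hy : -ω ^ 2 * t ≤ -(δ * τ) := by
    have := mul_le_mul_of_nonneg_right hδ1 hτ0
    rw [hτ] at *; linarith
  have hM : -(δ * τ) ≤ 0 := by nlinarith [mul_nonneg hδ0.le hτ0]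
  have hd2 : |Qhat1 c h ω * t - -ω ^ 2 * t + κ * (h * ω) ^ 4 * τ| ≤ C * (h * ω) ^ 6 * τ := by
    have e : Qhat1 c h ω * t - -ω ^ 2 * t + κ * (h * ω) ^ 4 * τ
        = (Qhat1 c h ω - (-ω ^ 2 - (4 + 13 * c) * ω ^ 6 * h ^ 4 / (2880 * (-2 + c)))) * t := by
      rw [hτ, hκ]; ring
    rw [e, abs_mul, abs_of_nonneg ht]
    refine (mul_le_mul_of_nonneg_right (hC h ω hh hθ) ht).trans (le_of_eq ?_)
    rw [hτ]; ring
  have hd1 : |Qhat1 c h ω * t - -ω ^ 2 * t| ≤ K * (h * ω) ^ 4 * τ := by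
    have h1 : |κ * (h * ω) ^ 4 * τ| = |κ| * (h * ω) ^ 4 * τ := by
      rw [abs_mul, abs_mul, abs_of_nonneg hτ0, abs_of_nonneg (by positivity : 0 ≤ (h * ω) ^ 4)]
    have h2 : C * (h * ω) ^ 6 * τ ≤ C * Real.pi ^ 2 * (h * ω) ^ 4 * τ := by
      calc C * (h * ω) ^ 6 * τ = C * (h * ω) ^ 2 * (h * ω) ^ 4 * τ := by ring
        _ ≤ _ := by gcongr
    have h3 := abs_sub (Qhat1 c h ω * t - -ω ^ 2 * t + κ * (h * ω) ^ 4 * τ)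
      (κ * (h * ω) ^ 4 * τ)
    rw [add_sub_cancel_right] at h3
    rw [hK]
    linarith
  have hexp1 : τ * Real.exp (-(δ * τ)) ≤ 1 / δ := mul_exp_neg_le hδ0
  have hexp2 : τ ^ 2 * Real.exp (-(δ * τ)) ≤ 4 / δ ^ 2 := sq_mul_exp_neg_le hδ0 hτ0
  rw [show |h * ω| ^ 4 = (h * ω) ^ 4 from Even.pow_abs ⟨2, rfl⟩ _,
    show |h * ω| ^ 6 = (h * ω) ^ 6 from Even.pow_abs ⟨3, rfl⟩ _]
  have p4 : 0 ≤ (h * ω) ^ 4 := by positivity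
  have p6 : 0 ≤ (h * ω) ^ 6 := by positivity
  refine ⟨Real.exp_le_one_iff.2 (hx.trans hM), ?_, ?_⟩
  · calc |Real.exp (Qhat1 c h ω * t) - Real.exp (-ω ^ 2 * t)|
        ≤ |Qhat1 c h ω * t - -ω ^ 2 * t| * Real.exp (-(δ * τ)) := abs_exp_sub_exp_le hx hy
      _ ≤ K * (h * ω) ^ 4 * τ * Real.exp (-(δ * τ)) := by gcongr
      _ = K * (h * ω) ^ 4 * (τ * Real.exp (-(δ * τ))) := by ring
      _ ≤ K * (h * ω) ^ 4 * (1 / δ) := by gcongr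
      _ = K / δ * (h * ω) ^ 4 := by ring
      _ ≤ _ := by
        gcongr
        exact le_add_of_nonneg_right (by positivity)
  · have e : Real.exp (Qhat1 c h ω * t) - Real.exp (-ω ^ 2 * t)
          * (1 - (4 + 13 * c) * ω ^ 6 * t * h ^ 4 / (2880 * (-2 + c)))
        = (Real.exp (Qhat1 c h ω * t) - Real.exp (-ω ^ 2 * t)
            - (Qhat1 c h ω * t - -ω ^ 2 * t) * Real.exp (-ω ^ 2 * t))
          + (Qhat1 c h ω * t - -ω ^ 2 * t + κ * (h * ω) ^ 4 * τ) * Real.exp (-ω ^ 2 * t) := by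
      rw [hτ, hκ]; ring
    have h1 : |Real.exp (Qhat1 c h ω * t) - Real.exp (-ω ^ 2 * t)
            - (Qhat1 c h ω * t - -ω ^ 2 * t) * Real.exp (-ω ^ 2 * t)|
        ≤ 4 * K ^ 2 * Real.pi ^ 2 / δ ^ 2 * (h * ω) ^ 6 := by
      calc _ ≤ (Qhat1 c h ω * t - -ω ^ 2 * t) ^ 2 * Real.exp (-(δ * τ)) :=
            abs_exp_sub_exp_sub_le hx hy
        _ ≤ (K * (h * ω) ^ 4 * τ) ^ 2 * Real.exp (-(δ * τ)) := by
            rw [← sq_abs (Qhat1 c h ω * t - -ω ^ 2 * t)]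
            gcongr
        _ = K ^ 2 * (h * ω) ^ 2 * (h * ω) ^ 6 * (τ ^ 2 * Real.exp (-(δ * τ))) := by ring
        _ ≤ K ^ 2 * Real.pi ^ 2 * (h * ω) ^ 6 * (4 / δ ^ 2) := by gcongr
        _ = _ := by ring
    have h2 : |(Qhat1 c h ω * t - -ω ^ 2 * t + κ * (h * ω) ^ 4 * τ) * Real.exp (-ω ^ 2 * t)|
        ≤ C / δ * (h * ω) ^ 6 := by
      rw [abs_mul, abs_of_pos (Real.exp_pos _)]
      calc _ ≤ C * (h * ω) ^ 6 * τ * Real.exp (-(δ * τ)) := by gcongr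
        _ = C * (h * ω) ^ 6 * (τ * Real.exp (-(δ * τ))) := by ring
        _ ≤ C * (h * ω) ^ 6 * (1 / δ) := by gcongr
        _ = _ := by ring
    rw [e]
    refine (abs_add_le _ _).trans ((add_le_add h1 h2).trans ?_)
    rw [← add_mul]
    exact mul_le_mul_of_nonneg_right (le_add_of_nonneg_left (by positivity)) p6

theorem abs_exp_sub_exp_le_one {x y : ℝ} (hx : Real.exp x ≤ 1) (hyx : y ≤ x) :
    |Real.exp x - Real.exp y| ≤ 1 := by
  have h1 := Real.exp_le_exp.2 hyx
  rw [abs_of_nonneg (by linarith)]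
  linarith [Real.exp_pos y]

/-- The low amplitude is `e^{Q̂₁t}` up to the sixth-order defect. In the high amplitude the
prefactor is expanded first; replacing `e^{Q̂₁t}` by `e^{-ω²t}` then costs only `θ⁵ θ⁴`. -/
theorem exists_ampLow_bounds (hc : c < 2) :
    ∃ C : ℝ, 0 ≤ C ∧ ∀ h ω t : ℝ, 0 < h → |h * ω| ≤ Real.pi → 0 ≤ t →
      |ampLowLow c h ω t - Real.exp (-ω ^ 2 * t)
          * (1 - (4 + 13 * c) * ω ^ 6 * t * h ^ 4 / (2880 * (-2 + c)))|
        ≤ C * (|ω| * h) ^ 6 ∧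
      |ampLowHigh c h ω t - -(c * (|ω| * h) ^ 5 / (1024 * (-2 + c)))
          * (Real.exp (-ω ^ 2 * t) - Real.exp (Qhat2 c h ω * t))|
        ≤ C * (|ω| * h) ^ 6 := by
  obtain ⟨C1, hC1, hE⟩ := exists_exp_Qhat1_bounds hc
  obtain ⟨C2, hC2, hdef⟩ := exists_defect_expansion hc
  obtain ⟨C3, hC3, hup⟩ := exists_symUp_div_expansion hc
  set ρ : ℝ := |c| / |1024 * (-2 + c)| with hρ
  have hρ0 : 0 ≤ ρ := by positivity
  refine ⟨C1 + C2 + C3 + ρ * C1 * Real.pi ^ 3, by positivity, fun h ω t hh hθ ht => ?_⟩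
  obtain ⟨h1, h4, h6⟩ := hE h ω t hh hθ ht
  have hθe : |ω| * h = |h * ω| := by rw [abs_mul, abs_of_pos hh, mul_comm]
  rw [hθe]
  set θ : ℝ := h * ω with hθd
  have hdiff : |Real.exp (Qhat1 c h ω * t) - Real.exp (Qhat2 c h ω * t)| ≤ 1 :=
    abs_exp_sub_exp_le_one h1 (mul_le_mul_of_nonneg_right (Qhat2_le_Qhat1 c h ω) ht)
  have p6 : 0 ≤ |θ| ^ 6 := by positivity
  have hd := hdef θ hθ
  have hu := hup θ hθ
  constructor
  · have e : ampLowLow c h ω t - Real.exp (-ω ^ 2 * t)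
          * (1 - (4 + 13 * c) * ω ^ 6 * t * h ^ 4 / (2880 * (-2 + c)))
        = (Real.exp (Qhat1 c h ω * t) - Real.exp (-ω ^ 2 * t)
          * (1 - (4 + 13 * c) * ω ^ 6 * t * h ^ 4 / (2880 * (-2 + c))))
          - (symDisc c θ - symGap c θ) / (2 * symDisc c θ)
            * (Real.exp (Qhat1 c h ω * t) - Real.exp (Qhat2 c h ω * t)) := by
      rw [ampLowLow]; ring
    have h2 : |(symDisc c θ - symGap c θ) / (2 * symDisc c θ)
            * (Real.exp (Qhat1 c h ω * t) - Real.exp (Qhat2 c h ω * t))| ≤ C2 * |θ| ^ 6 * 1 := by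
      rw [abs_mul]
      exact mul_le_mul hd hdiff (abs_nonneg _) (by positivity)
    rw [e]
    refine (abs_sub _ _).trans ((add_le_add h6 h2).trans ?_)
    have : 0 ≤ (C3 + ρ * C1 * Real.pi ^ 3) * |θ| ^ 6 := by positivity
    linarith
  · set η : ℝ := -(c * |θ| ^ 5 / (1024 * (-2 + c))) with hη
    have hηabs : |η| = ρ * |θ| ^ 5 := by
      rw [hη, abs_neg, abs_div, abs_mul, abs_pow, abs_abs, hρ]; ring
    have e : ampLowHigh c h ω t - η * (Real.exp (-ω ^ 2 * t) - Real.exp (Qhat2 c h ω * t))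
        = (symUp c θ / (2 * symDisc c θ) - η)
            * (Real.exp (Qhat1 c h ω * t) - Real.exp (Qhat2 c h ω * t))
          + η * (Real.exp (Qhat1 c h ω * t) - Real.exp (-ω ^ 2 * t)) := by
      rw [ampLowHigh]; ring
    have h2 : |(symUp c θ / (2 * symDisc c θ) - η)
            * (Real.exp (Qhat1 c h ω * t) - Real.exp (Qhat2 c h ω * t))| ≤ C3 * |θ| ^ 6 * 1 := by
      rw [abs_mul]
      exact mul_le_mul hu hdiff (abs_nonneg _) (by positivity)
    have h3 : |η * (Real.exp (Qhat1 c h ω * t) - Real.exp (-ω ^ 2 * t))|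
        ≤ ρ * C1 * Real.pi ^ 3 * |θ| ^ 6 := by
      rw [abs_mul, hηabs]
      calc ρ * |θ| ^ 5 * |Real.exp (Qhat1 c h ω * t) - Real.exp (-ω ^ 2 * t)|
          ≤ ρ * |θ| ^ 5 * (C1 * |θ| ^ 4) := by gcongr
        _ = ρ * C1 * |θ| ^ 3 * |θ| ^ 6 := by ring
        _ ≤ _ := by gcongr
    rw [e]
    refine (abs_add_le _ _).trans ((add_le_add h2 h3).trans ?_)
    have : 0 ≤ (C1 + C2) * |θ| ^ 6 := by positivity
    linarith

/-- Amplitude errors relative to the exact solution. -/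
theorem exists_ampLow_error_bounds (hc : c < 2) :
    ∃ C : ℝ, 0 ≤ C ∧ ∀ h ω t : ℝ, 0 < h → |h * ω| ≤ Real.pi → 0 ≤ t →
      |ampLowLow c h ω t - Real.exp (-ω ^ 2 * t)| ≤ C * |h * ω| ^ 4 ∧
      |ampLowHigh c h ω t| ≤ C * |h * ω| ^ 5 ∧
      (c = -4 / 13 → |ampLowLow c h ω t - Real.exp (-ω ^ 2 * t)| ≤ C * |h * ω| ^ 5) := by
  obtain ⟨C1, hC1, hA⟩ := exists_ampLow_bounds hc
  obtain ⟨C2, hC2, hE⟩ := exists_exp_Qhat1_bounds hc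
  obtain ⟨C3, hC3, hdef⟩ := exists_defect_expansion hc
  set ρ : ℝ := |c| / |1024 * (-2 + c)| with hρ
  have hρ0 : 0 ≤ ρ := by positivity
  refine ⟨C2 + C3 * Real.pi ^ 2 + C1 * Real.pi + ρ, by positivity, fun h ω t hh hθ ht => ?_⟩
  obtain ⟨h1, h4, -⟩ := hE h ω t hh hθ ht
  obtain ⟨hA1, hA2⟩ := hA h ω t hh hθ ht
  have hθe : |ω| * h = |h * ω| := by rw [abs_mul, abs_of_pos hh, mul_comm]
  rw [hθe] at hA1 hA2
  have hdiff : |Real.exp (Qhat1 c h ω * t) - Real.exp (Qhat2 c h ω * t)| ≤ 1 :=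
    abs_exp_sub_exp_le_one h1 (mul_le_mul_of_nonneg_right (Qhat2_le_Qhat1 c h ω) ht)
  have hd := hdef _ hθ
  have h65 : C1 * |h * ω| ^ 6 ≤ C1 * Real.pi * |h * ω| ^ 5 := by
    calc C1 * |h * ω| ^ 6 = C1 * |h * ω| * |h * ω| ^ 5 := by ring
      _ ≤ _ := by gcongr
  refine ⟨?_, ?_, ?_⟩
  · have e : ampLowLow c h ω t - Real.exp (-ω ^ 2 * t)
        = (Real.exp (Qhat1 c h ω * t) - Real.exp (-ω ^ 2 * t))
          - (symDisc c (h * ω) - symGap c (h * ω)) / (2 * symDisc c (h * ω))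
            * (Real.exp (Qhat1 c h ω * t) - Real.exp (Qhat2 c h ω * t)) := by
      rw [ampLowLow]; ring
    have h2 : |(symDisc c (h * ω) - symGap c (h * ω)) / (2 * symDisc c (h * ω))
            * (Real.exp (Qhat1 c h ω * t) - Real.exp (Qhat2 c h ω * t))|
          ≤ C3 * |h * ω| ^ 6 * 1 := by
      rw [abs_mul]
      exact mul_le_mul hd hdiff (abs_nonneg _) (by positivity)
    have h3 : C3 * |h * ω| ^ 6 ≤ C3 * Real.pi ^ 2 * |h * ω| ^ 4 := by
      calc C3 * |h * ω| ^ 6 = C3 * |h * ω| ^ 2 * |h * ω| ^ 4 := by ring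
        _ ≤ _ := by gcongr
    rw [e]
    refine (abs_sub _ _).trans ((add_le_add h4 h2).trans ?_)
    have : 0 ≤ (C1 * Real.pi + ρ) * |h * ω| ^ 4 := by positivity
    linarith
  · set η : ℝ := -(c * |h * ω| ^ 5 / (1024 * (-2 + c))) with hη
    have hηabs : |η| = ρ * |h * ω| ^ 5 := by
      rw [hη, abs_neg, abs_div, abs_mul, abs_pow, abs_abs, hρ]; ring
    have hexp : |Real.exp (-ω ^ 2 * t) - Real.exp (Qhat2 c h ω * t)| ≤ 1 := by
      have e1 : Real.exp (-ω ^ 2 * t) ≤ 1 := Real.exp_le_one_iff.2 (by nlinarith [sq_nonneg ω])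
      have e2 : Real.exp (Qhat2 c h ω * t) ≤ 1 :=
        (Real.exp_le_exp.2 (mul_le_mul_of_nonneg_right (Qhat2_le_Qhat1 c h ω) ht)).trans h1
      rw [abs_le]
      constructor <;> linarith [Real.exp_pos (-ω ^ 2 * t), Real.exp_pos (Qhat2 c h ω * t)]
    have h2 : |η * (Real.exp (-ω ^ 2 * t) - Real.exp (Qhat2 c h ω * t))|
        ≤ ρ * |h * ω| ^ 5 * 1 := by
      rw [abs_mul, hηabs]
      gcongr
    have h3 := abs_add_le (ampLowHigh c h ω t
      - η * (Real.exp (-ω ^ 2 * t) - Real.exp (Qhat2 c h ω * t)))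
      (η * (Real.exp (-ω ^ 2 * t) - Real.exp (Qhat2 c h ω * t)))
    rw [sub_add_cancel] at h3
    have : 0 ≤ (C2 + C3 * Real.pi ^ 2) * |h * ω| ^ 5 := by positivity
    linarith
  · intro hc4
    -- The fourth-order term disappears; the remaining sixth-order bound is weakened to order five.
    have e : (4 + 13 * c) = 0 := by rw [hc4]; norm_num
    rw [e] at hA1
    simp only [zero_mul, zero_div, sub_zero, mul_one] at hA1
    have : 0 ≤ (C2 + C3 * Real.pi ^ 2 + ρ) * |h * ω| ^ 5 := by positivity
    linarith

/-- Stability: all amplitudes are bounded. -/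
theorem exists_amp_bound (hc : c < 2) :
    ∃ K : ℝ, 0 ≤ K ∧ ∀ h ω t : ℝ, 0 < h → |h * ω| ≤ Real.pi → 0 ≤ t →
      |ampLowLow c h ω t| ≤ K ∧ |ampLowHigh c h ω t| ≤ K ∧
      |ampHighLow c h ω t| ≤ K ∧ |ampHighHigh c h ω t| ≤ K := by
  obtain ⟨C, -, hE⟩ := exists_exp_Qhat1_bounds hc
  obtain ⟨K, hK0, hK⟩ := exists_abs_symDown_le hc
  refine ⟨2 + K, by positivity, fun h ω t hh hθ ht => ?_⟩
  obtain ⟨h1, -, -⟩ := hE h ω t hh hθ ht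
  have hdiff : |Real.exp (Qhat1 c h ω * t) - Real.exp (Qhat2 c h ω * t)| ≤ 1 :=
    abs_exp_sub_exp_le_one h1 (mul_le_mul_of_nonneg_right (Qhat2_le_Qhat1 c h ω) ht)
  have h1' : |Real.exp (Qhat1 c h ω * t)| ≤ 1 := by rwa [abs_of_pos (Real.exp_pos _)]
  have hd0 := symDisc_nonneg c (h * ω)
  have key : ∀ {x B : ℝ}, |x| ≤ B * (2 * symDisc c (h * ω)) → 0 ≤ B →
      |x / (2 * symDisc c (h * ω))
        * (Real.exp (Qhat1 c h ω * t) - Real.exp (Qhat2 c h ω * t))| ≤ B := by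
    intro x B hx hB
    rw [abs_mul, abs_div, abs_of_nonneg (by positivity : 0 ≤ 2 * symDisc c (h * ω))]
    have : |x| / (2 * symDisc c (h * ω)) ≤ B := by
      rcases hd0.eq_or_lt with h0 | h0
      · rw [← h0]; simpa using hB
      · rwa [div_le_iff₀ (by positivity)]
    calc _ ≤ B * 1 := mul_le_mul this hdiff (abs_nonneg _) hB
      _ = B := mul_one B
  have hg0 := symGap_nonneg hc hθ
  have hg1 := symGap_le_symDisc (c := c) (θ := h * ω)
  have hu := abs_symUp_le (c := c) hθ
  have hdn := hK _ hθ
  refine ⟨?_, ?_, ?_, ?_⟩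
  · refine (abs_sub _ _).trans ?_
    have := key (x := symDisc c (h * ω) - symGap c (h * ω)) (B := 1)
      (by rw [abs_of_nonneg (by linarith)]; linarith) one_pos.le
    linarith
  · have := key (x := symUp c (h * ω)) (B := 1) (by linarith) one_pos.le
    rw [ampLowHigh]
    linarith
  · have := key (x := symDown c (h * ω)) (B := K) (by nlinarith) hK0
    rw [ampHighLow]
    linarith
  · refine (abs_sub _ _).trans ?_
    have := key (x := symDisc c (h * ω) + symGap c (h * ω)) (B := 1)
      (by rw [abs_of_nonneg (by linarith)]; linarith) one_pos.le
    linarith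

end Bounds

/-! ### The eigenvalue system of a block and its eigenvectors -/

section Eigen

variable {c h ω : ℝ}

theorem Omega_eq (c h ω : ℝ) : Omega c h ω = -symGap c (h * ω) / rDen c h ω := by
  rw [Omega, symGap_eq, mul_comm ω h]
  ring

theorem symDisc_sq_rDen (c h ω : ℝ) :
    symDisc c (h * ω) ^ 2 = symGap c (h * ω) ^ 2
      + 32 * c * (Real.sin (h * ω / 4) ^ 5 * Real.cos (h * ω / 4)) * rDen c h ω := by
  have h6 : |Real.sin (h * ω / 4)| ^ 6 = Real.sin (h * ω / 4) ^ 6 := Even.pow_abs ⟨3, rfl⟩ _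
  rw [symDisc_sq, symUp, symDown, rDen, mul_comm ω h]
  linear_combination 1024 * c ^ 2 * Real.cos (h * ω / 4) ^ 6 * h6

/-- Stated for any `d` with `d² = symDisc²`, so that `d = symDisc` and `d = -symDisc` give both
roots at once. -/
theorem block_system {ρ d : ℝ} (hD : rDen c h ω ≠ 0)
    (hρ : ρ * rDen c h ω = -symGap c (h * ω) + d)
    (hd : d ^ 2 = symGap c (h * ω) ^ 2
      + 32 * c * (Real.sin (h * ω / 4) ^ 5 * Real.cos (h * ω / 4)) * rDen c h ω) :
    mu1 c h ω - sigma1 c h ω * ((ρ : ℂ) * I)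
        = (((symMean c (h * ω) + d) / (3 * h ^ 2) : ℝ) : ℂ) * (1 - (ρ : ℂ) * I) ∧
      mu2 c h ω + sigma2 c h ω * ((ρ : ℂ) * I)
        = (((symMean c (h * ω) + d) / (3 * h ^ 2) : ℝ) : ℂ) * (1 + (ρ : ℂ) * I) := by
  set A : ℝ := 32 * c * (Real.sin (h * ω / 4) ^ 5 * Real.cos (h * ω / 4)) with hA
  -- From `d² - symGap² = A * rDen` and `rDen * ρ = d - symGap`, after cancelling `rDen`.
  have hAρ : A = (symGap c (h * ω) + d) * ρ := by
    apply mul_right_cancel₀ hD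
    linear_combination -hd - (symGap c (h * ω) + d) * hρ
  have hDen : rDen c h ω
      = 32 * c * (Real.sin (h * ω / 4) * Real.cos (h * ω / 4) ^ 5) := by
    rw [rDen, mul_comm ω h]; ring
  rw [hDen] at hρ
  have e3 : 3 * h * ω / 2 = 3 * (h * ω) / 2 := by ring
  have hρ' : (ρ : ℂ) * (32 * c * ((Real.sin (h * ω / 4) * Real.cos (h * ω / 4) ^ 5 : ℝ) : ℂ))
      = -symGap c (h * ω) + d := by exact_mod_cast hρ
  have hA' : 32 * (c : ℂ) * ((Real.sin (h * ω / 4) ^ 5 * Real.cos (h * ω / 4) : ℝ) : ℂ)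
      = (symGap c (h * ω) + d) * ρ := by
    have : ((A : ℝ) : ℂ) = (((symGap c (h * ω) + d) * ρ : ℝ) : ℂ) := by rw [← hAρ]
    rw [hA] at this
    exact_mod_cast this
  have m1 : mu1 c h ω = 1 / (3 * (h : ℂ) ^ 2) * ((symMean c (h * ω) + symGap c (h * ω) : ℝ)
      - I * ((symGap c (h * ω) + d) * ρ)) := by
    rw [mu1, ← hA', symMean, symGap, e3]; push_cast; ring
  have m2 : mu2 c h ω = 1 / (3 * (h : ℂ) ^ 2) * ((symMean c (h * ω) + symGap c (h * ω) : ℝ)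
      + I * ((symGap c (h * ω) + d) * ρ)) := by
    rw [mu2, ← hA', symMean, symGap, e3]; push_cast; ring
  have s1 : sigma1 c h ω * ρ = 1 / (3 * (h : ℂ) ^ 2) *
      ((symMean c (h * ω) - symGap c (h * ω) : ℝ) * ρ + I * (-symGap c (h * ω) + d)) := by
    rw [sigma1, ← hρ', symMean, symGap, e3]; push_cast; ring
  have s2 : sigma2 c h ω * ρ = 1 / (3 * (h : ℂ) ^ 2) *
      ((symMean c (h * ω) - symGap c (h * ω) : ℝ) * ρ - I * (-symGap c (h * ω) + d)) := by
    rw [sigma2, ← hρ', symMean, symGap, e3]; push_cast; ring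
  rw [← mul_assoc, ← mul_assoc, s1, s2, m1, m2]
  push_cast
  constructor
  · linear_combination (-1 / (3 * (h : ℂ) ^ 2) * (-symGap c (h * ω) + d)) * Complex.I_mul_I
  · linear_combination (-1 / (3 * (h : ℂ) ^ 2) * (-symGap c (h * ω) + d)) * Complex.I_mul_I

end Eigen

section GridEigen

variable {c : ℝ} {N : ℕ} [NeZero N] {ω : ℤ}

theorem rDen_ne_zero (hc : c ≠ 0) (hω : |2 * ω| ≤ N) (hω0 : ω ≠ 0) :
    rDen c (meshSize N) ω ≠ 0 := by
  have h := abs_le.1 (abs_meshSize_mul_le hω)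
  have hh := meshSize_pos N
  have hω0' : (ω : ℝ) ≠ 0 := by exact_mod_cast hω0
  have hx : (ω : ℝ) * meshSize N / 4 ≠ 0 := by positivity
  have hs : Real.sin ((ω : ℝ) * meshSize N / 4) ≠ 0 := by
    intro hs
    rw [Real.sin_eq_zero_iff_of_lt_of_lt (by linarith [Real.pi_pos])
      (by linarith [Real.pi_pos])] at hs
    exact hx hs
  have hk : Real.cos ((ω : ℝ) * meshSize N / 4) ≠ 0 := by
    apply ne_of_gt
    apply Real.cos_pos_of_mem_Ioo
    constructor <;> linarith [Real.pi_pos]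
  unfold rDen
  positivity

theorem r1_eq (c h ω : ℝ) :
    r1 c h ω = (((-symGap c (h * ω) + symDisc c (h * ω)) / rDen c h ω : ℝ) : ℂ) * I := by
  rw [r1, Omega_eq, Delta_eq, ← add_div]

theorem r2_eq (c h ω : ℝ) :
    r2 c h ω = (((-symGap c (h * ω) + -symDisc c (h * ω)) / rDen c h ω : ℝ) : ℂ) * I := by
  rw [r2, Omega_eq, Delta_eq, ← sub_div, sub_eq_add_neg]

theorem block_system_roots (hc0 : c ≠ 0) (hω : |2 * ω| ≤ N) (hω0 : ω ≠ 0) :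
    ∀ rq ∈ ({(r1 c (meshSize N) ω, Qhat1 c (meshSize N) ω),
          (r2 c (meshSize N) ω, Qhat2 c (meshSize N) ω)} : Set (ℂ × ℝ)),
        mu1 c (meshSize N) ω - sigma1 c (meshSize N) ω * rq.1 = (rq.2 : ℂ) * (1 - rq.1) ∧
        mu2 c (meshSize N) ω + sigma2 c (meshSize N) ω * rq.1 = (rq.2 : ℂ) * (1 + rq.1) := by
  have hD := rDen_ne_zero hc0 hω hω0
  intro rq hrq
  simp only [Set.mem_insert_iff, Set.mem_singleton_iff] at hrq
  rcases hrq with rfl | rfl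
  · rw [r1_eq, Qhat1_eq]
    exact block_system hD (div_mul_cancel₀ _ hD) (symDisc_sq_rDen _ _ _)
  · rw [r2_eq, Qhat2_eq, sub_eq_add_neg]
    exact block_system hD (div_mul_cancel₀ _ hD) (by rw [neg_sq]; exact symDisc_sq_rDen _ _ _)

/-- The mean acts as a scalar, so only the traceless part of the block has to be diagonalized. -/
theorem blockOp_combo (hω : |2 * ω| ≤ N) {d : ℝ} {a b : ℂ}
    (ha : symGap c (meshSize N * ω) * a + symDown c (meshSize N * ω) * b = d * a)
    (hb : symUp c (meshSize N * ω) * a - symGap c (meshSize N * ω) * b = d * b) :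
    blockOp c N (combo N ω (a, b))
      = (((symMean c (meshSize N * ω) + d) / (3 * meshSize N ^ 2) : ℝ) : ℂ)
        • combo N ω (a, b) := by
  unfold combo
  rw [map_add, map_smul, map_smul, blockOp_low c hω, blockOp_high c hω]
  ext p
  simp only [Pi.add_apply, Pi.smul_apply, smul_eq_mul]
  push_cast
  linear_combination (mode N ω p / (Real.sqrt (2 * Real.pi) * (3 * (meshSize N : ℂ) ^ 2))) * ha
    + (mode N (highFreq N ω) p / (Real.sqrt (2 * Real.pi) * (3 * (meshSize N : ℂ) ^ 2))) * hb

theorem sign_mul_self (hω0 : ω ≠ 0) : ((ω.sign : ℤ) : ℝ) * ω.sign = 1 := by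
  rcases lt_or_gt_of_ne hω0 with h | h
  · simp [Int.sign_eq_neg_one_of_neg h]
  · simp [Int.sign_eq_one_of_pos h]

theorem sign_mul_sin (hω : |2 * ω| ≤ N) :
    (ω.sign : ℝ) * Real.sin (meshSize N * ω / 4) = |Real.sin (meshSize N * ω / 4)| := by
  rw [← aliasSign_mul_sin hω]
  rcases lt_trichotomy ω 0 with h | h | h
  · simp [aliasSign, Int.sign_eq_neg_one_of_neg h, not_lt.2 h.le]
  · simp [h]
  · simp [aliasSign, Int.sign_eq_one_of_pos h, h]

theorem blockOp_combo_root (hω : |2 * ω| ≤ N) (hω0 : ω ≠ 0) (hD : rDen c (meshSize N) ω ≠ 0)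
    {d : ℝ} (hd : d ^ 2 = symDisc c (meshSize N * ω) ^ 2) (a : ℂ) :
    blockOp c N (combo N ω (a, -I * (ω.sign : ℂ) *
        ((((-symGap c (meshSize N * ω) + d) / rDen c (meshSize N) ω : ℝ) : ℂ) * I) * a))
      = (((symMean c (meshSize N * ω) + d) / (3 * meshSize N ^ 2) : ℝ) : ℂ)
        • combo N ω (a, -I * (ω.sign : ℂ) *
        ((((-symGap c (meshSize N * ω) + d) / rDen c (meshSize N) ω : ℝ) : ℂ) * I) * a) := by
  set ρ : ℝ := (-symGap c (meshSize N * ω) + d) / rDen c (meshSize N) ω with hρd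
  have hρ : ρ * rDen c (meshSize N) ω = -symGap c (meshSize N * ω) + d := div_mul_cancel₀ _ hD
  rw [symDisc_sq_rDen] at hd
  set A : ℝ := 32 * c * (Real.sin (meshSize N * ω / 4) ^ 5 * Real.cos (meshSize N * ω / 4))
    with hA
  have hAρ : A = (symGap c (meshSize N * ω) + d) * ρ := by
    apply mul_right_cancel₀ hD
    linear_combination -hd - (symGap c (meshSize N * ω) + d) * hρ
  have hss := sign_mul_self hω0
  have hdown : symDown c (meshSize N * ω) = ω.sign * rDen c (meshSize N) ω := by
    rw [symDown, rDen, ← sign_mul_sin hω, mul_comm (ω : ℝ)]; ring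
  have hup : symUp c (meshSize N * ω) = ω.sign * A := by
    rw [symUp, hA, ← sign_mul_sin hω]
    linear_combination 32 * c * Real.sin (meshSize N * ω / 4) ^ 5 * Real.cos (meshSize N * ω / 4)
      * ((ω.sign : ℝ) ^ 3 + ω.sign) * hss
  have hss' : ((ω.sign : ℤ) : ℂ) * ω.sign = 1 := by exact_mod_cast hss
  have hρ' : (ρ : ℂ) * rDen c (meshSize N) ω = -symGap c (meshSize N * ω) + d := by
    exact_mod_cast hρ
  rw [show -I * ((ω.sign : ℤ) : ℂ) * ((ρ : ℂ) * I) * a = ω.sign * ρ * a by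
    linear_combination (-(ω.sign : ℂ) * ρ * a) * Complex.I_mul_I]
  apply blockOp_combo hω
  · rw [hdown]
    push_cast
    linear_combination (rDen c (meshSize N) ω * ρ * a) * hss' + a * hρ'
  · rw [hup, hAρ]
    push_cast
    ring

theorem r2_ne_zero (hc : c < 2) (hc0 : c ≠ 0) (hω : |2 * ω| ≤ N) (hω0 : ω ≠ 0) :
    r2 c (meshSize N) ω ≠ 0 := by
  have hD := rDen_ne_zero hc0 hω hω0
  have h1 := symDisc_pos hc hc0 (meshSize N * ω)
  have h2 := symGap_nonneg hc (abs_meshSize_mul_le hω)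
  rw [r2_eq]
  refine mul_ne_zero ?_ Complex.I_ne_zero
  rw [Complex.ofReal_ne_zero]
  exact div_ne_zero (by linarith) hD

theorem r1_ne_r2 (hc : c < 2) (hc0 : c ≠ 0) (hω : |2 * ω| ≤ N) (hω0 : ω ≠ 0) :
    r1 c (meshSize N) ω ≠ r2 c (meshSize N) ω := by
  have hD := rDen_ne_zero hc0 hω hω0
  have h1 := symDisc_pos hc hc0 (meshSize N * ω)
  rw [r1_eq, r2_eq]
  intro h
  have h3 := mul_right_cancel₀ Complex.I_ne_zero h
  rw [Complex.ofReal_inj, div_left_inj' hD] at h3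
  linarith

theorem blockOp_psi (hc : c < 2) (hω : |2 * ω| ≤ N) (k : Fin 2) :
    blockOp c N (psi c N ω k) = (Qhat c N ω k : ℂ) • psi c N ω k := by
  by_cases h0 : c = 0 ∨ ω = 0
  · have hs : symUp c (meshSize N * ω) = 0 ∧ symDown c (meshSize N * ω) = 0 := by
      rcases h0 with h | h <;> simp [symUp, symDown, h]
    -- Nonnegativity of the gap decides that `Q̂₁` belongs to the low mode in the decoupled case.
    have hd : symDisc c (meshSize N * ω) = symGap c (meshSize N * ω) := by
      rw [symDisc, hs.1, zero_mul, add_zero,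
        Real.sqrt_sq (symGap_nonneg hc (abs_meshSize_mul_le hω))]
    fin_cases k
    · simp only [psi, Qhat, coeff1, if_pos h0, if_true, Fin.zero_eta, Qhat1_eq]
      exact blockOp_combo hω (by rw [hd]; ring) (by rw [hs.1]; simp)
    · simp only [psi, Qhat, coeff2, if_pos h0, one_ne_zero, if_false, Fin.mk_one, Qhat2_eq,
        sub_eq_add_neg]
      exact blockOp_combo hω (by rw [hs.2]; simp) (by rw [hd]; push_cast; ring)
  · have h0' := not_or.1 h0
    have hD := rDen_ne_zero h0'.1 hω h0'.2
    fin_cases k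
    · simp only [psi, Qhat, coeff1, if_neg h0, if_true, Fin.zero_eta, Qhat1_eq]
      have := blockOp_combo_root hω h0'.2 hD (d := symDisc c (meshSize N * ω)) rfl
        (1 / (Real.sqrt (1 + ‖r1 c (meshSize N) ω‖ ^ 2) : ℂ))
      rw [← r1_eq, mul_one_div] at this
      exact this
    · simp only [psi, Qhat, coeff2, if_neg h0, one_ne_zero, if_false, Fin.mk_one, Qhat2_eq]
      have hr := r2_ne_zero hc h0'.1 hω h0'.2
      -- The free scalar is taken as `|r₂|/r₂` over the norm, so that the high coefficient contains
      -- `|r₂|`; this needs `r₂ ≠ 0`.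
      have := blockOp_combo_root hω h0'.2 hD (d := -symDisc c (meshSize N * ω)) (neg_sq _)
        ((‖r2 c (meshSize N) ω‖ : ℂ) / r2 c (meshSize N) ω
          / (Real.sqrt (1 + ‖r2 c (meshSize N) ω‖ ^ 2) : ℂ))
      rw [← r2_eq, ← sub_eq_add_neg,
        show -I * (ω.sign : ℂ) * r2 c (meshSize N) ω *
          ((‖r2 c (meshSize N) ω‖ : ℂ) / r2 c (meshSize N) ω
          / (Real.sqrt (1 + ‖r2 c (meshSize N) ω‖ ^ 2) : ℂ))
          = -I * (ω.sign : ℂ) * (‖r2 c (meshSize N) ω‖ : ℂ)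
            / (Real.sqrt (1 + ‖r2 c (meshSize N) ω‖ ^ 2) : ℂ) by field_simp] at this
      exact this

theorem norm_sign (hω0 : ω ≠ 0) : ‖((ω.sign : ℤ) : ℂ)‖ = 1 := by
  rcases lt_or_gt_of_ne hω0 with h | h
  · simp [Int.sign_eq_neg_one_of_neg h]
  · simp [Int.sign_eq_one_of_pos h]

theorem norm_coeff1 (c h : ℝ) (ω : ℤ) :
    ‖(coeff1 c h ω).1‖ ^ 2 + ‖(coeff1 c h ω).2‖ ^ 2 = 1 := by
  unfold coeff1
  split_ifs with h0
  · simp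
  · have hω0 := (not_or.1 h0).2
    have hp : 0 < 1 + ‖r1 c h ω‖ ^ 2 := by positivity
    simp only [norm_div, norm_mul, norm_neg, Complex.norm_I, norm_one, norm_sign hω0,
      Complex.norm_real, Real.norm_eq_abs, abs_of_nonneg (Real.sqrt_nonneg _), div_pow, one_mul,
      one_pow, Real.sq_sqrt hp.le]
    rw [← add_div, div_self hp.ne']

theorem norm_coeff2 (hc : c < 2) (hω : |2 * ω| ≤ N) :
    ‖(coeff2 c (meshSize N) ω).1‖ ^ 2 + ‖(coeff2 c (meshSize N) ω).2‖ ^ 2 = 1 := by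
  unfold coeff2
  split_ifs with h0
  · simp
  · have h0' := not_or.1 h0
    have hr := norm_ne_zero_iff.2 (r2_ne_zero hc h0'.1 hω h0'.2)
    have hp : 0 < 1 + ‖r2 c (meshSize N) ω‖ ^ 2 := by positivity
    simp only [norm_div, norm_mul, norm_neg, Complex.norm_I, norm_sign h0'.2,
      Complex.norm_real, Real.norm_eq_abs, abs_of_nonneg (Real.sqrt_nonneg _), div_pow, one_mul,
      Real.sq_sqrt hp.le, abs_norm]
    rw [← add_div, div_self (pow_ne_zero 2 hr), div_self hp.ne']

/-- In the coupled case the determinant is a nonzero multiple of `r₁ - r₂`. -/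
theorem coeff_det_ne_zero (hc : c < 2) (hω : |2 * ω| ≤ N) :
    (coeff1 c (meshSize N) ω).1 * (coeff2 c (meshSize N) ω).2
      - (coeff2 c (meshSize N) ω).1 * (coeff1 c (meshSize N) ω).2 ≠ 0 := by
  unfold coeff1 coeff2
  split_ifs with h0
  · simp
  · have h0' := not_or.1 h0
    have hr := r2_ne_zero hc h0'.1 hω h0'.2
    have hr12 := sub_ne_zero.2 (r1_ne_r2 hc h0'.1 hω h0'.2)
    have hs : ((ω.sign : ℤ) : ℂ) ≠ 0 := by
      rw [← norm_ne_zero_iff, norm_sign h0'.2]; exact one_ne_zero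
    have hq : ∀ r : ℂ, (Real.sqrt (1 + ‖r‖ ^ 2) : ℂ) ≠ 0 := by
      intro r
      rw [Complex.ofReal_ne_zero]
      exact (Real.sqrt_pos.2 (by positivity)).ne'
    have hn : (‖r2 c (meshSize N) ω‖ : ℂ) ≠ 0 := by
      rw [Complex.ofReal_ne_zero]; exact norm_ne_zero_iff.2 hr
    have h1 := hq (r1 c (meshSize N) ω)
    have h2 := hq (r2 c (meshSize N) ω)
    generalize r1 c (meshSize N) ω = x at *
    generalize r2 c (meshSize N) ω = y at *
    have e : 1 / (Real.sqrt (1 + ‖x‖ ^ 2) : ℂ)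
          * (-I * (ω.sign : ℂ) * (‖y‖ : ℂ) / (Real.sqrt (1 + ‖y‖ ^ 2) : ℂ))
        - (‖y‖ : ℂ) / y / (Real.sqrt (1 + ‖y‖ ^ 2) : ℂ)
          * (-I * (ω.sign : ℂ) * x / (Real.sqrt (1 + ‖x‖ ^ 2) : ℂ))
        = (x - y) * (I * (ω.sign : ℂ) * (‖y‖ : ℂ)) / ((Real.sqrt (1 + ‖x‖ ^ 2) : ℂ)
          * (Real.sqrt (1 + ‖y‖ ^ 2) : ℂ) * y) := by
      field_simp
      ring
    simp only
    rw [e]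
    exact div_ne_zero (mul_ne_zero hr12 (mul_ne_zero (mul_ne_zero Complex.I_ne_zero hs) hn))
      (mul_ne_zero (mul_ne_zero h1 h2) hr)

/-! ### Completeness of the eigenvectors -/

variable (N) in
/-- The shift by one node. -/
def nodeShift : Grid N →ₗ[ℂ] Grid N where
  toFun u := fun p => if p.2 = 0 then u (p.1, 1) else u (p.1 + 1, 0)
  map_add' u v := by
    ext p
    simp only [Pi.add_apply]
    split_ifs <;> rfl
  map_smul' a u := by
    ext p
    simp only [Pi.smul_apply, RingHom.id_apply]
    split_ifs <;> rfl

theorem nodeShift_mode (k : ℤ) :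
    nodeShift N (mode N k) = wave k (meshSize N / 2) • mode N k := by
  ext ⟨j, b⟩
  fin_cases b
  · simp [nodeShift, mode, proj, node_right, wave_add, mul_comm]
  · simp only [nodeShift, LinearMap.coe_mk, AddHom.coe_mk, Fin.mk_one, one_ne_zero, if_false,
      mode, Pi.smul_apply, smul_eq_mul]
    rw [proj_add_one (wave_periodic k), proj, node_right, ← wave_add]
    congr 1
    ring

/-- The frequencies resolved by the grid: each low frequency with its high frequency. -/
def gridFreq (p : LowFreq N × Fin 2) : ℤ := if p.2 = 0 then p.1 else highFreq N p.1

/-- `exp(ikh/2)` determines `k` modulo `2N`, and the low and high frequencies together lie in `(-N,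
N]`. These values are the eigenvalues of the one-node shift. -/
theorem wave_half_meshSize_injective :
    Function.Injective fun p : LowFreq N × Fin 2 => wave (gridFreq p) (meshSize N / 2) := by
  have hinj : ∀ k l : ℤ, |k - l| < 2 * N →
      wave k (meshSize N / 2) = wave l (meshSize N / 2) → k = l := by
    intro k l hkl h
    unfold wave at h
    rw [Complex.exp_eq_exp_iff_exists_int] at h
    obtain ⟨n, hn⟩ := h
    have h1 : (k : ℂ) * (meshSize N / 2) = l * (meshSize N / 2) + n * (2 * Real.pi) := by
      apply mul_left_cancel₀ Complex.I_ne_zero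
      push_cast at hn
      linear_combination hn
    have h2 : (k : ℝ) * (meshSize N / 2) = l * (meshSize N / 2) + n * (2 * Real.pi) := by
      exact_mod_cast h1
    have h3 : (k : ℝ) = l + n * (2 * N) := by
      rw [← natCast_mul_meshSize N] at h2
      have := meshSize_ne_zero N
      field_simp at h2
      linarith
    have h4 : k = l + n * (2 * N) := by exact_mod_cast h3
    have h5 : |n * (2 * (N : ℤ))| < 2 * N := by rwa [h4, add_sub_cancel_left] at hkl
    have hN : 0 < (2 * (N : ℤ)) := by have := Nat.pos_of_ne_zero (NeZero.ne N); omega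
    rw [abs_mul, abs_of_pos hN] at h5
    have h6 : |n| < 1 := by nlinarith
    rw [Int.abs_lt_one_iff] at h6
    rw [h4, h6]; ring
  rintro ⟨⟨ω, h1, h2⟩, b⟩ ⟨⟨ω', h1', h2'⟩, b'⟩ h
  have hk := hinj _ _ ?_ h
  · fin_cases b <;> fin_cases b' <;> simp only [gridFreq, highFreq, Fin.zero_eta, Fin.mk_one,
      if_true, one_ne_zero, if_false] at hk
    · simp [hk]
    · split_ifs at hk <;> omega
    · split_ifs at hk <;> omega
    · have : ω = ω' := by split_ifs at hk <;> omega
      simp [this]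
  · rw [abs_lt]
    fin_cases b <;> fin_cases b' <;> simp only [gridFreq, highFreq, Fin.zero_eta, Fin.mk_one,
      if_true, one_ne_zero, if_false] <;> (try split_ifs) <;> constructor <;> omega

theorem linearIndependent_modes :
    LinearIndependent ℂ fun p : LowFreq N × Fin 2 => mode N (gridFreq p) := by
  refine Module.End.eigenvectors_linearIndependent' (nodeShift N) _
    wave_half_meshSize_injective _ fun p => ?_
  refine Module.End.hasEigenvector_iff.2 ⟨Module.End.mem_eigenspace_iff.2 (nodeShift_mode _), ?_⟩
  intro h
  have := congrFun h (0, 0)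
  exact wave_ne_zero _ _ this

variable (N) in
/-- Low frequencies are representatives modulo `N`. -/
def lowFreqEquiv : ZMod N ≃ LowFreq N where
  toFun x := ⟨x.valMinAbs, by have := x.valMinAbs_mem_Ioc; constructor <;> linarith [this.1, this.2]⟩
  invFun ω := (ω.1 : ZMod N)
  left_inv x := x.coe_valMinAbs
  right_inv ω := Subtype.ext
    ((ZMod.valMinAbs_spec _ _).2 ⟨rfl, by constructor <;> linarith [ω.2.1, ω.2.2]⟩)

instance : Fintype (LowFreq N) := Fintype.ofEquiv _ (lowFreqEquiv N)

theorem card_lowFreq : Fintype.card (LowFreq N × Fin 2) = Module.finrank ℂ (Grid N) := by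
  rw [Module.finrank_fintype_fun_eq_card, Fintype.card_prod, Fintype.card_prod,
    Fintype.card_congr (lowFreqEquiv N)]

theorem span_psi_eq_top (hc : c < 2) :
    Submodule.span ℂ (Set.range fun p : LowFreq N × Fin 2 => psi c N p.1 p.2) = ⊤ := by
  rw [eq_top_iff, ← linearIndependent_modes.span_eq_top_of_card_eq_finrank' card_lowFreq,
    Submodule.span_le]
  rintro _ ⟨⟨ω, b⟩, rfl⟩
  have hω : |2 * ω.1| ≤ N := abs_le.2 ⟨by linarith [ω.2.1], ω.2.2⟩
  have hdet := coeff_det_ne_zero (c := c) hc hω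
  have h1 := Submodule.subset_span (R := ℂ)
    (Set.mem_range_self (f := fun p : LowFreq N × Fin 2 => psi c N p.1 p.2) (ω, 0))
  have h2 := Submodule.subset_span (R := ℂ)
    (Set.mem_range_self (f := fun p : LowFreq N × Fin 2 => psi c N p.1 p.2) (ω, 1))
  simp only [psi, combo, if_true, one_ne_zero, if_false] at h1 h2
  set W := Submodule.span ℂ (Set.range fun p : LowFreq N × Fin 2 => psi c N p.1 p.2)
  set a1 := (coeff1 c (meshSize N) ω).1
  set b1 := (coeff1 c (meshSize N) ω).2
  set a2 := (coeff2 c (meshSize N) ω).1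
  set b2 := (coeff2 c (meshSize N) ω).2
  have hpi : (Real.sqrt (2 * Real.pi) : ℂ) ≠ 0 := by
    rw [Complex.ofReal_ne_zero]
    exact (Real.sqrt_pos.2 (by positivity)).ne'
  -- Cramer's rule inside one block recovers the two modes from the two eigenvectors.
  have hx : mode N ω ∈ W := by
    have := W.smul_mem (Real.sqrt (2 * Real.pi) / (a1 * b2 - a2 * b1) : ℂ)
      (W.sub_mem (W.smul_mem b2 h1) (W.smul_mem b1 h2))
    convert this using 1
    ext p
    simp only [Pi.smul_apply, Pi.sub_apply, Pi.add_apply, smul_eq_mul]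
    field_simp
    ring
  have hy : mode N (highFreq N ω) ∈ W := by
    have := W.smul_mem (Real.sqrt (2 * Real.pi) / (a1 * b2 - a2 * b1) : ℂ)
      (W.sub_mem (W.smul_mem a1 h2) (W.smul_mem a2 h1))
    convert this using 1
    ext p
    simp only [Pi.smul_apply, Pi.sub_apply, Pi.add_apply, smul_eq_mul]
    field_simp
    ring
  fin_cases b
  · exact hx
  · exact hy

theorem linearIndependent_psi (hc : c < 2) :
    LinearIndependent ℂ (fun p : LowFreq N × Fin 2 => psi c N p.1 p.2) :=
  linearIndependent_of_top_le_span_of_card_eq_finrank (span_psi_eq_top hc).ge card_lowFreq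

end GridEigen

/-! ### The discrete norm -/

section Norm

variable {N : ℕ} [NeZero N]

theorem gridNorm_eq (v : Grid N) :
    gridNorm N v = Real.sqrt (meshSize N / 2)
      * ‖(WithLp.toLp 2 v : EuclideanSpace ℂ (ZMod N × Fin 2))‖ := by
  rw [EuclideanSpace.norm_eq, gridNorm, Real.sqrt_mul (by linarith [meshSize_pos N])]

theorem abs_gridNorm_sub_le (u v : Grid N) :
    |gridNorm N u - gridNorm N v| ≤ gridNorm N (u - v) := by
  rw [gridNorm_eq, gridNorm_eq, gridNorm_eq, ← mul_sub, abs_mul,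
    abs_of_nonneg (Real.sqrt_nonneg _), WithLp.toLp_sub]
  exact mul_le_mul_of_nonneg_left (abs_norm_sub_norm_le _ _) (Real.sqrt_nonneg _)

/-- There are `2N` nodes of weight `h/2`, so the total mass is `2π`. -/
theorem meshSize_mul_card (B : ℝ) :
    meshSize N / 2 * ∑ _p : ZMod N × Fin 2, B ^ 2 = 2 * Real.pi * B ^ 2 := by
  rw [Finset.sum_const, Finset.card_univ, Fintype.card_prod, ZMod.card, Fintype.card_fin,
    ← natCast_mul_meshSize N, nsmul_eq_mul]
  push_cast
  ring

theorem gridNorm_le {v : Grid N} {B : ℝ} (hB : 0 ≤ B) (h : ∀ p, ‖v p‖ ≤ B) :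
    gridNorm N v ≤ Real.sqrt (2 * Real.pi) * B := by
  rw [← Real.sqrt_sq hB, ← Real.sqrt_mul (by positivity), ← meshSize_mul_card (N := N)]
  apply Real.sqrt_le_sqrt
  refine mul_le_mul_of_nonneg_left (Finset.sum_le_sum fun p _ => ?_)
    (by linarith [meshSize_pos N])
  exact pow_le_pow_left₀ (norm_nonneg _) (h p) 2

theorem gridNorm_of_norm_eq {v : Grid N} {B : ℝ} (hB : 0 ≤ B) (h : ∀ p, ‖v p‖ = B) :
    gridNorm N v = Real.sqrt (2 * Real.pi) * B := by
  rw [← Real.sqrt_sq hB, ← Real.sqrt_mul (by positivity), ← meshSize_mul_card (N := N), gridNorm]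
  simp only [h]

theorem gridNorm_smul_mode (a : ℂ) (k : ℤ) :
    gridNorm N (a • mode N k) = Real.sqrt (2 * Real.pi) * ‖a‖ :=
  gridNorm_of_norm_eq (norm_nonneg a) fun p => by
    rw [Pi.smul_apply, norm_smul, norm_mode, mul_one]

end Norm

/-! ### Taylor expansion and the truncation error -/

/-- Induction on the order: in the step variable, the remainder of `w` has as derivative the
remainder of `w'` one order lower, and the mean value inequality gains a factor `|s|`. The factorial
is given up, since only the order is used. -/
theorem norm_sub_taylor_le {M : ℝ} (n : ℕ) {w : ℝ → ℂ}
    (hw : ContDiff ℝ ((⊤ : ℕ∞) : WithTop ℕ∞) w) (hM : ∀ x, ‖iteratedDeriv n w x‖ ≤ M)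
    (x s : ℝ) :
    ‖w (x + s) - ∑ k ∈ Finset.range n, ((s ^ k / k.factorial : ℝ) : ℂ) * iteratedDeriv k w x‖
      ≤ M * |s| ^ n := by
  induction n generalizing w s with
  | zero => simpa using hM (x + s)
  | succ n ih =>
    have hw' : ContDiff ℝ ((⊤ : ℕ∞) : WithTop ℕ∞) (deriv w) := by
      have := (contDiff_infty_iff_deriv.1 hw).2
      exact this
    have hM0 : 0 ≤ M := (norm_nonneg _).trans (hM x)
    have hM' : ∀ x, ‖iteratedDeriv n (deriv w) x‖ ≤ M := by
      intro x
      rw [← iteratedDeriv_succ']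
      exact hM x
    set g : ℝ → ℂ := fun r => w (x + r)
      - ∑ k ∈ Finset.range (n + 1), ((r ^ k / k.factorial : ℝ) : ℂ) * iteratedDeriv k w x with hg
    set g' : ℝ → ℂ := fun r => deriv w (x + r)
      - ∑ k ∈ Finset.range n, ((r ^ k / k.factorial : ℝ) : ℂ) * iteratedDeriv k (deriv w) x
      with hg'
    have hder : ∀ r, HasDerivAt g (g' r) r := by
      intro r
      have h1 : HasDerivAt (fun r => w (x + r)) (deriv w (x + r)) r :=
        ((hw.differentiable (by simp)) (x + r)).hasDerivAt.comp_const_add x r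
      refine h1.sub ?_
      simp only [Finset.sum_range_succ', iteratedDeriv_succ']
      have h2 : HasDerivAt (fun r : ℝ => ∑ k ∈ Finset.range n,
          ((r ^ (k + 1) / (k + 1).factorial : ℝ) : ℂ) * iteratedDeriv k (deriv w) x)
          (∑ k ∈ Finset.range n, ((r ^ k / k.factorial : ℝ) : ℂ)
            * iteratedDeriv k (deriv w) x) r := by
        refine HasDerivAt.fun_sum fun k _ => ?_
        refine HasDerivAt.mul_const ?_ _
        refine HasDerivAt.ofReal_comp ?_
        refine ((hasDerivAt_pow (k + 1) r).div_const _).congr_deriv ?_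
        rw [Nat.factorial_succ]
        have : (k.factorial : ℝ) ≠ 0 := by exact_mod_cast k.factorial_ne_zero
        push_cast
        field_simp
      simpa using h2.add_const ((((1 : ℝ)) : ℂ) * w x)
    have hg0 : g 0 = 0 := by
      simp only [hg, Finset.sum_range_succ']
      simp
    have hbound : ∀ r ∈ Set.uIcc 0 s, ‖g' r‖ ≤ M * |s| ^ n := by
      intro r hr
      refine (ih hw' hM' r).trans ?_
      have : |r| ≤ |s| := by simpa using Set.abs_sub_left_of_mem_uIcc hr
      gcongr
    have h := (convex_uIcc 0 s).norm_image_sub_le_of_norm_hasDerivWithin_le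
      (fun r _ => (hder r).hasDerivWithinAt) hbound Set.left_mem_uIcc Set.right_mem_uIcc
    rw [hg0, sub_zero, sub_zero, Real.norm_eq_abs] at h
    calc ‖g s‖ ≤ M * |s| ^ n * |s| := h
      _ = M * |s| ^ (n + 1) := by ring

theorem exists_norm_le_of_periodic {w : ℝ → ℂ} (hw : Continuous w)
    (hp : Function.Periodic w (2 * Real.pi)) : ∃ M : ℝ, 0 ≤ M ∧ ∀ x, ‖w x‖ ≤ M := by
  obtain ⟨M, hM⟩ := (isCompact_Icc (a := (0 : ℝ)) (b := 2 * Real.pi)).exists_bound_of_continuousOn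
    hw.continuousOn
  refine ⟨|M|, abs_nonneg M, fun x => ?_⟩
  obtain ⟨y, hy, hxy⟩ := hp.exists_mem_Ico₀ Real.two_pi_pos x
  rw [hxy]
  exact (hM y (Set.Ico_subset_Icc_self hy)).trans (le_abs_self M)

theorem periodic_iteratedDeriv {w : ℝ → ℂ} {T : ℝ} (hp : Function.Periodic w T) (n : ℕ) :
    Function.Periodic (iteratedDeriv n w) T := by
  intro x
  have h := congrFun (iteratedDeriv_comp_add_const n w T) x
  rw [← h]
  congr 1
  exact funext hp

theorem exists_norm_iteratedDeriv_le {w : ℝ → ℂ}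
    (hw : ContDiff ℝ ((⊤ : ℕ∞) : WithTop ℕ∞) w) (hp : Function.Periodic w (2 * Real.pi))
    (n : ℕ) : ∃ M : ℝ, 0 ≤ M ∧ ∀ x, ‖iteratedDeriv n w x‖ ≤ M :=
  exists_norm_le_of_periodic (hw.continuous_iteratedDeriv n (by exact_mod_cast le_top))
    (periodic_iteratedDeriv hp n)

/-- The stencil applied to Taylor remainders; the centre node is absent because its remainder is
zero. The constants are `1 + 16 + 16 + 1` and `1 + 5 + 10 + 5 + 1`. -/
theorem norm_linear_comb_le {z₁ z₂ z₃ z₄ z₅ : ℂ} {B c : ℝ} (h₁ : ‖z₁‖ ≤ B) (h₂ : ‖z₂‖ ≤ B)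
    (h₃ : ‖z₃‖ ≤ B) (h₄ : ‖z₄‖ ≤ B) (h₅ : ‖z₅‖ ≤ B) :
    ‖(-z₁ + 16 * z₂ + 16 * z₃ - z₄) + c * (z₁ - 5 * z₂ - 10 * z₃ + 5 * z₄ - z₅)‖
      ≤ (34 + 22 * |c|) * B := by
  have a1 : ‖-z₁ + 16 * z₂ + 16 * z₃ - z₄‖ ≤ 34 * B := by
    calc ‖-z₁ + 16 * z₂ + 16 * z₃ - z₄‖ ≤ ‖-z₁‖ + ‖16 * z₂‖ + ‖16 * z₃‖ + ‖z₄‖ := by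
          refine (norm_sub_le _ _).trans ?_
          gcongr
          exact norm_add₃_le
      _ ≤ _ := by
          simp only [norm_neg, norm_mul, Complex.norm_ofNat]
          linarith
  have a2 : ‖z₁ - 5 * z₂ - 10 * z₃ + 5 * z₄ - z₅‖ ≤ 22 * B := by
    calc ‖z₁ - 5 * z₂ - 10 * z₃ + 5 * z₄ - z₅‖
        ≤ ‖z₁‖ + ‖5 * z₂‖ + ‖10 * z₃‖ + ‖5 * z₄‖ + ‖z₅‖ := by
          refine (norm_sub_le _ _).trans ?_
          gcongr
          refine (norm_add_le _ _).trans ?_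
          gcongr
          refine (norm_sub_le _ _).trans ?_
          gcongr
          exact norm_sub_le _ _
      _ ≤ _ := by
          simp only [norm_mul, Complex.norm_ofNat]
          linarith
  refine (norm_add_le _ _).trans ?_
  rw [norm_mul, Complex.norm_real, Real.norm_eq_abs]
  nlinarith [abs_nonneg c, mul_le_mul_of_nonneg_left a2 (abs_nonneg c)]

/-- The symmetric stencil reproduces `w''` exactly on polynomials of degree at most five, and `δ_j`
annihilates degree four, leaving `-(h/2)⁵ w⁽⁵⁾` at a left node. Division by `3h²` yields `c h³/96`.
-/
theorem exists_truncError_expansion (c : ℝ) {w : ℝ → ℂ}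
    (hw : ContDiff ℝ ((⊤ : ℕ∞) : WithTop ℕ∞) w) (hp : Function.Periodic w (2 * Real.pi)) :
    ∃ C : ℝ, 0 ≤ C ∧ ∀ (N : ℕ) [NeZero N] (j : ZMod N),
      ‖truncError c N w (j, 0) - ((c * meshSize N ^ 3 / 96 : ℝ) : ℂ)
          * iteratedDeriv 5 w (node N (j, 0))‖ ≤ C * meshSize N ^ 4 ∧
      ‖truncError c N w (j, 1) + ((c * meshSize N ^ 3 / 96 : ℝ) : ℂ)
          * iteratedDeriv 5 w (node N (j, 1))‖ ≤ C * meshSize N ^ 4 := by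
  obtain ⟨M, hM0, hM⟩ := exists_norm_iteratedDeriv_le hw hp 6
  -- The farthest stencil point is `3h/2` away, giving `(3/2)⁶` in the sixth-order remainder; the
  -- `3` comes from the prefactor `1/(3h²)`.
  refine ⟨(34 + 22 * |c|) * (M * (3 / 2) ^ 6) / 3, by positivity, fun N _ j => ?_⟩
  set h : ℝ := meshSize N with hh
  have hpos : 0 < h := meshSize_pos N
  have hne : (h : ℂ) ≠ 0 := by exact_mod_cast hpos.ne'
  let R : ℝ → ℝ → ℂ := fun x s => w (x + s)
    - ∑ k ∈ Finset.range 6, ((s ^ k / k.factorial : ℝ) : ℂ) * iteratedDeriv k w x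
  have hR : ∀ x s, |s| ≤ 3 / 2 * h → ‖R x s‖ ≤ M * (3 / 2) ^ 6 * h ^ 6 := by
    intro x s hs
    refine (norm_sub_taylor_le 6 hw hM x s).trans ?_
    calc M * |s| ^ 6 ≤ M * (3 / 2 * h) ^ 6 := by gcongr
      _ = _ := by ring
  have hwR : ∀ x s, w (x + s) = w x + s * iteratedDeriv 1 w x + s ^ 2 / 2 * iteratedDeriv 2 w x
      + s ^ 3 / 6 * iteratedDeriv 3 w x + s ^ 4 / 24 * iteratedDeriv 4 w x
      + s ^ 5 / 120 * iteratedDeriv 5 w x + R x s := by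
    intro x s
    simp only [R, Finset.sum_range_succ, Finset.sum_range_zero, Nat.factorial]
    simp only [iteratedDeriv_zero]
    push_cast
    ring
  have hwR' : ∀ x s, w (x - s) = w x - s * iteratedDeriv 1 w x + s ^ 2 / 2 * iteratedDeriv 2 w x
      - s ^ 3 / 6 * iteratedDeriv 3 w x + s ^ 4 / 24 * iteratedDeriv 4 w x
      - s ^ 5 / 120 * iteratedDeriv 5 w x + R x (-s) := by
    intro x s
    rw [sub_eq_add_neg, hwR]
    push_cast
    ring
  have hfin : ∀ z : ℂ, ‖z‖ ≤ (34 + 22 * |c|) * (M * (3 / 2) ^ 6 * h ^ 6) →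
      ‖-1 / (3 * (h : ℂ) ^ 2) * z‖ ≤ (34 + 22 * |c|) * (M * (3 / 2) ^ 6) / 3 * h ^ 4 := by
    intro z hz
    rw [norm_mul, norm_div, norm_neg, norm_one, norm_mul, norm_pow, Complex.norm_real,
      Real.norm_eq_abs, abs_of_pos hpos, Complex.norm_ofNat]
    calc 1 / (3 * h ^ 2) * ‖z‖
        ≤ 1 / (3 * h ^ 2) * ((34 + 22 * |c|) * (M * (3 / 2) ^ 6 * h ^ 6)) := by gcongr
      _ = _ := by field_simp
  have s1 : |h| ≤ 3 / 2 * h := by rw [abs_of_pos hpos]; linarith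
  have s2 : |h / 2| ≤ 3 / 2 * h := by rw [abs_of_pos (by linarith)]; linarith
  have s3 : |3 * h / 2| ≤ 3 / 2 * h := by rw [abs_of_pos (by linarith)]; linarith
  have s1' : |-h| ≤ 3 / 2 * h := by rwa [abs_neg]
  have s2' : |-(h / 2)| ≤ 3 / 2 * h := by rwa [abs_neg]
  have s3' : |-(3 * h / 2)| ≤ 3 / 2 * h := by rwa [abs_neg]
  constructor
  · set x := node N (j, 0) with hx
    have e : truncError c N w (j, 0) - ((c * h ^ 3 / 96 : ℝ) : ℂ) * iteratedDeriv 5 w x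
        = -1 / (3 * (h : ℂ) ^ 2) * ((-R x (-h) + 16 * R x (-(h / 2)) + 16 * R x (h / 2) - R x h)
          + c * (R x (-h) - 5 * R x (-(h / 2)) - 10 * R x (h / 2) + 5 * R x h
            - R x (3 * h / 2))) := by
      rw [truncError, Pi.sub_apply, blockOp_proj_left c hp, ← hx, ← hh]
      simp only [hwR, hwR', proj, ← hx]
      push_cast
      field_simp
      ring
    rw [e]
    exact hfin _ (norm_linear_comb_le (hR _ _ s1') (hR _ _ s2') (hR _ _ s2) (hR _ _ s1)
      (hR _ _ s3))
  · set x := node N (j, 1) with hx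
    have e : truncError c N w (j, 1) + ((c * h ^ 3 / 96 : ℝ) : ℂ) * iteratedDeriv 5 w x
        = -1 / (3 * (h : ℂ) ^ 2) * ((-R x h + 16 * R x (h / 2) + 16 * R x (-(h / 2)) - R x (-h))
          + c * (R x h - 5 * R x (h / 2) - 10 * R x (-(h / 2)) + 5 * R x (-h)
            - R x (-(3 * h / 2)))) := by
      rw [truncError, Pi.sub_apply, blockOp_proj_right c hp, ← hx, ← hh]
      simp only [hwR, hwR', proj, ← hx]
      push_cast
      field_simp
      ring
    rw [e]
    exact hfin _ (norm_linear_comb_le (hR _ _ s1) (hR _ _ s2) (hR _ _ s2') (hR _ _ s1')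
      (hR _ _ s3'))

theorem exists_gridNorm_truncError_le (c : ℝ) {w : ℝ → ℂ}
    (hw : ContDiff ℝ ((⊤ : ℕ∞) : WithTop ℕ∞) w) (hp : Function.Periodic w (2 * Real.pi)) :
    ∃ C : ℝ, ∀ (N : ℕ) [NeZero N], gridNorm N (truncError c N w) ≤ C * meshSize N ^ 3 := by
  obtain ⟨C, hC0, hC⟩ := exists_truncError_expansion c hw hp
  obtain ⟨M, hM0, hM⟩ := exists_norm_iteratedDeriv_le hw hp 5
  refine ⟨Real.sqrt (2 * Real.pi) * (C * (2 * Real.pi) + |c| / 96 * M), fun N _ => ?_⟩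
  have hpos := meshSize_pos N
  rw [mul_assoc]
  refine gridNorm_le (by positivity) fun ⟨j, b⟩ => ?_
  have h4 : C * meshSize N ^ 4 ≤ C * (2 * Real.pi) * meshSize N ^ 3 := by
    calc C * meshSize N ^ 4 = C * meshSize N * meshSize N ^ 3 := by ring
      _ ≤ _ := by gcongr; exact meshSize_le N
  have h5 : ∀ x, ‖((c * meshSize N ^ 3 / 96 : ℝ) : ℂ) * iteratedDeriv 5 w x‖
      ≤ |c| / 96 * M * meshSize N ^ 3 := by
    intro x
    rw [norm_mul, Complex.norm_real, Real.norm_eq_abs, abs_div, abs_mul, abs_pow,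
      abs_of_pos hpos, abs_of_pos (by norm_num : (0 : ℝ) < 96)]
    calc |c| * meshSize N ^ 3 / 96 * ‖iteratedDeriv 5 w x‖
        ≤ |c| * meshSize N ^ 3 / 96 * M := by gcongr; exact hM x
      _ = _ := by ring
  fin_cases b
  · have := norm_add_le (truncError c N w (j, 0) - ((c * meshSize N ^ 3 / 96 : ℝ) : ℂ)
      * iteratedDeriv 5 w (node N (j, 0))) (((c * meshSize N ^ 3 / 96 : ℝ) : ℂ)
      * iteratedDeriv 5 w (node N (j, 0)))
    rw [sub_add_cancel] at this
    have h1 := (hC N j).1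
    have h2 := h5 (node N (j, 0))
    simp only [Fin.zero_eta]
    linarith
  · have := norm_sub_le (truncError c N w (j, 1) + ((c * meshSize N ^ 3 / 96 : ℝ) : ℂ)
      * iteratedDeriv 5 w (node N (j, 1))) (((c * meshSize N ^ 3 / 96 : ℝ) : ℂ)
      * iteratedDeriv 5 w (node N (j, 1)))
    rw [add_sub_cancel_right] at this
    have h1 := (hC N j).2
    have h2 := h5 (node N (j, 1))
    simp only [Fin.mk_one]
    linarith

theorem contDiff_wave (k : ℤ) : ContDiff ℝ ((⊤ : ℕ∞) : WithTop ℕ∞) (wave k) := by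
  unfold wave
  have : ContDiff ℝ ((⊤ : ℕ∞) : WithTop ℕ∞) (fun x : ℝ => (x : ℂ)) := Complex.ofRealCLM.contDiff
  fun_prop

theorem hasDerivAt_wave (k : ℤ) (x : ℝ) : HasDerivAt (wave k) (I * k * wave k x) x := by
  have h := ((Complex.ofRealCLM.hasDerivAt (x := x)).const_mul (I * k)).cexp
  refine h.congr_deriv ?_
  simp [wave, mul_comm]

theorem iteratedDeriv_wave (k : ℤ) (n : ℕ) :
    iteratedDeriv n (wave k) = fun x => (I * k) ^ n * wave k x := by
  induction n with
  | zero => simp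
  | succ n ih =>
    rw [iteratedDeriv_succ, ih]
    ext x
    rw [((hasDerivAt_wave k x).const_mul _).deriv]
    ring

/-- The leading part has constant modulus on the grid, so its norm is exact; the reverse triangle
inequality handles the rest. -/
theorem exists_gridNorm_truncError_wave (c : ℝ) (ω : ℤ) :
    ∃ C : ℝ, ∀ (N : ℕ) [NeZero N],
      |gridNorm N (truncError c N (wave ω))
          - Real.sqrt (2 * Real.pi) * (|c| * |(ω : ℝ)| ^ 5 / 96) * meshSize N ^ 3|
        ≤ C * meshSize N ^ 4 := by
  obtain ⟨C, hC0, hC⟩ := exists_truncError_expansion c (contDiff_wave ω) (wave_periodic ω)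
  refine ⟨Real.sqrt (2 * Real.pi) * C, fun N _ => ?_⟩
  have hpos := meshSize_pos N
  let v : Grid N := fun p => (if p.2 = 0 then 1 else -1) * (((c * meshSize N ^ 3 / 96 : ℝ) : ℂ)
    * iteratedDeriv 5 (wave ω) (node N p))
  have hv : gridNorm N v
      = Real.sqrt (2 * Real.pi) * (|c| * |(ω : ℝ)| ^ 5 / 96) * meshSize N ^ 3 := by
    rw [mul_assoc]
    refine gridNorm_of_norm_eq (by positivity) fun p => ?_
    have hs : ‖(if p.2 = 0 then 1 else -1 : ℂ)‖ = 1 := by split_ifs <;> simp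
    simp only [v]
    rw [norm_mul, hs, one_mul, iteratedDeriv_wave, norm_mul, norm_mul, norm_pow, norm_mul,
      norm_wave, Complex.norm_I, Complex.norm_real, Real.norm_eq_abs, Complex.norm_intCast,
      abs_div, abs_mul, abs_pow, abs_of_pos hpos, abs_of_pos (by norm_num : (0 : ℝ) < 96)]
    ring
  rw [← hv]
  refine (abs_gridNorm_sub_le _ _).trans ?_
  rw [mul_assoc]
  refine gridNorm_le (by positivity) fun ⟨j, b⟩ => ?_
  fin_cases b
  · simpa [v] using (hC N j).1
  · simpa [v] using (hC N j).2

/-! ### Fourier coefficients of periodic functions -/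

/-- The (unnormalized) Fourier coefficient of a `2π`-periodic function. -/
def fourierInt (w : ℝ → ℂ) (k : ℤ) : ℂ := ∫ x in (0 : ℝ)..(2 * Real.pi), wave (-k) x * w x

theorem continuous_wave (k : ℤ) : Continuous (wave k) := (contDiff_wave k).continuous

theorem wave_two_pi (k : ℤ) : wave k (2 * Real.pi) = wave k 0 := by
  have := wave_periodic k 0
  rwa [zero_add] at this

theorem fourierInt_deriv {w w' : ℝ → ℂ} (hw : ∀ x, HasDerivAt w (w' x) x) (hw' : Continuous w')
    (hp : w (2 * Real.pi) = w 0) (k : ℤ) : fourierInt w' k = I * k * fourierInt w k := by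
  unfold fourierInt
  rw [intervalIntegral.integral_mul_deriv_eq_deriv_mul (fun x _ => hasDerivAt_wave (-k) x)
    (fun x _ => hw x) ((continuous_const.mul (continuous_wave _)).intervalIntegrable _ _)
    (hw'.intervalIntegrable _ _), hp, wave_two_pi, sub_self, zero_sub,
    ← intervalIntegral.integral_neg, ← intervalIntegral.integral_const_mul]
  congr 1
  ext x
  push_cast
  ring

theorem norm_fourierInt_le {w : ℝ → ℂ} {M : ℝ} (hM : ∀ x, ‖w x‖ ≤ M) (k : ℤ) :
    ‖fourierInt w k‖ ≤ M * (2 * Real.pi) := by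
  have h := intervalIntegral.norm_integral_le_of_norm_le_const (a := (0 : ℝ))
    (b := 2 * Real.pi) (f := fun x => wave (-k) x * w x) (C := M)
    (fun x _ => by rw [norm_mul, norm_wave, one_mul]; exact hM x)
  rwa [sub_zero, abs_of_pos Real.two_pi_pos] at h

theorem fourierInt_iteratedDeriv {w : ℝ → ℂ} (hw : ContDiff ℝ ((⊤ : ℕ∞) : WithTop ℕ∞) w)
    (hp : Function.Periodic w (2 * Real.pi)) (k : ℤ) (n : ℕ) :
    fourierInt (iteratedDeriv n w) k = (I * k) ^ n * fourierInt w k := by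
  induction n with
  | zero => simp
  | succ n ih =>
    have h1 : ∀ x, HasDerivAt (iteratedDeriv n w) (iteratedDeriv (n + 1) w x) x := by
      intro x
      rw [iteratedDeriv_succ]
      exact ((hw.differentiable_iteratedDeriv n
        (by exact_mod_cast WithTop.coe_lt_top n)) x).hasDerivAt
    have h2 := periodic_iteratedDeriv hp n 0
    rw [zero_add] at h2
    rw [fourierInt_deriv h1 (hw.continuous_iteratedDeriv (n + 1) (by exact_mod_cast le_top)) h2,
      ih]
    ring

theorem exists_pow_mul_fourierInt_le {w : ℝ → ℂ} (hw : ContDiff ℝ ((⊤ : ℕ∞) : WithTop ℕ∞) w)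
    (hp : Function.Periodic w (2 * Real.pi)) (n : ℕ) :
    ∃ K : ℝ, ∀ k : ℤ, |(k : ℝ)| ^ n * ‖fourierInt w k‖ ≤ K := by
  obtain ⟨M, -, hM⟩ := exists_norm_iteratedDeriv_le hw hp n
  refine ⟨M * (2 * Real.pi), fun k => ?_⟩
  have h := norm_fourierInt_le hM k
  rwa [fourierInt_iteratedDeriv hw hp, norm_mul, norm_pow, norm_mul, Complex.norm_I, one_mul,
    Complex.norm_intCast] at h

theorem summable_pow_mul_fourierInt {w : ℝ → ℂ} (hw : ContDiff ℝ ((⊤ : ℕ∞) : WithTop ℕ∞) w)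
    (hp : Function.Periodic w (2 * Real.pi)) (n : ℕ) :
    Summable fun k : ℤ => |(k : ℝ)| ^ n * ‖fourierInt w k‖ := by
  -- Two extra derivatives give a comparison with the summable `1/k²`; `k = 0` is discarded as a
  -- finite exception.
  obtain ⟨K, hK⟩ := exists_pow_mul_fourierInt_le hw hp (n + 2)
  have hs : Summable fun k : ℤ => K * (1 / (k : ℝ) ^ 2) :=
    (Real.summable_one_div_int_pow.2 (by norm_num)).mul_left K
  refine Summable.of_norm_bounded_eventually hs ?_
  have : ({0}ᶜ : Set ℤ) ∈ Filter.cofinite := (Set.finite_singleton 0).compl_mem_cofinite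
  filter_upwards [this] with k hk
  have hk0 : (k : ℝ) ≠ 0 := by exact_mod_cast hk
  have hk2 : 0 < (k : ℝ) ^ 2 := by positivity
  rw [Real.norm_eq_abs, abs_of_nonneg (by positivity), mul_one_div, le_div_iff₀ hk2]
  refine le_trans (le_of_eq ?_) (hK k)
  rw [← sq_abs (k : ℝ)]
  ring

theorem hasSum_fourierInt {w : ℝ → ℂ} (hw : Continuous w)
    (hp : Function.Periodic w (2 * Real.pi)) (hs : Summable fun k => fourierInt w k) (x : ℝ) :
    HasSum (fun k : ℤ => fourierInt w k / (2 * Real.pi) * wave k x) (w x) := by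
  have : Fact (0 < 2 * Real.pi) := ⟨Real.two_pi_pos⟩
  have hpi : (Real.pi : ℂ) ≠ 0 := by exact_mod_cast Real.pi_ne_zero
  let W : C(AddCircle (2 * Real.pi), ℂ) := ⟨hp.lift, continuous_coinduced_dom.2 hw⟩
  have hW : ∀ y : ℝ, W (y : AddCircle (2 * Real.pi)) = w y := fun y => hp.lift_coe y
  have hfour : ∀ (k : ℤ) (y : ℝ), fourier k (y : AddCircle (2 * Real.pi)) = wave k y := by
    intro k y
    rw [fourier_coe_apply, wave]
    congr 1
    push_cast
    field_simp
  have hcoef : ∀ k, fourierCoeff W k = fourierInt w k / (2 * Real.pi) := by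
    intro k
    rw [fourierCoeff_eq_intervalIntegral W k 0, zero_add, fourierInt]
    simp only [hfour, hW, smul_eq_mul]
    rw [Complex.real_smul]
    push_cast
    ring
  have hsum : Summable (fourierCoeff W) := by
    rw [show fourierCoeff W = fun k => fourierInt w k / (2 * Real.pi) from funext hcoef]
    exact hs.div_const _
  have h := has_pointwise_sum_fourier_series_of_summable hsum (x : AddCircle (2 * Real.pi))
  simpa only [hcoef, hfour, hW, smul_eq_mul] using h

/-! ### Fourier series of heat solutions -/

section Heat

variable {f : ℝ → ℂ} {u : ℝ → ℝ → ℂ}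

theorem IsHeatSolution.continuous_slice (hu : IsHeatSolution f u) {t : ℝ} (ht : 0 ≤ t) :
    Continuous fun x => u x t := by
  have h := hu.continuousOn.comp_continuous (f := fun x : ℝ => (x, t)) (by fun_prop)
    (fun x => ⟨Set.mem_univ _, ht⟩)
  exact h

theorem IsHeatSolution.periodic_initial (hu : IsHeatSolution f u) :
    Function.Periodic f (2 * Real.pi) := by
  have h := hu.periodic 0 le_rfl
  simpa only [hu.initial] using h

theorem IsHeatSolution.fourierInt_xx (hu : IsHeatSolution f u) {t : ℝ} (ht : 0 < t) (k : ℤ) :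
    fourierInt (iteratedDeriv 2 fun x => u x t) k
      = -(k : ℂ) ^ 2 * fourierInt (fun x => u x t) k := by
  have hC := hu.contDiff t ht
  have hp := hu.periodic t ht.le
  have h0 : ∀ x, HasDerivAt (fun x => u x t) (iteratedDeriv 1 (fun x => u x t) x) x := by
    intro x
    rw [iteratedDeriv_one]
    exact ((hC.differentiable (by norm_num)) x).hasDerivAt
  have h1 : ∀ x, HasDerivAt (iteratedDeriv 1 fun x => u x t)
      (iteratedDeriv 2 (fun x => u x t) x) x := by
    intro x
    rw [iteratedDeriv_succ (n := 1)]
    exact ((hC.differentiable_iteratedDeriv 1 (by norm_num)) x).hasDerivAt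
  have e0 := hp 0
  have e1 := periodic_iteratedDeriv hp 1 0
  rw [zero_add] at e0 e1
  rw [fourierInt_deriv h1 (hC.continuous_iteratedDeriv 2 (by norm_num)) e1,
    fourierInt_deriv h0 (hC.continuous_iteratedDeriv 1 (by norm_num)) e0]
  linear_combination (k : ℂ) ^ 2 * fourierInt (fun x => u x t) k * Complex.I_mul_I

/-- Differentiation under the integral. Domination uses a compact time window away from `0`, since
`u_xx` is only controlled for positive times. -/
theorem IsHeatSolution.hasDerivAt_fourierInt (hu : IsHeatSolution f u) {t : ℝ} (ht : 0 < t)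
    (k : ℤ) :
    HasDerivAt (fun s => fourierInt (fun x => u x s) k)
      (-(k : ℂ) ^ 2 * fourierInt (fun x => u x t) k) t := by
  rw [← hu.fourierInt_xx ht k]
  have hcomp : IsCompact (Set.Icc (0 : ℝ) (2 * Real.pi) ×ˢ Set.Icc (t / 2) (2 * t)) :=
    isCompact_Icc.prod isCompact_Icc
  obtain ⟨M, hM⟩ := hcomp.exists_bound_of_continuousOn (hu.continuousOn_xx.mono (by
    rintro ⟨x, s⟩ ⟨-, hs⟩
    exact ⟨Set.mem_univ _, lt_of_lt_of_le (half_pos ht) hs.1⟩))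
  have hnhds : Set.Ioo (t / 2) (2 * t) ∈ nhds t := Ioo_mem_nhds (by linarith) (by linarith)
  refine (intervalIntegral.hasDerivAt_integral_of_dominated_loc_of_deriv_le
    (F := fun s x => wave (-k) x * u x s)
    (F' := fun s x => wave (-k) x * iteratedDeriv 2 (fun y => u y s) x)
    (bound := fun _ => M) hnhds ?_ ?_ ?_ ?_ ?_ ?_).2
  · filter_upwards [hnhds] with s hs
    exact ((continuous_wave _).mul (hu.continuous_slice
      (by linarith [hs.1]))).aestronglyMeasurable
  · exact ((continuous_wave _).mul (hu.continuous_slice ht.le)).intervalIntegrable _ _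
  · exact ((continuous_wave _).mul ((hu.contDiff t ht).continuous_iteratedDeriv 2
      (by norm_num))).aestronglyMeasurable
  · refine Filter.Eventually.of_forall fun x hx s hs => ?_
    rw [norm_mul, norm_wave, one_mul]
    rw [Set.uIoc_of_le Real.two_pi_pos.le] at hx
    exact hM (x, s) ⟨⟨hx.1.le, hx.2⟩, ⟨hs.1.le, hs.2.le⟩⟩
  · exact intervalIntegrable_const
  · refine Filter.Eventually.of_forall fun x _ s hs => ?_
    exact (hu.heat s (by linarith [hs.1]) x).const_mul _

/-- Freezing the time at `0` for negative arguments gives a function continuous on the whole line.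
-/
theorem IsHeatSolution.continuous_fourierInt (hu : IsHeatSolution f u) (k : ℤ) :
    Continuous fun s => fourierInt (fun x => u x (max s 0)) k := by
  refine intervalIntegral.continuous_parametric_intervalIntegral_of_continuous'
    (f := fun s x => wave (-k) x * u x (max s 0)) ?_ _ _
  refine ((continuous_wave _).comp continuous_snd).mul ?_
  exact hu.continuousOn.comp_continuous (f := fun p : ℝ × ℝ => (p.2, max p.1 0)) (by fun_prop)
    (fun p => ⟨Set.mem_univ _, Set.mem_Ici.2 (le_max_right _ _)⟩)

/-- `exp(k²s)` times the coefficient has zero derivative for `s > 0` and is continuous at `0`, hence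
constant. This determines the heat solution from its data without a separate uniqueness theorem. -/
theorem IsHeatSolution.fourierInt_eq (hu : IsHeatSolution f u) {t : ℝ} (ht : 0 ≤ t) (k : ℤ) :
    fourierInt (fun x => u x t) k = Real.exp (-(k : ℝ) ^ 2 * t) * fourierInt f k := by
  rcases ht.eq_or_lt with rfl | ht
  · simp [hu.initial]
  let G : ℝ → ℂ := fun s => (Real.exp ((k : ℝ) ^ 2 * s) : ℂ)
    * fourierInt (fun x => u x (max s 0)) k
  have hG : Continuous G := by
    refine Continuous.mul ?_ (hu.continuous_fourierInt k)
    exact Complex.continuous_ofReal.comp (by fun_prop)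
  have hder : ∀ s, 0 < s → HasDerivAt G 0 s := by
    intro s hs
    have h1 : HasDerivAt (fun s => fourierInt (fun x => u x (max s 0)) k)
        (-(k : ℂ) ^ 2 * fourierInt (fun x => u x s) k) s := by
      refine (hu.hasDerivAt_fourierInt hs k).congr_of_eventuallyEq ?_
      filter_upwards [lt_mem_nhds hs] with r hr
      rw [max_eq_left hr.le]
    have h2 := (hasDerivAt_exp_mul ((k : ℝ) ^ 2) s).ofReal_comp
    refine (h2.mul h1).congr_deriv ?_
    rw [max_eq_left hs.le]
    push_cast
    ring
  have hconst : ∀ s ∈ Set.Ioo 0 t, G s = G t := by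
    intro s hs
    have := constant_of_has_deriv_right_zero (f := G) (a := s) (b := t) hG.continuousOn
      (fun r hr => (hder r (hs.1.trans_le hr.1)).hasDerivWithinAt) t
      (Set.right_mem_Icc.2 hs.2.le)
    exact this.symm
  -- No derivative is available at `s = 0`, so the value there is reached by a right limit.
  have hlim : G 0 = G t := by
    have h1 : Filter.Tendsto G (nhdsWithin 0 (Set.Ioi 0)) (nhds (G 0)) :=
      hG.continuousAt.tendsto.mono_left nhdsWithin_le_nhds
    have h2 : Filter.Tendsto G (nhdsWithin 0 (Set.Ioi 0)) (nhds (G t)) := by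
      refine Filter.Tendsto.congr' ?_ tendsto_const_nhds
      filter_upwards [Ioo_mem_nhdsGT ht] with s hs
      exact (hconst s hs).symm
    exact tendsto_nhds_unique h1 h2
  simp only [G, max_self, hu.initial, max_eq_left ht.le, mul_zero, Real.exp_zero,
    Complex.ofReal_one, one_mul] at hlim
  rw [hlim, ← mul_assoc, ← Complex.ofReal_mul, ← Real.exp_add]
  simp

theorem IsHeatSolution.hasSum (hu : IsHeatSolution f u)
    (hf : ContDiff ℝ ((⊤ : ℕ∞) : WithTop ℕ∞) f) {t : ℝ} (ht : 0 ≤ t) (x : ℝ) :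
    HasSum (fun k : ℤ => fourierInt f k / (2 * Real.pi) * waveSol k x t) (u x t) := by
  have hp := hu.periodic_initial
  have hs : Summable fun k => fourierInt (fun x => u x t) k := by
    refine Summable.of_norm_bounded (summable_pow_mul_fourierInt hf hp 0) fun k => ?_
    rw [hu.fourierInt_eq ht, norm_mul, Complex.norm_real, Real.norm_eq_abs,
      abs_of_pos (Real.exp_pos _), pow_zero]
    refine mul_le_mul_of_nonneg_right (Real.exp_le_one_iff.2 ?_) (norm_nonneg _)
    nlinarith [sq_nonneg (k : ℝ)]
  have h := hasSum_fourierInt (hu.continuous_slice ht) (hu.periodic t ht) hs x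
  refine h.congr_fun fun k => ?_
  rw [hu.fourierInt_eq ht, waveSol]
  ring

end Heat

/-! ### Errors of arbitrary modes -/

/-- Because the nodes are offset by `h/4`, `exp(2iNx)` equals `-1` rather than `1` on the grid. -/
theorem mode_add_two_mul (N : ℕ) [NeZero N] (k q : ℤ) :
    mode N (k + 2 * N * q) = ((-1 : ℂ) ^ q) • mode N k := by
  ext ⟨j, b⟩
  have hz : ∀ x, wave (2 * N * q) x = (wave N x ^ 2) ^ q := by
    intro x
    unfold wave
    rw [← Complex.exp_nat_mul, ← Complex.exp_int_mul]
    push_cast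
    ring_nf
  obtain ⟨h0, h1⟩ := wave_natCast_node N j
  fin_cases b
  · simp only [Fin.zero_eta, mode, proj, wave_add_freq, hz, h0, Complex.I_sq, Pi.smul_apply,
      smul_eq_mul]
    exact mul_comm _ _
  · simp only [Fin.mk_one, mode, proj, wave_add_freq, hz, h1, neg_sq, Complex.I_sq,
      Pi.smul_apply, smul_eq_mul]
    exact mul_comm _ _

/-- Reduce `k` modulo `2N` to a representative `r ∈ (-N, N]`. If `r` is not low, it is the high
frequency of `r - N` or `r + N`. -/
theorem exists_mode_alias (N : ℕ) [NeZero N] (k : ℤ) :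
    ∃ ω : ℤ, |2 * ω| ≤ N ∧ ∃ ε : ℂ, ‖ε‖ = 1 ∧
      (mode N k = ε • mode N ω ∨ mode N k = ε • mode N (highFreq N ω)) := by
  have : NeZero (2 * N) := ⟨by have := NeZero.ne N; omega⟩
  set r : ℤ := (k : ZMod (2 * N)).valMinAbs with hr
  have h1 := (k : ZMod (2 * N)).valMinAbs_mem_Ioc
  rw [← hr] at h1
  have h2 : ((r : ℤ) : ZMod (2 * N)) = k := (k : ZMod (2 * N)).coe_valMinAbs
  rw [ZMod.intCast_eq_intCast_iff_dvd_sub] at h2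
  obtain ⟨q, hq⟩ := h2
  have hk : k = r + 2 * N * q := by push_cast at hq; linarith
  have hmode : mode N k = ((-1 : ℂ) ^ q) • mode N r := by rw [hk, mode_add_two_mul]
  have hε : ‖((-1 : ℂ) ^ q)‖ = 1 := by simp
  obtain ⟨h3, h4⟩ := h1
  push_cast at h3 h4
  by_cases hlow : |2 * r| ≤ N
  · exact ⟨r, hlow, _, hε, Or.inl hmode⟩
  · by_cases hpos : 0 < r
    · rw [abs_of_pos (by linarith)] at hlow
      refine ⟨r - N, abs_le.2 ⟨by omega, by omega⟩, _, hε, Or.inr ?_⟩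
      rw [hmode, highFreq, if_neg (by omega), sub_add_cancel]
    · rw [abs_of_nonpos (by linarith)] at hlow
      refine ⟨r + N, abs_le.2 ⟨by omega, by omega⟩, _, hε, Or.inr ?_⟩
      rw [hmode, highFreq, if_pos (by omega), add_sub_cancel_right]

section ModeErrors

variable {c : ℝ}

theorem semigroup_mode_low (hc : c < 2) {N : ℕ} [NeZero N] {ω : ℤ} (hω : |2 * ω| ≤ N) {t : ℝ}
    (ht : 0 ≤ t) :
    semigroup c N t (mode N ω) = (ampLowLow c (meshSize N) ω t : ℂ) • mode N ω
        + (ampLowHigh c (meshSize N) ω t : ℂ) • mode N (highFreq N ω) :=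
  (isSemidiscreteSolution_semigroup _).eq (isSemidiscreteSolution_low hc hω) ht

theorem semigroup_mode_high (hc : c < 2) {N : ℕ} [NeZero N] {ω : ℤ} (hω : |2 * ω| ≤ N) {t : ℝ}
    (ht : 0 ≤ t) :
    semigroup c N t (mode N (highFreq N ω)) = (ampHighLow c (meshSize N) ω t : ℂ) • mode N ω
        + (ampHighHigh c (meshSize N) ω t : ℂ) • mode N (highFreq N ω) :=
  (isSemidiscreteSolution_semigroup _).eq (isSemidiscreteSolution_high hc hω) ht

theorem norm_add_smul_mode_le {N : ℕ} (a b : ℝ) (k l : ℤ) (p : ZMod N × Fin 2) :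
    ‖((a : ℂ) • mode N k + (b : ℂ) • mode N l) p‖ ≤ |a| + |b| := by
  rw [Pi.add_apply, Pi.smul_apply, Pi.smul_apply]
  refine (norm_add_le _ _).trans ?_
  rw [norm_smul, norm_smul, norm_mode, norm_mode, Complex.norm_real, Complex.norm_real]
  simp

theorem exists_semigroup_mode_bound (hc : c < 2) :
    ∃ K : ℝ, 0 ≤ K ∧ ∀ (N : ℕ) [NeZero N] (k : ℤ) (t : ℝ), 0 ≤ t → ∀ p,
      ‖semigroup c N t (mode N k) p‖ ≤ K := by
  obtain ⟨K, hK0, hK⟩ := exists_amp_bound hc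
  refine ⟨2 * K, by positivity, fun N _ k t ht p => ?_⟩
  obtain ⟨ω, hω, ε, hε, h⟩ := exists_mode_alias N k
  obtain ⟨h1, h2, h3, h4⟩ := hK (meshSize N) ω t (meshSize_pos N) (abs_meshSize_mul_le hω) ht
  rcases h with h | h
  · rw [h, map_smul, Pi.smul_apply, norm_smul, hε, one_mul, semigroup_mode_low hc hω ht]
    refine (norm_add_smul_mode_le _ _ _ _ _).trans ?_
    linarith
  · rw [h, map_smul, Pi.smul_apply, norm_smul, hε, one_mul, semigroup_mode_high hc hω ht]
    refine (norm_add_smul_mode_le _ _ _ _ _).trans ?_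
    linarith

/-- Resolved frequencies use the amplitude expansions. For unresolved ones `|k|h ≥ 1`, so the
trivial stability bound `1 + K` is already of the required form for every power. -/
theorem exists_mode_error_bound (hc : c < 2) :
    ∃ C : ℝ, 0 ≤ C ∧ ∀ (N : ℕ) [NeZero N] (k : ℤ) (t : ℝ), 0 ≤ t → ∀ p,
      ‖waveSol k (node N p) t - semigroup c N t (mode N k) p‖
        ≤ C * (|(k : ℝ)| ^ 4 * meshSize N ^ 4) ∧
      (c = -4 / 13 → ‖waveSol k (node N p) t - semigroup c N t (mode N k) p‖
        ≤ C * (|(k : ℝ)| ^ 5 * meshSize N ^ 5)) := by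
  obtain ⟨K, hK0, hK⟩ := exists_semigroup_mode_bound hc
  obtain ⟨C, hC0, hC⟩ := exists_ampLow_error_bounds hc
  -- The low amplitude costs `C`, and the fifth-order high amplitude costs `Cπ` when measured at
  -- order four or `C` at order five; `1 + K` serves the unresolved frequencies.
  refine ⟨C * (2 + Real.pi) + (1 + K), by positivity, fun N _ k t ht p => ?_⟩
  have hpos := meshSize_pos N
  have hθ : |meshSize N * (k : ℝ)| = |(k : ℝ)| * meshSize N := by
    rw [abs_mul, abs_of_pos hpos, mul_comm]
  rw [← mul_pow, ← mul_pow, ← hθ]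
  by_cases hk : |2 * k| ≤ N
  · have hle := abs_meshSize_mul_le hk
    obtain ⟨h1, h2, h3⟩ := hC (meshSize N) k t hpos hle ht
    have e : waveSol k (node N p) t - semigroup c N t (mode N k) p
        = (((Real.exp (-(k : ℝ) ^ 2 * t) - ampLowLow c (meshSize N) k t : ℝ) : ℂ) • mode N k
          + ((-ampLowHigh c (meshSize N) k t : ℝ) : ℂ) • mode N (highFreq N k)) p := by
      rw [semigroup_mode_low hc hk ht]
      simp only [waveSol, Pi.add_apply, Pi.smul_apply, smul_eq_mul, mode, proj]
      push_cast
      ring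
    have hn := norm_add_smul_mode_le (N := N)
      (Real.exp (-(k : ℝ) ^ 2 * t) - ampLowLow c (meshSize N) k t)
      (-ampLowHigh c (meshSize N) k t) k (highFreq N k) p
    rw [← e, abs_neg, abs_sub_comm] at hn
    set θ := |meshSize N * (k : ℝ)|
    have hθ0 : 0 ≤ θ := abs_nonneg _
    have h54 : C * θ ^ 5 ≤ C * Real.pi * θ ^ 4 := by
      calc C * θ ^ 5 = C * θ * θ ^ 4 := by ring
        _ ≤ _ := by gcongr
    have p4 : 0 ≤ (C + 1 + K) * θ ^ 4 := by positivity
    have p5 : 0 ≤ (C * Real.pi + 1 + K) * θ ^ 5 := by positivity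
    refine ⟨by linarith, fun h => ?_⟩
    have := h3 h
    linarith
  · have hlarge : 1 ≤ |meshSize N * (k : ℝ)| := by
      have h1 : (N : ℝ) ≤ 2 * |(k : ℝ)| := by
        have : (N : ℤ) ≤ |2 * k| := (not_le.1 hk).le
        have h' : (N : ℝ) ≤ |2 * (k : ℝ)| := by exact_mod_cast this
        rwa [abs_mul, abs_two] at h'
      rw [hθ]
      nlinarith [natCast_mul_meshSize N, Real.pi_gt_three]
    have hn : ‖waveSol k (node N p) t - semigroup c N t (mode N k) p‖ ≤ 1 + K := by
      refine (norm_sub_le _ _).trans (add_le_add ?_ (hK N k t ht p))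
      rw [waveSol, norm_mul, norm_wave, mul_one, Complex.norm_real, Real.norm_eq_abs,
        abs_of_pos (Real.exp_pos _), Real.exp_le_one_iff]
      nlinarith [sq_nonneg (k : ℝ)]
    have key : ∀ n : ℕ, 1 + K ≤ (C * (2 + Real.pi) + (1 + K)) * |meshSize N * (k : ℝ)| ^ n := by
      intro n
      have h1 : 1 ≤ |meshSize N * (k : ℝ)| ^ n := one_le_pow₀ hlarge
      have h2 : 0 ≤ C * (2 + Real.pi) := by positivity
      nlinarith
    exact ⟨hn.trans (key 4), fun _ => hn.trans (key 5)⟩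

/-- The grid data is written as the sum of all integer modes, unresolved ones included, and the
continuous linear semigroup acts termwise. No separate treatment of interpolation or aliasing errors
is needed; the sum converges because `|k|ⁿ` times the coefficients is summable. -/
theorem exists_gridNorm_globalError_le (hc : c < 2) {f : ℝ → ℂ} {u : ℝ → ℝ → ℂ}
    (hf : ContDiff ℝ ((⊤ : ℕ∞) : WithTop ℕ∞) f) (hu : IsHeatSolution f u) :
    ∃ C : ℝ, ∀ (N : ℕ) [NeZero N] (v : ℝ → Grid N),
      IsSemidiscreteSolution c N (proj N f) v → ∀ t : ℝ, 0 ≤ t →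
        gridNorm N (globalError N u v t) ≤ C * meshSize N ^ 4 ∧
        (c = -4 / 13 → gridNorm N (globalError N u v t) ≤ C * meshSize N ^ 5) := by
  obtain ⟨C, hC0, hC⟩ := exists_mode_error_bound hc
  have hp := hu.periodic_initial
  have hS := fun n => summable_pow_mul_fourierInt hf hp n
  set A : ℕ → ℝ := fun n => ∑' k : ℤ, |(k : ℝ)| ^ n * ‖fourierInt f k‖ with hA
  have hA0 : ∀ n, 0 ≤ A n := fun n => tsum_nonneg fun k => by positivity
  refine ⟨Real.sqrt (2 * Real.pi) * (C / (2 * Real.pi) * (A 4 + A 5)),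
    fun N _ v hv t ht => ?_⟩
  have hpos := meshSize_pos N
  have hproj : HasSum (fun k : ℤ => (fourierInt f k / (2 * Real.pi)) • mode N k) (proj N f) := by
    refine Pi.hasSum.2 fun p => ?_
    have h := hu.hasSum hf le_rfl (node N p)
    simpa [waveSol, hu.initial, mode, proj] using h
  have hv' : HasSum (fun k : ℤ => (fourierInt f k / (2 * Real.pi)) • semigroup c N t (mode N k))
      (v t) := by
    rw [hv.eq (isSemidiscreteSolution_semigroup _) ht]
    simpa only [map_smul] using (semigroup c N t).hasSum hproj
  have hE : ∀ p, HasSum (fun k : ℤ => fourierInt f k / (2 * Real.pi)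
      * (waveSol k (node N p) t - semigroup c N t (mode N k) p)) (globalError N u v t p) := by
    intro p
    have h1 := (hu.hasSum hf ht (node N p)).sub (Pi.hasSum.1 hv' p)
    refine h1.congr_fun fun k => ?_
    rw [Pi.smul_apply, smul_eq_mul]
    ring
  have hpoint : ∀ n : ℕ, (∀ k p, ‖waveSol k (node N p) t - semigroup c N t (mode N k) p‖
      ≤ C * (|(k : ℝ)| ^ n * meshSize N ^ n)) →
      gridNorm N (globalError N u v t)
        ≤ Real.sqrt (2 * Real.pi) * (C / (2 * Real.pi) * A n * meshSize N ^ n) := by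
    intro n hn
    have := hA0 n
    refine gridNorm_le (by positivity) fun p => ?_
    have hsum : HasSum (fun k : ℤ => C / (2 * Real.pi) * meshSize N ^ n
        * (|(k : ℝ)| ^ n * ‖fourierInt f k‖)) (C / (2 * Real.pi) * meshSize N ^ n * A n) :=
      (hS n).hasSum.mul_left _
    refine ((hE p).norm_le_of_bounded hsum fun k => ?_).trans (le_of_eq (by ring))
    rw [norm_mul, norm_div, norm_mul, Complex.norm_ofNat, Complex.norm_real, Real.norm_eq_abs,
      abs_of_pos Real.pi_pos]
    calc ‖fourierInt f k‖ / (2 * Real.pi)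
          * ‖waveSol k (node N p) t - semigroup c N t (mode N k) p‖
        ≤ ‖fourierInt f k‖ / (2 * Real.pi) * (C * (|(k : ℝ)| ^ n * meshSize N ^ n)) := by
          gcongr
          exact hn k p
      _ = _ := by ring
  have hfinal : ∀ n : ℕ, A n ≤ A 4 + A 5 →
      Real.sqrt (2 * Real.pi) * (C / (2 * Real.pi) * A n * meshSize N ^ n)
        ≤ Real.sqrt (2 * Real.pi) * (C / (2 * Real.pi) * (A 4 + A 5)) * meshSize N ^ n := by
    intro n hn
    rw [mul_assoc (Real.sqrt (2 * Real.pi))]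
    gcongr
  refine ⟨?_, fun hc4 => ?_⟩
  · exact (hpoint 4 fun k p => (hC N k t ht p).1).trans
      (hfinal 4 (le_add_of_nonneg_right (hA0 5)))
  · exact (hpoint 5 fun k p => (hC N k t ht p).2 hc4).trans
      (hfinal 5 (le_add_of_nonneg_left (hA0 4)))

end ModeErrors

/-! ### Fourier data -/

section FourierData

variable {c : ℝ}

/-- The exponent is at most a negative multiple of `t/h²`, so `e^{-x} ≤ 1/x` even gives `h²`. One
power of `h` is enough, since this exponential is always multiplied by `h⁵`. -/
theorem exists_exp_Qhat2_le (hc : c < 2) {t : ℝ} (ht : 0 < t) :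
    ∃ K : ℝ, 0 ≤ K ∧ ∀ (N : ℕ) [NeZero N] (ω : ℝ),
      Real.exp (Qhat2 c (meshSize N) ω * t) ≤ K * meshSize N := by
  have hm : 0 < 2 - c := by linarith
  refine ⟨3 * (2 * Real.pi) / (4 * (2 - c) * t), by positivity, fun N _ ω => ?_⟩
  have hpos := meshSize_pos N
  set x : ℝ := 4 * (2 - c) / (3 * meshSize N ^ 2) * t with hx
  have hx0 : 0 < x := by positivity
  have h1 : Qhat2 c (meshSize N) ω * t ≤ -(1 * x) := by
    have := mul_le_mul_of_nonneg_right (Qhat2_le hc (meshSize N) ω) ht.le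
    rw [hx]
    refine this.trans (le_of_eq (by ring))
  have h2 : Real.exp (-(1 * x)) ≤ 1 / x := by
    rw [le_div_iff₀ hx0, mul_comm]
    simpa using mul_exp_neg_le (δ := 1) (τ := x) one_pos
  calc Real.exp (Qhat2 c (meshSize N) ω * t) ≤ 1 / x := (Real.exp_le_exp.2 h1).trans h2
    _ = 3 * meshSize N / (4 * (2 - c) * t) * meshSize N := by rw [hx]; field_simp
    _ ≤ 3 * (2 * Real.pi) / (4 * (2 - c) * t) * meshSize N := by
        gcongr
        exact meshSize_le N

theorem exists_fixed_time_expansion (hc : c < 2) (ω : ℤ) {t : ℝ} (ht : 0 < t) :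
    ∃ C : ℝ, 0 ≤ C ∧ ∀ (N : ℕ) [NeZero N], |2 * ω| ≤ N →
      |ampLowLow c (meshSize N) ω t - Real.exp (-(ω : ℝ) ^ 2 * t)
          * (1 - (4 + 13 * c) * (ω : ℝ) ^ 6 * t * meshSize N ^ 4 / (2880 * (-2 + c)))|
        ≤ C * meshSize N ^ 6 ∧
      |ampLowHigh c (meshSize N) ω t
          - -(c * (|(ω : ℝ)| * meshSize N) ^ 5 / (1024 * (-2 + c)))
            * Real.exp (-(ω : ℝ) ^ 2 * t)| ≤ C * meshSize N ^ 6 := by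
  obtain ⟨C, hC0, hC⟩ := exists_ampLow_bounds hc
  obtain ⟨K, hK0, hK⟩ := exists_exp_Qhat2_le hc ht
  set ρ : ℝ := |c| / |1024 * (-2 + c)| with hρ
  have hρ0 : 0 ≤ ρ := by positivity
  refine ⟨C * |(ω : ℝ)| ^ 6 + ρ * |(ω : ℝ)| ^ 5 * K, by positivity, fun N _ hω => ?_⟩
  have hpos := meshSize_pos N
  obtain ⟨h1, h2⟩ := hC (meshSize N) ω t hpos (abs_meshSize_mul_le hω) ht.le
  have p6 : 0 ≤ ρ * |(ω : ℝ)| ^ 5 * K * meshSize N ^ 6 := by positivity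
  constructor
  · refine h1.trans ?_
    rw [mul_pow]
    linarith
  · set η : ℝ := -(c * (|(ω : ℝ)| * meshSize N) ^ 5 / (1024 * (-2 + c))) with hη
    have hηabs : |η| = ρ * |(ω : ℝ)| ^ 5 * meshSize N ^ 5 := by
      rw [hη, abs_neg, abs_div, abs_mul, abs_pow, abs_mul, abs_abs, abs_of_pos hpos, hρ]
      ring
    have h3 : |η * Real.exp (Qhat2 c (meshSize N) ω * t)|
        ≤ ρ * |(ω : ℝ)| ^ 5 * K * meshSize N ^ 6 := by
      rw [abs_mul, hηabs, abs_of_pos (Real.exp_pos _)]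
      calc ρ * |(ω : ℝ)| ^ 5 * meshSize N ^ 5 * Real.exp (Qhat2 c (meshSize N) ω * t)
          ≤ ρ * |(ω : ℝ)| ^ 5 * meshSize N ^ 5 * (K * meshSize N) := by
            gcongr
            exact hK N ω
        _ = _ := by ring
    have h4 := abs_sub (ampLowHigh c (meshSize N) ω t - η * (Real.exp (-(ω : ℝ) ^ 2 * t)
      - Real.exp (Qhat2 c (meshSize N) ω * t))) (η * Real.exp (Qhat2 c (meshSize N) ω * t))
    rw [show ampLowHigh c (meshSize N) ω t - η * (Real.exp (-(ω : ℝ) ^ 2 * t)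
      - Real.exp (Qhat2 c (meshSize N) ω * t)) - η * Real.exp (Qhat2 c (meshSize N) ω * t)
      = ampLowHigh c (meshSize N) ω t - η * Real.exp (-(ω : ℝ) ^ 2 * t) by ring] at h4
    rw [mul_pow] at h2
    linarith

/-- For use with `a` dominant: a single mode has an exact norm, and the reverse triangle inequality
makes orthogonality of the modes unnecessary. -/
theorem abs_gridNorm_two_modes_sub_le {N : ℕ} [NeZero N] (a b X : ℝ) (k l : ℤ) :
    |gridNorm N ((a : ℂ) • mode N k + (b : ℂ) • mode N l) - Real.sqrt (2 * Real.pi) * X|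
      ≤ Real.sqrt (2 * Real.pi) * (|b| + |(|a|) - X|) := by
  have h1 := abs_gridNorm_sub_le ((a : ℂ) • mode N k + (b : ℂ) • mode N l) ((a : ℂ) • mode N k)
  rw [add_sub_cancel_left, gridNorm_smul_mode, gridNorm_smul_mode, Complex.norm_real,
    Complex.norm_real, Real.norm_eq_abs, Real.norm_eq_abs] at h1
  have h2 : |Real.sqrt (2 * Real.pi) * |a| - Real.sqrt (2 * Real.pi) * X|
      = Real.sqrt (2 * Real.pi) * |(|a|) - X| := by
    rw [← mul_sub, abs_mul, abs_of_nonneg (Real.sqrt_nonneg _)]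
  have h3 := abs_sub_le (gridNorm N ((a : ℂ) • mode N k + (b : ℂ) • mode N l))
    (Real.sqrt (2 * Real.pi) * |a|) (Real.sqrt (2 * Real.pi) * X)
  linarith

/-- The error has a low part, `h⁴` plus `O(h⁶)`, and a high part of order `h⁵`. The low part leads
in general; at `c = -4/13` its `h⁴` term vanishes and the high part takes over. -/
theorem exists_globalError_wave (hc : c < 2) (ω : ℤ) {t : ℝ} (ht : 0 < t) :
    ∃ C : ℝ, ∀ (N : ℕ) [NeZero N], |2 * ω| ≤ N →
      ∀ v, IsSemidiscreteSolution c N (mode N ω) v →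
        |gridNorm N (globalError N (waveSol ω) v t)
            - Real.sqrt (2 * Real.pi) * (|4 + 13 * c| * (ω : ℝ) ^ 6 * t / (2880 * (2 - c)))
              * Real.exp (-(ω : ℝ) ^ 2 * t) * meshSize N ^ 4| ≤ C * meshSize N ^ 5 ∧
        (c = -4 / 13 →
          |gridNorm N (globalError N (waveSol ω) v t)
              - Real.sqrt (2 * Real.pi) * (|c| * |(ω : ℝ)| ^ 5 / (1024 * (2 - c)))
                * Real.exp (-(ω : ℝ) ^ 2 * t) * meshSize N ^ 5| ≤ C * meshSize N ^ 6) := by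
  obtain ⟨C, hC0, hC⟩ := exists_fixed_time_expansion hc ω ht
  have hm : 0 < 2 - c := by linarith
  set e : ℝ := Real.exp (-(ω : ℝ) ^ 2 * t) with he
  have he0 : 0 < e := Real.exp_pos _
  set ρ : ℝ := |c| * |(ω : ℝ)| ^ 5 / (1024 * (2 - c)) with hρ
  have hρ0 : 0 ≤ ρ := by positivity
  refine ⟨Real.sqrt (2 * Real.pi) * (2 * C * (2 * Real.pi) + ρ * e + 2 * C),
    fun N _ hω v hv => ?_⟩
  have hpos := meshSize_pos N
  obtain ⟨h1, h2⟩ := hC N hω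
  have hE : globalError N (waveSol ω) v t
      = ((e - ampLowLow c (meshSize N) ω t : ℝ) : ℂ) • mode N ω
        + ((-ampLowHigh c (meshSize N) ω t : ℝ) : ℂ) • mode N (highFreq N ω) := by
    rw [globalError, hv.eq (isSemidiscreteSolution_low hc hω) ht.le]
    ext p
    simp only [proj, waveSol, Pi.sub_apply, Pi.add_apply, Pi.smul_apply, smul_eq_mul, mode,
      Complex.ofReal_sub, Complex.ofReal_neg, ← he]
    ring
  set a : ℝ := ampLowLow c (meshSize N) ω t
  set b : ℝ := ampLowHigh c (meshSize N) ω t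
  have habs2 : |-2 + c| = 2 - c := by rw [abs_of_neg (by linarith)]; ring
  have hη : |-(c * (|(ω : ℝ)| * meshSize N) ^ 5 / (1024 * (-2 + c))) * e|
      = ρ * e * meshSize N ^ 5 := by
    rw [abs_mul, abs_neg, abs_div, abs_mul, abs_mul, habs2, abs_pow, abs_mul, abs_abs,
      abs_of_pos hpos, abs_of_pos he0, abs_of_pos (by norm_num : (0 : ℝ) < 1024), hρ]
    ring
  have hX : |(4 + 13 * c) * (ω : ℝ) ^ 6 * t * meshSize N ^ 4 / (2880 * (-2 + c)) * e|
      = |4 + 13 * c| * (ω : ℝ) ^ 6 * t / (2880 * (2 - c)) * e * meshSize N ^ 4 := by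
    rw [abs_mul, abs_div, abs_mul, abs_mul, abs_mul, abs_mul 2880, habs2, abs_of_pos he0,
      abs_of_pos ht, abs_of_pos (by positivity : 0 < meshSize N ^ 4),
      abs_of_nonneg (by positivity : 0 ≤ (ω : ℝ) ^ 6), abs_of_pos (by norm_num : (0 : ℝ) < 2880)]
    ring
  have hC65 : C * meshSize N ^ 6 ≤ C * (2 * Real.pi) * meshSize N ^ 5 := by
    calc C * meshSize N ^ 6 = C * meshSize N * meshSize N ^ 5 := by ring
      _ ≤ _ := by gcongr; exact meshSize_le N
  have hbη : |(|b|) - ρ * e * meshSize N ^ 5| ≤ C * meshSize N ^ 6 := by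
    rw [← hη]
    exact (abs_abs_sub_abs_le _ _).trans h2
  have haX : |(|e - a|) - |4 + 13 * c| * (ω : ℝ) ^ 6 * t / (2880 * (2 - c)) * e * meshSize N ^ 4|
      ≤ C * meshSize N ^ 6 := by
    rw [← hX]
    refine (abs_abs_sub_abs_le _ _).trans ?_
    rw [← abs_neg]
    refine le_trans (le_of_eq ?_) h1
    congr 1
    ring
  have p5 : 0 ≤ meshSize N ^ 5 := by positivity
  have p6 : 0 ≤ meshSize N ^ 6 := by positivity
  rw [hE]
  constructor
  · have h := abs_gridNorm_two_modes_sub_le (N := N) (e - a) (-b)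
      (|4 + 13 * c| * (ω : ℝ) ^ 6 * t / (2880 * (2 - c)) * e * meshSize N ^ 4) ω (highFreq N ω)
    rw [← mul_assoc, ← mul_assoc, abs_neg] at h
    refine h.trans ?_
    rw [mul_assoc (Real.sqrt (2 * Real.pi))]
    refine mul_le_mul_of_nonneg_left ?_ (Real.sqrt_nonneg _)
    have hb : |b| ≤ C * meshSize N ^ 6 + ρ * e * meshSize N ^ 5 := by
      linarith [(abs_le.1 hbη).2]
    have : 0 ≤ 2 * C * meshSize N ^ 5 := by positivity
    linarith
  · intro hc4
    have h0 : |4 + 13 * c| = 0 := by rw [hc4]; norm_num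
    rw [h0, zero_mul, zero_mul, zero_div, zero_mul, zero_mul, sub_zero, abs_abs] at haX
    -- The high mode is now the dominant one, so the two summands exchange roles.
    rw [add_comm]
    have h := abs_gridNorm_two_modes_sub_le (N := N) (-b) (e - a)
      (ρ * e * meshSize N ^ 5) (highFreq N ω) ω
    rw [← mul_assoc, ← mul_assoc, abs_neg] at h
    refine h.trans ?_
    rw [mul_assoc (Real.sqrt (2 * Real.pi))]
    refine mul_le_mul_of_nonneg_left ?_ (Real.sqrt_nonneg _)
    have : 0 ≤ (2 * C * (2 * Real.pi) + ρ * e) * meshSize N ^ 6 := by positivity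
    linarith

end FourierData

/-! ### Assembly of the theorem -/

theorem aliasing {N : ℕ} [NeZero N] (ω : ℤ) (j : ZMod N) :
    (0 < ω → mode N ω (j, 0) = I * mode N (highFreq N ω) (j, 0) ∧
        mode N ω (j, 1) = -I * mode N (highFreq N ω) (j, 1)) ∧
      (ω < 0 → mode N ω (j, 0) = -I * mode N (highFreq N ω) (j, 0) ∧
        mode N ω (j, 1) = I * mode N (highFreq N ω) (j, 1)) := by
  have h0 := congrFun (mode_eq_highFreq N ω) (j, 0)
  have h1 := congrFun (mode_eq_highFreq N ω) (j, 1)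
  simp only [diagMul, if_true, one_ne_zero, if_false] at h0 h1
  refine ⟨fun h => ?_, fun h => ?_⟩
  · rw [h0, h1]
    simp [aliasSign, h]
  · rw [h0, h1]
    simp [aliasSign, not_lt.2 h.le]

end BFD

end

theorem mainTheorem2 (c : ℝ) (hc : c < 2) :
    -- aliasing of each low mode with its high mode
    (∀ (N : ℕ) [NeZero N] (ω : ℤ), |2 * ω| ≤ N → ∀ j : ZMod N,
      (0 < ω →
        BFD.mode N ω (j, 0) = Complex.I * BFD.mode N (BFD.highFreq N ω) (j, 0) ∧
        BFD.mode N ω (j, 1) = -Complex.I * BFD.mode N (BFD.highFreq N ω) (j, 1)) ∧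
      (ω < 0 →
        BFD.mode N ω (j, 0) = -Complex.I * BFD.mode N (BFD.highFreq N ω) (j, 0) ∧
        BFD.mode N ω (j, 1) = Complex.I * BFD.mode N (BFD.highFreq N ω) (j, 1))) ∧
    -- action of the operator on the low and on the high mode
    (∀ (N : ℕ) [NeZero N] (ω : ℤ), |2 * ω| ≤ N →
      BFD.blockOp c N (BFD.mode N ω) =
        BFD.diagMul (BFD.mu1 c (BFD.meshSize N) ω) (BFD.mu2 c (BFD.meshSize N) ω)
          (BFD.mode N ω) ∧
      BFD.blockOp c N (BFD.mode N (BFD.highFreq N ω)) =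
        BFD.diagMul (BFD.sigma1 c (BFD.meshSize N) ω) (BFD.sigma2 c (BFD.meshSize N) ω)
          (BFD.mode N (BFD.highFreq N ω))) ∧
    -- the `2 × 2` eigenvalue system of each block, with explicit solutions
    (c ≠ 0 → ∀ (N : ℕ) [NeZero N] (ω : ℤ), |2 * ω| ≤ N → ω ≠ 0 →
      ∀ rq ∈ ({(BFD.r1 c (BFD.meshSize N) ω, BFD.Qhat1 c (BFD.meshSize N) ω),
          (BFD.r2 c (BFD.meshSize N) ω, BFD.Qhat2 c (BFD.meshSize N) ω)} : Set (ℂ × ℝ)),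
        BFD.mu1 c (BFD.meshSize N) ω - BFD.sigma1 c (BFD.meshSize N) ω * rq.1
          = (rq.2 : ℂ) * (1 - rq.1) ∧
        BFD.mu2 c (BFD.meshSize N) ω + BFD.sigma2 c (BFD.meshSize N) ω * rq.1
          = (rq.2 : ℂ) * (1 + rq.1)) ∧
    -- normalized eigenvectors inside each block
    (∀ (N : ℕ) [NeZero N] (ω : ℤ), |2 * ω| ≤ N →
      ‖(BFD.coeff1 c (BFD.meshSize N) ω).1‖ ^ 2
        + ‖(BFD.coeff1 c (BFD.meshSize N) ω).2‖ ^ 2 = 1 ∧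
      ‖(BFD.coeff2 c (BFD.meshSize N) ω).1‖ ^ 2
        + ‖(BFD.coeff2 c (BFD.meshSize N) ω).2‖ ^ 2 = 1 ∧
      ∀ k : Fin 2, BFD.blockOp c N (BFD.psi c N ω k)
        = (BFD.Qhat c N ω k : ℂ) • BFD.psi c N ω k) ∧
    -- they diagonalize the operator
    (∀ (N : ℕ) [NeZero N],
      LinearIndependent ℂ (fun p : BFD.LowFreq N × Fin 2 => BFD.psi c N p.1 p.2) ∧
      Submodule.span ℂ
        (Set.range fun p : BFD.LowFreq N × Fin 2 => BFD.psi c N p.1 p.2) = ⊤) ∧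
    -- expansion of the eigenvalues
    (∃ C : ℝ, ∀ (N : ℕ) [NeZero N] (ω : ℤ), |2 * ω| ≤ N →
      |BFD.Qhat1 c (BFD.meshSize N) ω
          - (-(ω : ℝ) ^ 2
            - (4 + 13 * c) * (ω : ℝ) ^ 6 * BFD.meshSize N ^ 4 / (2880 * (-2 + c)))|
        ≤ C * (ω : ℝ) ^ 8 * BFD.meshSize N ^ 6 ∧
      |BFD.Qhat2 c (BFD.meshSize N) ω
          - (32 * (-2 + c) / (3 * BFD.meshSize N ^ 2) - (-5 + 6 * c) * (ω : ℝ) ^ 2 / 3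
            + (-1 + 3 * c) * (ω : ℝ) ^ 4 * BFD.meshSize N ^ 2 / 18)|
        ≤ C * (ω : ℝ) ^ 6 * BFD.meshSize N ^ 4) ∧
    -- the semi-discrete problem is uniquely solvable
    (∀ (N : ℕ) [NeZero N] (v₀ : BFD.Grid N),
      ∃ v, BFD.IsSemidiscreteSolution c N v₀ v ∧
        ∀ w, BFD.IsSemidiscreteSolution c N v₀ w → Set.EqOn w v (Set.Ici 0)) ∧
    -- the semi-discrete solution for Fourier data, uniformly in time and frequency
    (∃ C : ℝ, ∀ (N : ℕ) [NeZero N] (ω : ℤ), |2 * ω| ≤ N →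
      ∀ v, BFD.IsSemidiscreteSolution c N (BFD.mode N ω) v → ∀ t : ℝ, 0 ≤ t →
        ∃ a b : ℝ,
          v t = (a : ℂ) • BFD.mode N ω + (b : ℂ) • BFD.mode N (BFD.highFreq N ω) ∧
          |a - Real.exp (-(ω : ℝ) ^ 2 * t)
              * (1 - (4 + 13 * c) * (ω : ℝ) ^ 6 * t * BFD.meshSize N ^ 4
                / (2880 * (-2 + c)))|
            ≤ C * (|(ω : ℝ)| * BFD.meshSize N) ^ 6 ∧
          |b - -(c * (|(ω : ℝ)| * BFD.meshSize N) ^ 5 / (1024 * (-2 + c)))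
              * (Real.exp (-(ω : ℝ) ^ 2 * t)
                - Real.exp (BFD.Qhat2 c (BFD.meshSize N) ω * t))|
            ≤ C * (|(ω : ℝ)| * BFD.meshSize N) ^ 6) ∧
    -- the same at a fixed positive time
    (∀ (ω : ℤ) (t : ℝ), 0 < t → ∃ C : ℝ, ∀ (N : ℕ) [NeZero N], |2 * ω| ≤ N →
      ∀ v, BFD.IsSemidiscreteSolution c N (BFD.mode N ω) v →
        ∃ a b : ℝ,
          v t = (a : ℂ) • BFD.mode N ω + (b : ℂ) • BFD.mode N (BFD.highFreq N ω) ∧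
          |a - Real.exp (-(ω : ℝ) ^ 2 * t)
              * (1 - (4 + 13 * c) * (ω : ℝ) ^ 6 * t * BFD.meshSize N ^ 4
                / (2880 * (-2 + c)))|
            ≤ C * BFD.meshSize N ^ 6 ∧
          |b - -(c * (|(ω : ℝ)| * BFD.meshSize N) ^ 5 / (1024 * (-2 + c)))
              * Real.exp (-(ω : ℝ) ^ 2 * t)|
            ≤ C * BFD.meshSize N ^ 6) ∧
    -- exact order of the global error for Fourier data
    (∀ (ω : ℤ) (t : ℝ), 0 < t → ∃ C : ℝ, ∀ (N : ℕ) [NeZero N], |2 * ω| ≤ N →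
      ∀ v, BFD.IsSemidiscreteSolution c N (BFD.mode N ω) v →
        |BFD.gridNorm N (BFD.globalError N (BFD.waveSol ω) v t)
            - Real.sqrt (2 * Real.pi)
              * (|4 + 13 * c| * (ω : ℝ) ^ 6 * t / (2880 * (2 - c)))
              * Real.exp (-(ω : ℝ) ^ 2 * t) * BFD.meshSize N ^ 4|
          ≤ C * BFD.meshSize N ^ 5 ∧
        (c = -4 / 13 →
          |BFD.gridNorm N (BFD.globalError N (BFD.waveSol ω) v t)
              - Real.sqrt (2 * Real.pi) * (|c| * |(ω : ℝ)| ^ 5 / (1024 * (2 - c)))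
                * Real.exp (-(ω : ℝ) ^ 2 * t) * BFD.meshSize N ^ 5|
            ≤ C * BFD.meshSize N ^ 6)) ∧
    -- order of the global error for smooth data
    (∀ (f : ℝ → ℂ) (u : ℝ → ℝ → ℂ), ContDiff ℝ ((⊤ : ℕ∞) : WithTop ℕ∞) f → BFD.IsHeatSolution f u →
      ∃ C : ℝ, ∀ (N : ℕ) [NeZero N] (v : ℝ → BFD.Grid N),
        BFD.IsSemidiscreteSolution c N (BFD.proj N f) v → ∀ t : ℝ, 0 ≤ t →
          BFD.gridNorm N (BFD.globalError N u v t) ≤ C * BFD.meshSize N ^ 4 ∧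
          (c = -4 / 13 →
            BFD.gridNorm N (BFD.globalError N u v t) ≤ C * BFD.meshSize N ^ 5)) ∧
    -- the truncation error is of order three
    (∀ w : ℝ → ℂ, ContDiff ℝ ((⊤ : ℕ∞) : WithTop ℕ∞) w → Function.Periodic w (2 * Real.pi) →
      ∃ C : ℝ, ∀ (N : ℕ) [NeZero N],
        BFD.gridNorm N (BFD.truncError c N w) ≤ C * BFD.meshSize N ^ 3 ∧
        ∀ j : ZMod N,
          ‖BFD.truncError c N w (j, 0)
              - ((c * BFD.meshSize N ^ 3 / 96 : ℝ) : ℂ)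
                * iteratedDeriv 5 w (BFD.node N (j, 0))‖
            ≤ C * BFD.meshSize N ^ 4 ∧
          ‖BFD.truncError c N w (j, 1)
              + ((c * BFD.meshSize N ^ 3 / 96 : ℝ) : ℂ)
                * iteratedDeriv 5 w (BFD.node N (j, 1))‖
            ≤ C * BFD.meshSize N ^ 4) ∧
    -- and, for Fourier modes, of no higher order unless `c = 0`
    (∀ ω : ℤ, ∃ C : ℝ, ∀ (N : ℕ) [NeZero N],
      |BFD.gridNorm N (BFD.truncError c N (BFD.wave ω))
          - Real.sqrt (2 * Real.pi) * (|c| * |(ω : ℝ)| ^ 5 / 96) * BFD.meshSize N ^ 3|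
        ≤ C * BFD.meshSize N ^ 4) := by
  refine ⟨?_, ?_, ?_, ?_, ?_, ?_, ?_, ?_, ?_, ?_, ?_, ?_, ?_⟩
  · intro N _ ω _ j
    exact BFD.aliasing ω j
  · intro N _ ω _
    exact ⟨BFD.blockOp_mode_low c N ω, BFD.blockOp_mode_high c N ω⟩
  · intro hc0 N _ ω hω hω0
    exact BFD.block_system_roots hc0 hω hω0
  · intro N _ ω hω
    exact ⟨BFD.norm_coeff1 _ _ _, BFD.norm_coeff2 hc hω, BFD.blockOp_psi hc hω⟩
  · intro N _
    exact ⟨BFD.linearIndependent_psi hc, BFD.span_psi_eq_top hc⟩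
  · obtain ⟨C₁, -, h₁⟩ := BFD.exists_Qhat1_expansion hc
    obtain ⟨C₂, -, h₂⟩ := BFD.exists_Qhat2_expansion hc
    refine ⟨max C₁ C₂, fun N _ ω hω => ?_⟩
    have hpos := BFD.meshSize_pos N
    have hθ := BFD.abs_meshSize_mul_le hω
    refine ⟨(h₁ _ ω hpos hθ).trans ?_, (h₂ _ ω hpos hθ).trans ?_⟩
    · gcongr
      exact le_max_left _ _
    · gcongr
      exact le_max_right _ _
  · intro N _ v₀
    exact ⟨_, BFD.isSemidiscreteSolution_semigroup v₀,
      fun w hw => hw.eqOn (BFD.isSemidiscreteSolution_semigroup v₀)⟩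
  · obtain ⟨C, -, hC⟩ := BFD.exists_ampLow_bounds hc
    refine ⟨C, fun N _ ω hω v hv t ht => ?_⟩
    obtain ⟨h₁, h₂⟩ := hC _ ω t (BFD.meshSize_pos N) (BFD.abs_meshSize_mul_le hω) ht
    exact ⟨_, _, hv.eq (BFD.isSemidiscreteSolution_low hc hω) ht, h₁, h₂⟩
  · intro ω t ht
    obtain ⟨C, -, hC⟩ := BFD.exists_fixed_time_expansion hc ω ht
    refine ⟨C, fun N _ hω v hv => ?_⟩
    obtain ⟨h₁, h₂⟩ := hC N hω
    exact ⟨_, _, hv.eq (BFD.isSemidiscreteSolution_low hc hω) ht.le, h₁, h₂⟩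
  · intro ω t ht
    exact BFD.exists_globalError_wave hc ω ht
  · intro f u hf hu
    exact BFD.exists_gridNorm_globalError_le hc hf hu
  · intro w hw hp
    obtain ⟨C₁, h₁⟩ := BFD.exists_gridNorm_truncError_le c hw hp
    obtain ⟨C₂, -, h₂⟩ := BFD.exists_truncError_expansion c hw hp
    refine ⟨max C₁ C₂, fun N _ => ?_⟩
    have hpos := BFD.meshSize_pos N
    refine ⟨(h₁ N).trans ?_, fun j => ⟨(h₂ N j).1.trans ?_, (h₂ N j).2.trans ?_⟩⟩
    · gcongr
      exact le_max_left _ _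
    · gcongr
      exact le_max_right _ _
    · gcongr
      exact le_max_right _ _
  · exact BFD.exists_gridNorm_truncError_wave c
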